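/- **Proof formalisation condition for the HF calculus.** *Syntax.* Fix variables $x_0,x_1,x_2,\dots$ Terms are $t::=0\mid x_i\mid t\lhd t$. Formulas are built from $t\in u$, $t=u$ by $\lor$, $\neg$ and $\exists x_i$, and are identified up to renaming of bound variables (nominal syntax); $\land,\to,\leftrightarrow,\forall$ are the usual abbreviations, and $A(x_i::=t)$ is capture-avoiding substitution. Formulas are interpreted in the hereditarily finite sets, with $0=\emptyset$ and $x\lhd y=x\cup\{y\}$. *Calculus.* Fix a formula $E$ (the extra axiom) that is true in the hereditarily finite sets under every assignment. $H\vdash A$ ("$A$ is provable from the set of formulas $H$") is inductively generated by: $H\vdash A$ for $A\in H$; $H\vdash A$ for every axiom $A$; if $H\vdash A\to B$ and $H'\vdash A$ then $H\cup H'\vdash B$; if $H\vdash A\to B$ and $x_i$ is free neither in $B$ nor in any formula of $H$, then $H\vdash(\exists x_i\,A)\to B$. The axioms are: $E$; the Boolean axioms $A\to A$, $A\to A\lor B$, $A\lor A\to A$, $A\lor(B\lor C)\to(A\lor B)\lor C$, $(C\lor A)\to((\neg C\lor B)\to A\lor B)$; the equality axioms $x_1=x_1$, $(x_1=x_2\land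 x_3=x_4)\to(x_1=x_3\to x_2=x_4)$, $(x_1=x_2\land x_3=x_4)\to(x_1\in x_3\to x_2\in x_4)$, $(x_1=x_2\land x_3=x_4)\to x_1\lhd x_3=x_2\lhd x_4$; the special axioms $A(x_i::=t)\to\exists x_i\,A$; the axioms $z=0\leftrightarrow\forall x\,(x\notin z)$ and $z=x\lhd y\leftrightarrow\forall u\,(u\in z\leftrightarrow u\in x\lor u=y)$; and induction $A(x_i::=0)\to\bigl(\forall x_i\forall x_j\,(A\to(A(x_i::=x_j)\to A(x_i::=x_i\lhd x_j)))\to\forall x_i\,A\bigr)$ with $j\ne i$ and $x_j$ not free in $A$. *Coding.* Put $\langle a,b\rangle=\{\{a\},\{a,b\}\}$ (as a term), $\mathrm{succ}(t)=t\lhd t$, $\bar n=\mathrm{succ}^n(0)$, and let $\tau_0=\langle 0,0\rangle$, $\tau_{n+1}=\langle 0,\tau_n\rangle$. A formula $A$ is first translated into de Bruijn syntax, where a bound occurrence of a variable becomes the index $k$ counting the quantifiers between it and its binder. The result is coded by a closed term $\ulcorner A\urcorner$ as follows: $0\mapsto 0$; a free variable $x_i\mapsto\overline{i+1}$; the index $k\mapsto\langle\tau_6,\bar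 k\rangle$; $t\lhd u\mapsto\langle\tau_1,\langle t,u\rangle\rangle$; $t\in u\mapsto\langle\tau_0,\langle t,u\rangle\rangle$; $t=u\mapsto\langle\tau_2,\langle t,u\rangle\rangle$; $A\lor B\mapsto\langle\tau_3,\langle A,B\rangle\rangle$; $\neg A\mapsto\langle\tau_4,A\rangle$; $\exists A\mapsto\langle\tau_5,A\rangle$ (with the components on the right replaced by their codes). *Provability predicate.* $\mathrm{PfP}(y)$ is the explicit HF formula saying: there are an ordinal $k$ and a single-valued set $s$ of pairs with ordinals as first components, defined at least on $0,\dots,k$, with $s_k=y$, such that for each $n\le k$ the entry $s_n$ is the code of an axiom, or follows from entries $s_m,s_l$ with $m,l<n$ by modus ponens, or from one entry $s_m$ with $m<n$ by the $\exists$-rule (with $H=\emptyset$) or by the (derivable) rule that passes from $A$ to $A(x_i::=t)$. The notions used here (code of a term, code of a formula, abstraction of a variable to a de Bruijn index, substitution of a term for a variable, non-occurrence of a variable, and instances of each axiom scheme) are themselves given by HF formulas that assert the existence of a construction sequence of the corresponding kind. **Theorem.** For every such $E$ and every formula $A$, $$\emptyset\vdash A\quad\Longleftrightarrow\quad\emptyset\vdash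 \mathrm{PfP}(\ulcorner A\urcorner).$$ -/

import Mathlib

namespace HFCalc

/-! ### Hereditarily finite sets -/

/-- The universe of hereditarily finite sets, carried by `ℕ` through Ackermann's bijection
`HFSet ≃ Finset HFSet` below (`x ∈ y` iff bit `x` of `y` is set); since members are smaller,
membership is well founded, so this is the inductive universe of finite sets of
hereditarily finite sets. -/
def HFSet : Type := ℕ

namespace HFSet

/-- A hereditarily finite set is the same thing as a finite set of hereditarily finite sets. -/
def elems : HFSet ≃ Finset HFSet := Finset.equivBitIndices

/-- The empty set. -/
def empty : HFSet := elems.symm ∅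

instance : DecidableEq HFSet := inferInstanceAs (DecidableEq ℕ)

/-- Augmentation `x ◁ y = x ∪ {y}`. -/
def eats (x y : HFSet) : HFSet := elems.symm (insert y (elems x))

/-- Membership. -/
def Mem (x y : HFSet) : Prop := x ∈ elems y

end HFSet

/-! ### Terms, and formulas up to renaming of bound variables -/

/-- Variable names. -/
abbrev Name := ℕ

/-- Terms of the HF calculus. -/
inductive Tm : Type
  | zero : Tm
  | var (i : Name) : Tm
  | eats (t u : Tm) : Tm

namespace Tm

/-- The variables of a term. -/
def fv : Tm → Finset Name
  | zero => ∅
  | var i => {i}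
  | eats t u => t.fv ∪ u.fv

/-- Simultaneous substitution. -/
def subst (σ : Name → Tm) : Tm → Tm
  | zero => zero
  | var i => σ i
  | eats t u => eats (t.subst σ) (u.subst σ)

/-- Action of a permutation of names. -/
def perm (π : Equiv.Perm Name) : Tm → Tm
  | zero => zero
  | var i => var (π i)
  | eats t u => eats (t.perm π) (u.perm π)

/-- The value of a term. -/
def eval (e : Name → HFSet) : Tm → HFSet
  | zero => HFSet.empty
  | var i => e i
  | eats t u => HFSet.eats (t.eval e) (u.eval e)

end Tm

/-- Raw formulas, with significant names of bound variables. -/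
inductive PreFm : Type
  | mem (t u : Tm) : PreFm
  | eq (t u : Tm) : PreFm
  | disj (A B : PreFm) : PreFm
  | neg (A : PreFm) : PreFm
  | ex (i : Name) (A : PreFm) : PreFm

/-- A name outside a given finite set. -/
def freshName (S : Finset Name) : Name := S.sup id + 1

theorem freshName_notMem (S : Finset Name) : freshName S ∉ S := by
  intro h
  exact absurd (Finset.le_sup (f := id) h) (Nat.not_succ_le_self _)

namespace PreFm

/-- Free variables. -/
def fv : PreFm → Finset Name
  | mem t u => t.fv ∪ u.fv
  | eq t u => t.fv ∪ u.fv
  | disj A B => A.fv ∪ B.fv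
  | neg A => A.fv
  | ex i A => A.fv.erase i

/-- Action of a permutation of names on free and bound names alike. -/
def perm (π : Equiv.Perm Name) : PreFm → PreFm
  | mem t u => mem (t.perm π) (u.perm π)
  | eq t u => eq (t.perm π) (u.perm π)
  | disj A B => disj (A.perm π) (B.perm π)
  | neg A => neg (A.perm π)
  | ex i A => ex (π i) (A.perm π)

/-- Simultaneous capture-avoiding substitution; bound variables are renamed to fresh ones. -/
def subst (σ : Name → Tm) : PreFm → PreFm
  | mem t u => mem (t.subst σ) (u.subst σ)
  | eq t u => eq (t.subst σ) (u.subst σ)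
  | disj A B => disj (A.subst σ) (B.subst σ)
  | neg A => neg (A.subst σ)
  | ex i A =>
      let k := freshName ((A.fv.erase i).biUnion fun v => (σ v).fv)
      ex k (A.subst (Function.update σ i (Tm.var k)))

/-- Tarski truth in the hereditarily finite sets. -/
def Eval (e : Name → HFSet) : PreFm → Prop
  | mem t u => HFSet.Mem (t.eval e) (u.eval e)
  | eq t u => t.eval e = u.eval e
  | disj A B => A.Eval e ∨ B.Eval e
  | neg A => ¬ A.Eval e
  | ex i A => ∃ x : HFSet, A.Eval (Function.update e i x)

/-- Equality up to renaming of bound variables: the least congruence that identifies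
`∃ i, A` with `∃ j, (i j) • A` for `j` not free in `A`. -/
inductive Alpha : PreFm → PreFm → Prop
  | refl (A) : Alpha A A
  | symm {A B} : Alpha A B → Alpha B A
  | trans {A B C} : Alpha A B → Alpha B C → Alpha A C
  | disj {A A' B B'} : Alpha A A' → Alpha B B' → Alpha (disj A B) (disj A' B')
  | neg {A A'} : Alpha A A' → Alpha (neg A) (neg A')
  | ex (i) {A A'} : Alpha A A' → Alpha (ex i A) (ex i A')
  | rename (i j A) : j ∉ A.fv → Alpha (ex i A) (ex j (A.perm (Equiv.swap i j)))

instance setoid : Setoid PreFm := ⟨Alpha, Alpha.refl, Alpha.symm, Alpha.trans⟩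

end PreFm

/-! ### De Bruijn syntax and the translation into it -/

/-- De Bruijn terms: `ind k` is the variable bound by the `k`-th enclosing quantifier. -/
inductive DBTm : Type
  | zero : DBTm
  | var (i : Name) : DBTm
  | ind (k : ℕ) : DBTm
  | eats (t u : DBTm) : DBTm

/-- De Bruijn formulas. -/
inductive DBFm : Type
  | mem (t u : DBTm) : DBFm
  | eq (t u : DBTm) : DBFm
  | disj (A B : DBFm) : DBFm
  | neg (A : DBFm) : DBFm
  | ex (A : DBFm) : DBFm

/-- The translation of a name, below quantifiers binding the names `xs` (innermost first). -/
def lookup (xs : List Name) (x : Name) : DBTm :=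
  if x ∈ xs then DBTm.ind (xs.idxOf x) else DBTm.var x

def Tm.trans (xs : List Name) : Tm → DBTm
  | zero => DBTm.zero
  | var i => lookup xs i
  | eats t u => DBTm.eats (t.trans xs) (u.trans xs)

def PreFm.trans (xs : List Name) : PreFm → DBFm
  | mem t u => DBFm.mem (t.trans xs) (u.trans xs)
  | eq t u => DBFm.eq (t.trans xs) (u.trans xs)
  | disj A B => DBFm.disj (A.trans xs) (B.trans xs)
  | neg A => DBFm.neg (A.trans xs)
  | ex i A => DBFm.ex (A.trans (i :: xs))

/-! ### The operations respect renaming of bound variables -/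

/-- Raise every index by one. -/
def DBTm.lift : DBTm → DBTm
  | zero => zero
  | var i => var i
  | ind k => ind (k + 1)
  | eats t u => eats t.lift u.lift

/-- Replace names by terms, without touching indices. -/
def DBTm.map (f : Name → DBTm) : DBTm → DBTm
  | zero => zero
  | var i => f i
  | ind k => ind k
  | eats t u => eats (t.map f) (u.map f)

def DBFm.map (f : Name → DBTm) : DBFm → DBFm
  | mem t u => mem (t.map f) (u.map f)
  | eq t u => eq (t.map f) (u.map f)
  | disj A B => disj (A.map f) (B.map f)
  | neg A => neg (A.map f)
  | ex A => ex (A.map f)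

theorem lookup_cons (y : Name) (ys : List Name) (x : Name) :
    lookup (y :: ys) x = if x = y then DBTm.ind 0 else (lookup ys x).lift := by
  unfold lookup
  by_cases h : x = y
  · subst h; simp
  · have h' : ¬ y = x := fun e => h e.symm
    by_cases hx : x ∈ ys <;> simp [h, h', hx, DBTm.lift]

theorem lookup_injective (xs : List Name) : Function.Injective (lookup xs) := by
  intro x y h
  unfold lookup at h
  split_ifs at h with h1 h2
  · exact (List.idxOf_inj h1).1 (DBTm.ind.inj h)
  · exact DBTm.var.inj h

theorem Tm.trans_injective (xs : List Name) : Function.Injective (Tm.trans xs) := by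
  intro t
  induction t with
  | zero =>
    intro u h
    cases u with
    | zero => rfl
    | var i => simp only [Tm.trans, lookup] at h; split_ifs at h
    | eats => simp [Tm.trans] at h
  | var i =>
    intro u h
    cases u with
    | zero => simp only [Tm.trans, lookup] at h; split_ifs at h
    | var j => rw [lookup_injective xs h]
    | eats => simp only [Tm.trans, lookup] at h; split_ifs at h
  | eats t1 t2 ih1 ih2 =>
    intro u h
    cases u with
    | zero => simp [Tm.trans] at h
    | var j => simp only [Tm.trans, lookup] at h; split_ifs at h
    | eats u1 u2 =>
      simp only [Tm.trans, DBTm.eats.injEq] at h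
      rw [ih1 h.1, ih2 h.2]

theorem Tm.trans_perm (π : Equiv.Perm Name) (xs ys : List Name) (t : Tm)
    (h : ∀ v ∈ t.fv, lookup xs (π v) = lookup ys v) : (t.perm π).trans xs = t.trans ys := by
  induction t with
  | zero => rfl
  | var i => exact h i (by simp [Tm.fv])
  | eats t u iht ihu =>
    simp only [Tm.perm, Tm.trans]
    rw [iht fun v hv => h v (by simp [Tm.fv, hv]), ihu fun v hv => h v (by simp [Tm.fv, hv])]

theorem PreFm.trans_perm (π : Equiv.Perm Name) (A : PreFm) : ∀ (xs ys : List Name),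
    (∀ v ∈ A.fv, lookup xs (π v) = lookup ys v) → (A.perm π).trans xs = A.trans ys := by
  induction A with
  | mem t u =>
    intro xs ys h
    simp only [PreFm.perm, PreFm.trans]
    rw [Tm.trans_perm π xs ys t fun v hv => h v (by simp [PreFm.fv, hv]),
      Tm.trans_perm π xs ys u fun v hv => h v (by simp [PreFm.fv, hv])]
  | eq t u =>
    intro xs ys h
    simp only [PreFm.perm, PreFm.trans]
    rw [Tm.trans_perm π xs ys t fun v hv => h v (by simp [PreFm.fv, hv]),
      Tm.trans_perm π xs ys u fun v hv => h v (by simp [PreFm.fv, hv])]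
  | disj A B ihA ihB =>
    intro xs ys h
    simp only [PreFm.perm, PreFm.trans]
    rw [ihA xs ys fun v hv => h v (by simp [PreFm.fv, hv]),
      ihB xs ys fun v hv => h v (by simp [PreFm.fv, hv])]
  | neg A ih =>
    intro xs ys h
    simp only [PreFm.perm, PreFm.trans]
    rw [ih xs ys h]
  | ex i A ih =>
    intro xs ys h
    simp only [PreFm.perm, PreFm.trans]
    rw [ih (π i :: xs) (i :: ys)]
    intro v hv
    rw [lookup_cons, lookup_cons]
    by_cases hvi : v = i
    · simp [hvi]
    · simp only [EmbeddingLike.apply_eq_iff_eq, hvi, if_false]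
      rw [h v (by simp [PreFm.fv, hv, hvi])]

theorem PreFm.trans_swap {A : PreFm} {i j : Name} (hj : j ∉ A.fv) (xs : List Name) :
    (A.perm (Equiv.swap i j)).trans (j :: xs) = A.trans (i :: xs) := by
  apply PreFm.trans_perm
  intro v hv
  rw [lookup_cons, lookup_cons]
  by_cases hvi : v = i
  · simp [hvi]
  · have hvj : v ≠ j := by rintro rfl; exact hj hv
    rw [Equiv.swap_apply_of_ne_of_ne hvi hvj]
    simp [hvi, hvj]

theorem PreFm.Alpha.trans_eq {A B : PreFm} (h : PreFm.Alpha A B) :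
    ∀ xs, A.trans xs = B.trans xs := by
  induction h with
  | refl => intro xs; rfl
  | symm _ ih => intro xs; exact (ih xs).symm
  | trans _ _ ih1 ih2 => intro xs; exact (ih1 xs).trans (ih2 xs)
  | disj _ _ ih1 ih2 => intro xs; simp only [PreFm.trans, ih1 xs, ih2 xs]
  | neg _ ih => intro xs; simp only [PreFm.trans, ih xs]
  | ex i _ ih => intro xs; simp only [PreFm.trans, ih (i :: xs)]
  | rename i j A hj => intro xs; simp only [PreFm.trans, PreFm.trans_swap hj]

def PreFm.size : PreFm → ℕ
  | mem _ _ => 1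
  | eq _ _ => 1
  | disj A B => A.size + B.size + 1
  | neg A => A.size + 1
  | ex _ A => A.size + 1

theorem PreFm.size_perm (π : Equiv.Perm Name) (A : PreFm) : (A.perm π).size = A.size := by
  induction A <;> simp_all [PreFm.perm, PreFm.size]

theorem PreFm.alpha_of_trans_eq : ∀ (n : ℕ) (A B : PreFm) (xs : List Name),
    A.size ≤ n → A.trans xs = B.trans xs → PreFm.Alpha A B := by
  intro n
  induction n with
  | zero => intro A B xs hA; cases A <;> simp [PreFm.size] at hA
  | succ n ih =>
    intro A B xs hA h
    cases A with
    | mem t u =>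
      cases B <;> simp only [PreFm.trans, DBFm.mem.injEq, reduceCtorEq] at h
      rw [Tm.trans_injective xs h.1, Tm.trans_injective xs h.2]
      exact .refl _
    | eq t u =>
      cases B <;> simp only [PreFm.trans, DBFm.eq.injEq, reduceCtorEq] at h
      rw [Tm.trans_injective xs h.1, Tm.trans_injective xs h.2]
      exact .refl _
    | disj A1 A2 =>
      cases B <;> simp only [PreFm.trans, DBFm.disj.injEq, reduceCtorEq] at h
      simp only [PreFm.size] at hA
      exact .disj (ih _ _ xs (by omega) h.1) (ih _ _ xs (by omega) h.2)
    | neg A =>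
      cases B <;> simp only [PreFm.trans, DBFm.neg.injEq, reduceCtorEq] at h
      simp only [PreFm.size] at hA
      exact .neg (ih _ _ xs (by omega) h)
    | ex i A =>
      cases B with
      | ex j B =>
        simp only [PreFm.trans, DBFm.ex.injEq] at h
        simp only [PreFm.size] at hA
        have hk := freshName_notMem (A.fv ∪ B.fv)
        set k := freshName (A.fv ∪ B.fv)
        simp only [Finset.mem_union, not_or] at hk
        refine .trans (.rename i k A hk.1) (.trans (.ex k ?_) (.symm (.rename j k B hk.2)))
        apply ih _ _ (k :: xs)
        · rw [PreFm.size_perm]; omega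
        · rw [PreFm.trans_swap hk.1, PreFm.trans_swap hk.2, h]
      | _ => simp [PreFm.trans] at h

theorem PreFm.alpha_iff_trans_eq {A B : PreFm} : A ≈ B ↔ A.trans [] = B.trans [] :=
  ⟨fun h => PreFm.Alpha.trans_eq h [], PreFm.alpha_of_trans_eq _ A B [] le_rfl⟩

theorem Tm.trans_cons {k : Name} (xs : List Name) {t : Tm} (hk : k ∉ t.fv) :
    t.trans (k :: xs) = (t.trans xs).lift := by
  induction t with
  | zero => rfl
  | var i =>
    have : i ≠ k := by rintro rfl; simp [Tm.fv] at hk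
    simp [Tm.trans, lookup_cons, this]
  | eats t u iht ihu =>
    simp only [Tm.fv, Finset.mem_union, not_or] at hk
    simp [Tm.trans, DBTm.lift, iht hk.1, ihu hk.2]

theorem Tm.trans_nil_lift (t : Tm) : (t.trans []).lift = t.trans [] := by
  induction t with
  | zero => rfl
  | var i => simp [Tm.trans, lookup, DBTm.lift]
  | eats t u iht ihu => simp [Tm.trans, DBTm.lift, iht, ihu]

theorem DBTm.map_lift (f : Name → DBTm) (hf : ∀ i, (f i).lift = f i) (t : DBTm) :
    t.lift.map f = (t.map f).lift := by
  induction t with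
  | zero => rfl
  | var i => simp [DBTm.lift, DBTm.map, hf]
  | ind k => rfl
  | eats t u iht ihu => simp [DBTm.lift, DBTm.map, iht, ihu]

theorem Tm.trans_subst (f : Name → DBTm) (σ : Name → Tm) (xs ys : List Name) (t : Tm)
    (h : ∀ v ∈ t.fv, (σ v).trans xs = (lookup ys v).map f) :
    (t.subst σ).trans xs = (t.trans ys).map f := by
  induction t with
  | zero => rfl
  | var i => exact h i (by simp [Tm.fv])
  | eats t u iht ihu =>
    simp only [Tm.subst, Tm.trans, DBTm.map]
    rw [iht fun v hv => h v (by simp [Tm.fv, hv]), ihu fun v hv => h v (by simp [Tm.fv, hv])]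

theorem PreFm.trans_subst_aux (f : Name → DBTm) (hf : ∀ i, (f i).lift = f i) (A : PreFm) :
    ∀ (σ : Name → Tm) (xs ys : List Name),
    (∀ v ∈ A.fv, (σ v).trans xs = (lookup ys v).map f) →
    (A.subst σ).trans xs = (A.trans ys).map f := by
  induction A with
  | mem t u =>
    intro σ xs ys h
    simp only [PreFm.subst, PreFm.trans, DBFm.map]
    rw [Tm.trans_subst f σ xs ys t fun v hv => h v (by simp [PreFm.fv, hv]),
      Tm.trans_subst f σ xs ys u fun v hv => h v (by simp [PreFm.fv, hv])]
  | eq t u =>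
    intro σ xs ys h
    simp only [PreFm.subst, PreFm.trans, DBFm.map]
    rw [Tm.trans_subst f σ xs ys t fun v hv => h v (by simp [PreFm.fv, hv]),
      Tm.trans_subst f σ xs ys u fun v hv => h v (by simp [PreFm.fv, hv])]
  | disj A B ihA ihB =>
    intro σ xs ys h
    simp only [PreFm.subst, PreFm.trans, DBFm.map]
    rw [ihA σ xs ys fun v hv => h v (by simp [PreFm.fv, hv]),
      ihB σ xs ys fun v hv => h v (by simp [PreFm.fv, hv])]
  | neg A ih =>
    intro σ xs ys h
    simp only [PreFm.subst, PreFm.trans, DBFm.map]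
    rw [ih σ xs ys h]
  | ex i A ih =>
    intro σ xs ys h
    simp only [PreFm.subst, PreFm.trans, DBFm.map]
    have hk := freshName_notMem ((A.fv.erase i).biUnion fun v => (σ v).fv)
    set k := freshName ((A.fv.erase i).biUnion fun v => (σ v).fv)
    rw [ih _ (k :: xs) (i :: ys)]
    intro v hv
    rw [lookup_cons]
    by_cases hvi : v = i
    · simp [hvi, Tm.trans, lookup_cons, DBTm.map]
    · simp only [Finset.mem_biUnion, not_exists, not_and] at hk
      have hv' : v ∈ A.fv.erase i := by simp [hv, hvi]
      rw [Function.update_of_ne hvi, Tm.trans_cons xs (hk v hv'), h v hv', if_neg hvi,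
        DBTm.map_lift f hf]

theorem PreFm.trans_subst (σ : Name → Tm) (A : PreFm) :
    (A.subst σ).trans [] = (A.trans []).map fun v => (σ v).trans [] :=
  PreFm.trans_subst_aux _ (fun i => (σ i).trans_nil_lift) A σ [] [] fun v _ => by
    simp [lookup, DBTm.map]

theorem PreFm.subst_congr (σ : Name → Tm) {A B : PreFm} (h : A ≈ B) :
    A.subst σ ≈ B.subst σ := by
  rw [PreFm.alpha_iff_trans_eq] at h ⊢
  rw [PreFm.trans_subst, PreFm.trans_subst, h]

theorem Tm.fv_perm (π : Equiv.Perm Name) (t : Tm) (v : Name) :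
    π v ∈ (t.perm π).fv ↔ v ∈ t.fv := by
  induction t <;> simp_all [Tm.perm, Tm.fv]

theorem PreFm.fv_perm (π : Equiv.Perm Name) (A : PreFm) (v : Name) :
    π v ∈ (A.perm π).fv ↔ v ∈ A.fv := by
  induction A <;> simp_all [PreFm.perm, PreFm.fv, Tm.fv_perm]

theorem PreFm.Alpha.fv_eq {A B : PreFm} (h : PreFm.Alpha A B) : A.fv = B.fv := by
  induction h with
  | refl => rfl
  | symm _ ih => exact ih.symm
  | trans _ _ ih1 ih2 => exact ih1.trans ih2
  | disj _ _ ih1 ih2 => simp only [PreFm.fv, ih1, ih2]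
  | neg _ ih => simp only [PreFm.fv, ih]
  | ex i _ ih => simp only [PreFm.fv, ih]
  | rename i j A hj =>
    ext v
    obtain ⟨w, rfl⟩ := (Equiv.swap i j).surjective v
    simp only [PreFm.fv, Finset.mem_erase, PreFm.fv_perm]
    by_cases hwi : w = i
    · subst hwi; simp [hj]
    · by_cases hwj : w = j
      · subst hwj; simp [hj]
      · rw [Equiv.swap_apply_of_ne_of_ne hwi hwj]; simp [hwi, hwj]

theorem Tm.eval_perm (π : Equiv.Perm Name) (e : Name → HFSet) (t : Tm) :
    (t.perm π).eval e = t.eval (e ∘ π) := by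
  induction t <;> simp_all [Tm.perm, Tm.eval]

theorem PreFm.eval_perm (π : Equiv.Perm Name) (A : PreFm) : ∀ e : Name → HFSet,
    (A.perm π).Eval e ↔ A.Eval (e ∘ π) := by
  induction A with
  | ex i A ih =>
    intro e
    simp only [PreFm.perm, PreFm.Eval, ih]
    refine exists_congr fun x => ?_
    have : Function.update e (π i) x ∘ π = Function.update (e ∘ π) i x := by
      funext v; by_cases h : v = i <;> simp [h]
    rw [this]
  | _ => simp_all [PreFm.perm, PreFm.Eval, Tm.eval_perm]

theorem Tm.eval_congr {e e' : Name → HFSet} (t : Tm) (h : ∀ v ∈ t.fv, e v = e' v) :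
    t.eval e = t.eval e' := by
  induction t <;> simp_all [Tm.fv, Tm.eval]

theorem PreFm.eval_congr (A : PreFm) : ∀ {e e' : Name → HFSet},
    (∀ v ∈ A.fv, e v = e' v) → (A.Eval e ↔ A.Eval e') := by
  induction A with
  | mem t u =>
    intro e e' h
    simp only [PreFm.Eval]
    rw [t.eval_congr fun v hv => h v (by simp [PreFm.fv, hv]),
      u.eval_congr fun v hv => h v (by simp [PreFm.fv, hv])]
  | eq t u =>
    intro e e' h
    simp only [PreFm.Eval]
    rw [t.eval_congr fun v hv => h v (by simp [PreFm.fv, hv]),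
      u.eval_congr fun v hv => h v (by simp [PreFm.fv, hv])]
  | disj A B ihA ihB =>
    intro e e' h
    exact or_congr (ihA fun v hv => h v (by simp [PreFm.fv, hv]))
      (ihB fun v hv => h v (by simp [PreFm.fv, hv]))
  | neg A ih => intro e e' h; exact not_congr (ih h)
  | ex i A ih =>
    intro e e' h
    refine exists_congr fun x => ih fun v hv => ?_
    by_cases hvi : v = i
    · simp [hvi]
    · simp [hvi, h v (by simp [PreFm.fv, hv, hvi])]

theorem PreFm.Alpha.eval_iff {A B : PreFm} (h : PreFm.Alpha A B) :
    ∀ e : Name → HFSet, A.Eval e ↔ B.Eval e := by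
  induction h with
  | refl => intro e; rfl
  | symm _ ih => intro e; exact (ih e).symm
  | trans _ _ ih1 ih2 => intro e; exact (ih1 e).trans (ih2 e)
  | disj _ _ ih1 ih2 => intro e; exact or_congr (ih1 e) (ih2 e)
  | neg _ ih => intro e; exact not_congr (ih e)
  | ex i _ ih => intro e; exact exists_congr fun x => ih _
  | rename i j A hj =>
    intro e
    refine exists_congr fun x => ?_
    rw [PreFm.eval_perm]
    refine A.eval_congr fun v hv => ?_
    by_cases hvi : v = i
    · simp [hvi]
    · have hvj : v ≠ j := by rintro rfl; exact hj hv
      simp [Equiv.swap_apply_of_ne_of_ne hvi hvj, hvi, hvj]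

/-! ### Formulas -/

/-- Formulas of the HF calculus: raw formulas modulo renaming of bound variables. -/
def Fm : Type := Quotient PreFm.setoid

namespace Fm

def mem (t u : Tm) : Fm := Quotient.mk _ (PreFm.mem t u)

def eq (t u : Tm) : Fm := Quotient.mk _ (PreFm.eq t u)

def disj : Fm → Fm → Fm := Quotient.map₂ PreFm.disj fun _ _ h _ _ h' => PreFm.Alpha.disj h h'

def neg : Fm → Fm := Quotient.map PreFm.neg fun _ _ h => PreFm.Alpha.neg h

def ex (i : Name) : Fm → Fm := Quotient.map (PreFm.ex i) fun _ _ h => PreFm.Alpha.ex i h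

/-- Free variables; `i ∉ A.fv` says that `i` is fresh for `A`. -/
def fv : Fm → Finset Name := Quotient.lift PreFm.fv fun _ _ h => PreFm.Alpha.fv_eq h

/-- Simultaneous capture-avoiding substitution. -/
def subst (σ : Name → Tm) : Fm → Fm :=
  Quotient.map (PreFm.subst σ) fun _ _ h => PreFm.subst_congr σ h

/-- `A(i ::= x)`: substitution of the term `x` for the variable `i`. -/
def subst1 (A : Fm) (i : Name) (x : Tm) : Fm := A.subst (Function.update Tm.var i x)

/-- Truth of a formula in the hereditarily finite sets, under an assignment. -/
def Eval (e : Name → HFSet) : Fm → Prop :=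
  Quotient.lift (PreFm.Eval e) fun _ _ h => propext (PreFm.Alpha.eval_iff h e)

/-- The translation of a formula into de Bruijn syntax. -/
def trans : Fm → DBFm :=
  Quotient.lift (PreFm.trans []) fun _ _ h => PreFm.Alpha.trans_eq h []

end Fm

/-- The recursion equation of substitution below a quantifier. -/
theorem Fm.subst1_ex {i j : Name} {x : Tm} (hij : j ≠ i) (hj : j ∉ x.fv) (A : Fm) :
    (Fm.ex j A).subst1 i x = Fm.ex j (A.subst1 i x) := by
  induction A using Quotient.inductionOn with
  | h A =>
    apply Quotient.sound
    rw [PreFm.alpha_iff_trans_eq, PreFm.trans_subst]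
    simp only [PreFm.trans, DBFm.map]
    rw [PreFm.trans_subst_aux (fun v => (Function.update Tm.var i x v).trans [])
      (fun _ => Tm.trans_nil_lift _) A _ [j] [j]]
    · intro v _
      rw [lookup_cons]
      by_cases hvj : v = j
      · subst hvj; simp [hij, Tm.trans, lookup_cons, DBTm.map]
      · by_cases hvi : v = i
        · subst hvi; simp [hvj, lookup, DBTm.lift, DBTm.map, Tm.trans_cons [] hj, Tm.trans_nil_lift]
        · simp [hvj, hvi, lookup, DBTm.lift, DBTm.map, Tm.trans]

infix:70 " IN " => Fm.mem
infix:70 " EQ " => Fm.eq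
infixr:50 " OR " => Fm.disj

namespace Fm

def conj (A B : Fm) : Fm := neg (neg A OR neg B)

def imp (A B : Fm) : Fm := neg A OR B

def iff (A B : Fm) : Fm := conj (imp A B) (imp B A)

def all (i : Name) (A : Fm) : Fm := neg (ex i (neg A))

def neq (t u : Tm) : Fm := neg (t EQ u)

end Fm

infix:70 " NEQ " => Fm.neq
infixr:55 " AND " => Fm.conj
infixr:45 " IMP " => Fm.imp
infixr:40 " IFF " => Fm.iff

/-! ### The HF calculus -/

open Tm (zero var eats)

inductive BooleanAxiom : Fm → Prop
  | ident (A) : BooleanAxiom (A IMP A)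
  | disjI1 (A B) : BooleanAxiom (A IMP (A OR B))
  | disjCont (A) : BooleanAxiom ((A OR A) IMP A)
  | disjAssoc (A B C) : BooleanAxiom ((A OR (B OR C)) IMP ((A OR B) OR C))
  | disjConj (A B C) : BooleanAxiom ((C OR A) IMP ((Fm.neg C OR B) IMP (A OR B)))

def reflAx : Fm := var 1 EQ var 1

def eqCongAx : Fm :=
  (var 1 EQ var 2 AND var 3 EQ var 4) IMP (var 1 EQ var 3 IMP var 2 EQ var 4)

def memCongAx : Fm :=
  (var 1 EQ var 2 AND var 3 EQ var 4) IMP (var 1 IN var 3 IMP var 2 IN var 4)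

def eatsCongAx : Fm :=
  (var 1 EQ var 2 AND var 3 EQ var 4) IMP eats (var 1) (var 3) EQ eats (var 2) (var 4)

inductive EqualityAxiom : Fm → Prop
  | refl : EqualityAxiom reflAx
  | eqCong : EqualityAxiom eqCongAx
  | memCong : EqualityAxiom memCongAx
  | eatsCong : EqualityAxiom eatsCongAx

inductive SpecialAxiom : Fm → Prop
  | spec (A : Fm) (i : Name) (x : Tm) : SpecialAxiom (A.subst1 i x IMP Fm.ex i A)

/-- `z = 0 ↔ ∀ x, x ∉ z`. -/
def hf1 : Fm := var 0 EQ zero IFF Fm.all 1 (Fm.neg (var 1 IN var 0))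

/-- `z = x ◁ y ↔ ∀ u, (u ∈ z ↔ u ∈ x ∨ u = y)`. -/
def hf2 : Fm :=
  var 0 EQ eats (var 1) (var 2) IFF
    Fm.all 3 (var 3 IN var 0 IFF (var 3 IN var 1 OR var 3 EQ var 2))

inductive HFAxiom : Fm → Prop
  | hf1 : HFAxiom hf1
  | hf2 : HFAxiom hf2

inductive InductionAxiom : Fm → Prop
  | ind (A : Fm) (i j : Name) : j ≠ i → j ∉ A.fv →
      InductionAxiom (A.subst1 i zero IMP
        (Fm.all i (Fm.all j (A IMP (A.subst1 i (var j) IMP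
          A.subst1 i (eats (var i) (var j))))) IMP Fm.all i A))

/-- `Hfthm extra H A`: the formula `A` is provable from the set `H` of formulas in the HF
calculus with the additional axiom `extra`. -/
inductive Hfthm (extra : Fm) : Set Fm → Fm → Prop
  | hyp {H A} : A ∈ H → Hfthm extra H A
  | extra {H} : Hfthm extra H extra
  | bool {H A} : BooleanAxiom A → Hfthm extra H A
  | eq {H A} : EqualityAxiom A → Hfthm extra H A
  | spec {H A} : SpecialAxiom A → Hfthm extra H A
  | hf {H A} : HFAxiom A → Hfthm extra H A
  | ind {H A} : InductionAxiom A → Hfthm extra H A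
  | mp {H H' A B} : Hfthm extra H (A IMP B) → Hfthm extra H' A → Hfthm extra (H ∪ H') B
  | exists {H A B} {i : Name} : Hfthm extra H (A IMP B) → i ∉ B.fv → (∀ C ∈ H, i ∉ C.fv) →
      Hfthm extra H (Fm.ex i A IMP B)

/-! ### Codes -/

/-- The successor `x ◁ x`. -/
def succT (x : Tm) : Tm := eats x x

/-- The ordinal (natural number) `n` as a term. -/
def ordOf : ℕ → Tm
  | 0 => zero
  | n + 1 => succT (ordOf n)

/-- The ordered pair `{{x}, {x, y}}`. -/
def pair (x y : Tm) : Tm :=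
  eats (eats zero (eats (eats zero y) x)) (eats (eats zero x) x)

/-- Pairwise distinct tags for the syntactic constructors. -/
def tag : ℕ → Tm
  | 0 => pair zero zero
  | n + 1 => pair zero (tag n)

def qEats (t u : Tm) : Tm := pair (tag 1) (pair t u)
def qInd (k : Tm) : Tm := pair (tag 6) k
def qMem (t u : Tm) : Tm := pair (tag 0) (pair t u)
def qEq (t u : Tm) : Tm := pair (tag 2) (pair t u)
def qDisj (x y : Tm) : Tm := pair (tag 3) (pair x y)
def qNeg (x : Tm) : Tm := pair (tag 4) x
def qEx (x : Tm) : Tm := pair (tag 5) x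
def qImp (x y : Tm) : Tm := qDisj (qNeg x) y
def qAll (x : Tm) : Tm := qNeg (qEx (qNeg x))

def DBTm.quot : DBTm → Tm
  | zero => Tm.zero
  | var i => ordOf (i + 1)
  | ind k => qInd (ordOf k)
  | eats t u => qEats t.quot u.quot

def DBFm.quot : DBFm → Tm
  | mem t u => qMem t.quot u.quot
  | eq t u => qEq t.quot u.quot
  | disj A B => qDisj A.quot B.quot
  | neg A => qNeg A.quot
  | ex A => qEx A.quot

/-- The code of a formula, a closed term of the calculus. -/
def Fm.quot (A : Fm) : Tm := A.trans.quot

/-! ### Quantification over fresh variables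

In `exF ts P` the list `ts` holds the terms that occur in the body `P`; the bound variable is
chosen fresh for all of them. -/

/-- A name that does not occur in the given terms. -/
def freshFor (ts : List Tm) : Name := freshName (ts.foldr (fun t S => t.fv ∪ S) ∅)

def exF (ts : List Tm) (P : Tm → Fm) : Fm := Fm.ex (freshFor ts) (P (var (freshFor ts)))

def exF₂ (ts : List Tm) (P : Tm → Tm → Fm) : Fm :=
  exF ts fun a => exF (a :: ts) (P a)

def exF₃ (ts : List Tm) (P : Tm → Tm → Tm → Fm) : Fm :=
  exF ts fun a => exF₂ (a :: ts) (P a)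

def exF₄ (ts : List Tm) (P : Tm → Tm → Tm → Tm → Fm) : Fm :=
  exF ts fun a => exF₃ (a :: ts) (P a)

/-- Bounded universal quantification `∀ x ∈ t, P x`; here `t` is one of the terms avoided. -/
def allIn (ts : List Tm) (t : Tm) (P : Tm → Fm) : Fm :=
  Fm.all (freshFor (t :: ts))
    (var (freshFor (t :: ts)) IN t IMP P (var (freshFor (t :: ts))))

/-! ### Sets and sequences -/

def subsetP (t u : Tm) : Fm := allIn [t, u] t fun z => z IN u

/-- `x` is an ordinal, that is, a natural number: a transitive set of transitive sets. -/
def ordP (x : Tm) : Fm :=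
  allIn [x] x fun y => subsetP y x AND allIn [x, y] y fun z => subsetP z y

/-- `r` is a single-valued set of pairs with ordinals as first components. -/
def funP (r : Tm) : Fm :=
  allIn [r] r fun z => allIn [r, z] r fun z' =>
    exF₄ [r, z, z'] fun x y x' y' =>
      z EQ pair x y AND z' EQ pair x' y' AND ordP x AND ordP x' AND (x NEQ x' OR y EQ y')

/-- The domain of `r` includes `d`. -/
def domInclP (r d : Tm) : Fm := allIn [r, d] d fun x => exF [r, d, x] fun y => pair x y IN r

/-- `s` is a sequence, defined at least on the ordinal `k`. -/
def seqP (s k : Tm) : Fm := ordP k AND domInclP s k AND funP s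

/-- `s` is a sequence, defined at least on `0, …, k`, and its entry at `k` is `y`. -/
def lstSeqP (s k y : Tm) : Fm := seqP s (succT k) AND pair k y IN s

/-! ### Coded syntax -/

/-- `x` is the code of a variable: a non-zero ordinal. -/
def varP (x : Tm) : Fm := ordP x AND zero IN x

/-- `x` is the code of a de Bruijn index. -/
def indP (x : Tm) : Fm := exF [x] fun m => ordP m AND x EQ qInd m

/-- `s` is a construction sequence, ending at `k`, of the term code `t`. -/
def seqTermP (s k t : Tm) : Fm :=
  lstSeqP s k t AND
  allIn [s, k, t] (succT k) fun l => exF [s, k, t, l] fun sl =>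
    pair l sl IN s AND
    (sl EQ zero OR varP sl OR
      exF₄ [s, k, t, l, sl] fun m n sm sn =>
        m IN l AND n IN l AND pair m sm IN s AND pair n sn IN s AND sl EQ qEats sm sn)

/-- `t` is the code of a term (without de Bruijn indices). -/
def termP (t : Tm) : Fm := exF₂ [t] fun s k => seqTermP s k t

/-- `s` is a sequence of pairs, ending at `k`, that witnesses that replacing the variable `v`
by `u` in the (de Bruijn) term `x` yields `x'`. -/
def seqStTermP (v u x x' s k : Tm) : Fm :=
  varP v AND lstSeqP s k (pair x x') AND
  allIn [v, u, x, x', s, k] (succT k) fun l => exF₂ [v, u, x, x', s, k, l] fun sl sl' =>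
    pair l (pair sl sl') IN s AND
    ((sl EQ v AND sl' EQ u) OR
     ((indP sl OR (ordP sl AND sl NEQ v)) AND sl' EQ sl) OR
      exF₂ [v, u, x, x', s, k, l, sl, sl'] fun m n =>
      exF₂ [v, u, x, x', s, k, l, sl, sl', m, n] fun sm sm' =>
      exF₂ [v, u, x, x', s, k, l, sl, sl', m, n, sm, sm'] fun sn sn' =>
        m IN l AND n IN l AND pair m (pair sm sm') IN s AND pair n (pair sn sn') IN s AND
        sl EQ qEats sm sn AND sl' EQ qEats sm' sn')

/-- Abstraction of the variable `v` to the index `i` in the term `x` yields `x'`. -/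
def abstTermP (v i x x' : Tm) : Fm :=
  ordP i AND exF₂ [v, i, x, x'] fun s k => seqStTermP v (qInd i) x x' s k

/-- Substitution of the term `u` for the variable `v` in the term `x` yields `x'`. -/
def substTermP (v u x x' : Tm) : Fm :=
  termP u AND exF₂ [v, u, x, x'] fun s k => seqStTermP v u x x' s k

def abstAtomicP (v i y y' : Tm) : Fm :=
  exF₄ [v, i, y, y'] fun t u t' u' =>
    abstTermP v i t t' AND abstTermP v i u u' AND
    ((y EQ qEq t u AND y' EQ qEq t' u') OR (y EQ qMem t u AND y' EQ qMem t' u'))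

/-- `s` is a sequence of triples (index, formula, result), ending at `k`, that witnesses that
abstraction of the variable `v` to the index `i` in `x` yields `x'`; the index increases by one
below each quantifier. -/
def seqAbstFormP (v i x x' s k : Tm) : Fm :=
  lstSeqP s k (pair i (pair x x')) AND
  allIn [v, i, x, x', s, k] (succT k) fun l =>
  exF₃ [v, i, x, x', s, k, l] fun sli sl sl' =>
    pair l (pair sli (pair sl sl')) IN s AND
    (abstAtomicP v sli sl sl' OR
      (ordP sli AND
       exF₂ [v, i, x, x', s, k, l, sli, sl, sl'] fun m n =>
       exF₃ [v, i, x, x', s, k, l, sli, sl, sl', m, n] fun smi sm sm' =>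
       exF₃ [v, i, x, x', s, k, l, sli, sl, sl', m, n, smi, sm, sm'] fun sni sn sn' =>
        m IN l AND n IN l AND
        pair m (pair smi (pair sm sm')) IN s AND pair n (pair sni (pair sn sn')) IN s AND
        ((sli EQ smi AND sli EQ sni AND sl EQ qDisj sm sn AND sl' EQ qDisj sm' sn') OR
         (sli EQ smi AND sl EQ qNeg sm AND sl' EQ qNeg sm') OR
         (succT sli EQ smi AND sl EQ qEx sm AND sl' EQ qEx sm'))))

def abstFormP (v i x x' : Tm) : Fm :=
  varP v AND ordP i AND exF₂ [v, i, x, x'] fun s k => seqAbstFormP v i x x' s k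

def substAtomicP (v u y y' : Tm) : Fm :=
  exF₄ [v, u, y, y'] fun t r t' r' =>
    substTermP v u t t' AND substTermP v u r r' AND
    ((y EQ qEq t r AND y' EQ qEq t' r') OR (y EQ qMem t r AND y' EQ qMem t' r'))

def seqSubstFormP (v u x x' s k : Tm) : Fm :=
  lstSeqP s k (pair x x') AND
  allIn [v, u, x, x', s, k] (succT k) fun l => exF₂ [v, u, x, x', s, k, l] fun sl sl' =>
    pair l (pair sl sl') IN s AND
    (substAtomicP v u sl sl' OR
      exF₂ [v, u, x, x', s, k, l, sl, sl'] fun m n =>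
      exF₂ [v, u, x, x', s, k, l, sl, sl', m, n] fun sm sm' =>
      exF₂ [v, u, x, x', s, k, l, sl, sl', m, n, sm, sm'] fun sn sn' =>
        m IN l AND n IN l AND pair m (pair sm sm') IN s AND pair n (pair sn sn') IN s AND
        ((sl EQ qDisj sm sn AND sl' EQ qDisj sm' sn') OR
         (sl EQ qNeg sm AND sl' EQ qNeg sm') OR
         (sl EQ qEx sm AND sl' EQ qEx sm')))

/-- Substitution of the term `u` for the variable `v` in the formula `x` yields `x'`. -/
def substFormP (v u x x' : Tm) : Fm :=
  varP v AND termP u AND exF₂ [v, u, x, x'] fun s k => seqSubstFormP v u x x' s k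

def atomicP (y : Tm) : Fm :=
  exF₂ [y] fun t u => termP t AND termP u AND (y EQ qEq t u OR y EQ qMem t u)

def makeFormP (y u w : Tm) : Fm :=
  y EQ qDisj u w OR y EQ qNeg u OR
    exF₂ [y, u, w] fun v au => abstFormP v zero u au AND y EQ qEx au

def seqFormP (s k y : Tm) : Fm :=
  lstSeqP s k y AND
  allIn [s, k, y] (succT k) fun n => exF [s, k, y, n] fun sn =>
    pair n sn IN s AND
    (atomicP sn OR
      exF₄ [s, k, y, n, sn] fun m l sm sl =>
        m IN n AND l IN n AND pair m sm IN s AND pair l sl IN s AND makeFormP sn sm sl)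

/-- `y` is the code of a formula. -/
def formP (y : Tm) : Fm := exF₂ [y] fun s k => seqFormP s k y

/-- The variable `v` is not free in the formula `y`: substituting `0` for it has no effect. -/
def varNonOccFormP (v y : Tm) : Fm := formP y AND substFormP v zero y y

/-! ### Coded axioms, rules and proofs -/

def booleanAxP (p : Tm) : Fm :=
  exF₃ [p] fun x y z =>
    formP x AND formP y AND formP z AND
    (p EQ qImp x x OR
     p EQ qImp x (qDisj x y) OR
     p EQ qImp (qDisj x x) x OR
     p EQ qImp (qDisj x (qDisj y z)) (qDisj (qDisj x y) z) OR
     p EQ qImp (qDisj z x) (qImp (qDisj (qNeg z) y) (qDisj x y)))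

def specialAxP (p : Tm) : Fm :=
  exF₃ [p] fun v t x => exF₂ [p, v, t, x] fun xt ax =>
    formP x AND substFormP v t x xt AND abstFormP v zero x ax AND
    p EQ qImp xt (qEx ax)

def inductionAxP (p : Tm) : Fm :=
  exF₃ [p] fun v w x =>
  exF₃ [p, v, w, x] fun x0 xw xevw =>
  exF₃ [p, v, w, x, x0, xw, xevw] fun aw avw av =>
    v NEQ w AND varNonOccFormP w x AND
    substFormP v zero x x0 AND substFormP v w x xw AND substFormP v (qEats v w) x xevw AND
    abstFormP w zero (qImp x (qImp xw xevw)) aw AND abstFormP v zero (qAll aw) avw AND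
    abstFormP v zero x av AND
    p EQ qImp x0 (qImp (qAll avw) (qAll av))

def axiomP (extra : Fm) (p : Tm) : Fm :=
  p EQ extra.quot OR p EQ reflAx.quot OR p EQ eqCongAx.quot OR p EQ memCongAx.quot OR
  p EQ eatsCongAx.quot OR p EQ hf1.quot OR p EQ hf2.quot OR
  booleanAxP p OR specialAxP p OR inductionAxP p

/-- `z` follows from `x` and `y` by modus ponens. -/
def modPonP (x y z : Tm) : Fm := y EQ qImp x z

/-- `q` follows from `p` by the existential rule. -/
def existsP (p q : Tm) : Fm :=
  exF₄ [p, q] fun v x ax y =>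
    formP x AND varNonOccFormP v y AND abstFormP v zero x ax AND
    p EQ qImp x y AND q EQ qImp (qEx ax) y

/-- `q` follows from `p` by the (derived) rule of substitution of a term for a variable. -/
def substP (p q : Tm) : Fm := exF₂ [p, q] fun v t => substFormP v t p q

/-- `s` is a proof, ending at `k`, of the formula `y`. -/
def prfP (extra : Fm) (s k y : Tm) : Fm :=
  lstSeqP s k y AND
  allIn [s, k, y] (succT k) fun n => exF [s, k, y, n] fun sn =>
    pair n sn IN s AND
    (axiomP extra sn OR
      exF₄ [s, k, y, n, sn] fun m l sm sl =>
        m IN n AND l IN n AND pair m sm IN s AND pair l sl IN s AND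
        (modPonP sm sl sn OR existsP sm sn OR substP sm sn))

/-- The provability predicate: `y` is the code of a theorem. -/
def pfP (extra : Fm) (y : Tm) : Fm := exF₂ [y] fun s k => prfP extra s k y

end HFCalc

namespace HFCalc

/-! ### Arithmetic of the universe of hereditarily finite sets -/

namespace HFSet

/-! Both sides of the equivalence are compared with the truth of the sentence PfP(⌜A⌝) in the
hereditarily finite sets. No formalised version of modus ponens or of reflection inside the calculus
is needed.

Truth of PfP(⌜A⌝) means provability of A (`eval_pfP_quot`). Each coded predicate asserts that a
construction sequence exists. By `HFSet.exists_constr_iff_gen`, such a sequence exists exactly when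
its last entry lies in the inductive closure `Gen` of a base predicate under a binary step.
Evaluating the predicates one after another therefore identifies what they define: codes of terms
and formulas, abstraction, substitution, axioms, and finally codes of theorems (`gen_pf_iff`).
Injectivity of coding lets each code be read back as a unique formula. The substitution rule,
present only in coded proofs, adds nothing because it is derivable (`Hfthm.subst1`).

PfP(⌜A⌝) is a closed Sigma formula, and such a sentence is provable exactly when it is true
(`SigmaComplete.thm_iff_eval`). Provable implies true by soundness, which is where truth of the
extra axiom enters. For the converse, atomic statements and negated ones about closed terms are
decided by the calculus (`closed_atoms_decided`). A true existential has a witness named by a closed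
term. A bounded universal over a closed term reduces to the finitely many elements listed in it,
using replacement of equals (`Hfthm.leibniz`).

Derivations inside the calculus are kept short by propositional completeness (`Hfthm.of_val`): a
formula is a theorem if it holds under every truth assignment that respects the connectives and
satisfies all theorems. Maximal theories supply these assignments, so propositional reasoning takes
place in the metalanguage. -/

theorem mem_empty (x : HFSet) : ¬ Mem x empty := by simp [Mem, empty]

theorem mem_eats {x y z : HFSet} : Mem z (eats x y) ↔ Mem z x ∨ z = y := by
  simp [Mem, eats, or_comm]

theorem ext {x y : HFSet} (h : ∀ z, Mem z x ↔ Mem z y) : x = y :=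
  elems.injective (Finset.ext h)

/-- A set bit x forces 2^x ≤ y, and x < 2^x. The order of ℕ thus provides a rank that bounds
membership. -/
theorem lt_of_mem {x y : HFSet} (h : Mem x y) : @LT.lt ℕ _ x y := by
  have h1 : @Membership.mem ℕ (List ℕ) _ (Nat.bitIndices y) x := by
    have : x ∈ (Nat.bitIndices y).toFinset := h
    exact List.mem_toFinset.1 this
  exact lt_of_lt_of_le Nat.lt_two_pow_self (Nat.two_pow_le_of_mem_bitIndices h1)

theorem mem_induction {P : HFSet → Prop} (h : ∀ x, (∀ y, Mem y x → P y) → P x) (x : HFSet) :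
    P x :=
  Nat.strong_induction_on (p := P) x fun n ih => h n fun y hy => ih y (lt_of_mem hy)

/-- This is the semantic content of the induction axiom. Membership induction supplies P for every
member of x, and then x is rebuilt from the empty set by adjoining its members one at a time. -/
theorem eats_induction {P : HFSet → Prop} (h0 : P empty)
    (h1 : ∀ x y, P x → P y → P (eats x y)) (x : HFSet) : P x := by
  induction x using mem_induction with
  | h x ih =>
    have key : ∀ S : Finset HFSet, (∀ y ∈ S, P y) → P (elems.symm S) := by
      intro S
      induction S using Finset.induction_on with
      | empty => intro _; exact h0
      | insert a S _ ihS =>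
        intro hS
        have h2 := h1 _ a (ihS fun y hy => hS y (by simp [hy])) (hS a (by simp))
        simpa [eats] using h2
    simpa using key (elems x) ih

theorem eq_empty_iff {x : HFSet} : x = empty ↔ ∀ z, ¬ Mem z x :=
  ⟨fun h z => h ▸ mem_empty z, fun h => ext fun z => by simp [h z, mem_empty]⟩

theorem eq_eats_iff {x y z : HFSet} : z = eats x y ↔ ∀ u, Mem u z ↔ (Mem u x ∨ u = y) :=
  ⟨fun h _ => h ▸ mem_eats, fun h => ext fun u => (h u).trans mem_eats.symm⟩

/-! #### Ordered pairs -/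

def sing (a : HFSet) : HFSet := eats (eats empty a) a

def upair (a b : HFSet) : HFSet := eats (eats empty b) a

def pair (a b : HFSet) : HFSet := eats (eats empty (upair a b)) (sing a)

theorem mem_sing {a z : HFSet} : Mem z (sing a) ↔ z = a := by
  simp [sing, mem_eats, mem_empty]

theorem mem_upair {a b z : HFSet} : Mem z (upair a b) ↔ z = a ∨ z = b := by
  simp [upair, mem_eats, mem_empty, or_comm]

theorem mem_pair {a b z : HFSet} : Mem z (pair a b) ↔ z = upair a b ∨ z = sing a := by
  simp [pair, mem_eats, mem_empty]

-- From here on, pairs are known only through their members.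
attribute [irreducible] sing upair pair

theorem sing_eq {a c : HFSet} (h : sing a = sing c) : a = c :=
  mem_sing.1 (h ▸ mem_sing.2 rfl)

theorem upair_eq_sing {a b c : HFSet} (h : upair a b = sing c) : a = c ∧ b = c :=
  ⟨mem_sing.1 (h ▸ mem_upair.2 (.inl rfl)), mem_sing.1 (h ▸ mem_upair.2 (.inr rfl))⟩

/-- Kuratowski's argument: the singleton member determines the first component. Comparing the
unordered pairs then gives the second, with a separate case when one of them collapses to a
singleton. -/
theorem pair_inj {a b c d : HFSet} : pair a b = pair c d ↔ a = c ∧ b = d := by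
  refine ⟨fun h => ?_, fun h => by rw [h.1, h.2]⟩
  have hac : a = c := by
    have h1 : Mem (sing a) (pair c d) := h ▸ mem_pair.2 (.inr rfl)
    rcases mem_pair.1 h1 with h1 | h1
    · exact (upair_eq_sing h1.symm).1.symm
    · exact sing_eq h1
  subst hac
  refine ⟨rfl, ?_⟩
  have h1 : Mem (upair a b) (pair a d) := h ▸ mem_pair.2 (.inl rfl)
  have h2 : Mem (upair a d) (pair a b) := h ▸ mem_pair.2 (.inl rfl)
  rcases mem_pair.1 h1 with h1 | h1
  · have h3 : b = a ∨ b = d := mem_upair.1 (h1 ▸ mem_upair.2 (.inr rfl))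
    have h4 : d = a ∨ d = b := mem_upair.1 (h1 ▸ mem_upair.2 (.inr rfl))
    rcases h3 with h3 | h3
    · rcases h4 with h4 | h4
      · rw [h3, h4]
      · exact h4.symm
    · exact h3
  · have hb := (upair_eq_sing h1).2
    subst hb
    rcases mem_pair.1 h2 with h2 | h2
    · rw [h1] at h2
      exact (upair_eq_sing h2).2.symm
    · exact (upair_eq_sing h2).2.symm

theorem pair_ne_empty (a b : HFSet) : pair a b ≠ empty := fun h =>
  mem_empty (sing a) (h ▸ mem_pair.2 (.inr rfl))

/-- This separates pairs from non-zero ordinals, which do contain the empty set. Codes of variables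
therefore never clash with compound codes. -/
theorem not_empty_mem_pair (a b : HFSet) : ¬ Mem empty (pair a b) := by
  intro h
  rcases mem_pair.1 h with h | h
  · exact mem_empty a (h ▸ mem_upair.2 (.inl rfl))
  · exact mem_empty a (h ▸ mem_sing.2 rfl)

/-! #### Ordinals -/

def ord : ℕ → HFSet
  | 0 => empty
  | n + 1 => eats (ord n) (ord n)

theorem ord_succ (n : ℕ) : ord (n + 1) = eats (ord n) (ord n) := rfl

theorem ord_zero : ord 0 = empty := rfl

theorem mem_ord {n : ℕ} {x : HFSet} : Mem x (ord n) ↔ ∃ m < n, x = ord m := by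
  induction n with
  | zero => simp [ord, mem_empty]
  | succ n ih =>
    simp only [ord, mem_eats, ih]
    constructor
    · rintro (⟨m, hm, rfl⟩ | rfl)
      · exact ⟨m, by omega, rfl⟩
      · exact ⟨n, by omega, rfl⟩
    · rintro ⟨m, hm, rfl⟩
      rcases Nat.lt_succ_iff_lt_or_eq.1 hm with h | rfl
      · exact .inl ⟨m, h, rfl⟩
      · exact .inr rfl

attribute [irreducible] ord

theorem ord_mem_ord_of_lt {m n : ℕ} (h : m < n) : Mem (ord m) (ord n) := mem_ord.2 ⟨m, h, rfl⟩

theorem ord_strictMono : @StrictMono ℕ ℕ _ _ ord := fun _ _ h => lt_of_mem (ord_mem_ord_of_lt h)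

theorem ord_inj {m n : ℕ} : ord m = ord n ↔ m = n := ord_strictMono.injective.eq_iff

/-- By membership induction all members of x are ordinals. The least n with `ord n` outside x then
gives x = `ord n`: transitivity of x excludes larger ordinals, and minimality includes all smaller
ones. -/
theorem exists_eq_ord (x : HFSet)
    (h : ∀ y, Mem y x → (∀ z, Mem z y → Mem z x) ∧ ∀ z, Mem z y → ∀ w, Mem w z → Mem w y) :
    ∃ n, x = ord n := by
  classical
  induction x using mem_induction with
  | h x ih =>
    have hmem : ∀ y, Mem y x → ∃ n, y = ord n := fun y hy =>
      ih y hy fun z hz => ⟨(h y hy).2 z hz, (h z ((h y hy).1 z hz)).2⟩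
    -- The number underlying x serves as n: strict monotonicity gives x ≤ `ord x` as numbers, while
    -- members of x are smaller than x.
    have hex : ∃ n, ¬ Mem (ord n) x :=
      ⟨(x : ℕ), fun hx => absurd (lt_of_mem hx) (not_lt.2 (ord_strictMono.le_apply (x := (x : ℕ))))⟩
    refine ⟨Nat.find hex, ext fun z => ⟨fun hz => ?_, fun hz => ?_⟩⟩
    · obtain ⟨n, rfl⟩ := hmem z hz
      refine ord_mem_ord_of_lt (lt_of_not_ge fun hn => Nat.find_spec hex ?_)
      rcases Nat.lt_or_eq_of_le hn with h1 | h1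
      · exact (h _ hz).1 _ (ord_mem_ord_of_lt h1)
      · rwa [h1]
    · obtain ⟨m, hm, rfl⟩ := mem_ord.1 hz
      exact not_not.1 (Nat.find_min hex hm)

theorem isOrd_iff {x : HFSet} :
    (∀ y, Mem y x → (∀ z, Mem z y → Mem z x) ∧ ∀ z, Mem z y → ∀ w, Mem w z → Mem w y) ↔
      ∃ n, x = ord n := by
  refine ⟨exists_eq_ord x, ?_⟩
  rintro ⟨n, rfl⟩ y hy
  obtain ⟨m, hm, rfl⟩ := mem_ord.1 hy
  refine ⟨fun z hz => ?_, fun z hz w hw => ?_⟩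
  · obtain ⟨l, hl, rfl⟩ := mem_ord.1 hz
    exact ord_mem_ord_of_lt (hl.trans hm)
  · obtain ⟨l, hl, rfl⟩ := mem_ord.1 hz
    obtain ⟨j, hj, rfl⟩ := mem_ord.1 hw
    exact ord_mem_ord_of_lt (hj.trans hl)

theorem ord_ne_pair {n : ℕ} {a b : HFSet} : ord n ≠ pair a b := by
  cases n with
  | zero => exact fun h => pair_ne_empty a b (h.symm.trans ord_zero)
  | succ n => exact fun h => not_empty_mem_pair a b (h ▸ ord_zero ▸ ord_mem_ord_of_lt n.succ_pos)

def tag : ℕ → HFSet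
  | 0 => pair empty empty
  | n + 1 => pair empty (tag n)

theorem tag_ne_empty (n : ℕ) : tag n ≠ empty := by cases n <;> exact pair_ne_empty _ _

theorem tag_inj {m n : ℕ} : tag m = tag n ↔ m = n := by
  refine ⟨?_, fun h => h ▸ rfl⟩
  induction m generalizing n with
  | zero =>
    cases n with
    | zero => exact fun _ => rfl
    | succ n => exact fun h => absurd (pair_inj.1 h).2.symm (tag_ne_empty n)
  | succ m ih =>
    cases n with
    | zero => exact fun h => absurd (pair_inj.1 h).2 (tag_ne_empty m)
    | succ n => exact fun h => congrArg _ (ih (pair_inj.1 h).2)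

/-! #### Construction sequences -/

/-- `s` is a single-valued set of pairs with ordinals as first components, defined at least on
`0, …, k`, and its entry at `k` is `y`. -/
def LstSeq (s k y : HFSet) : Prop :=
  (∃ n, k = ord n) ∧ (∀ x, Mem x (eats k k) → ∃ z, Mem (pair x z) s) ∧
  (∀ z, Mem z s → ∀ z', Mem z' s → ∃ n y m y', z = pair (ord n) y ∧ z' = pair (ord m) y' ∧
    (n ≠ m ∨ y = y')) ∧ Mem (pair k y) s

/-- The closure of `B` under the binary step relation `S`. -/
inductive Gen {α : Type} (B : α → Prop) (S : α → α → α → Prop) : α → Prop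
  | base {x} : B x → Gen B S x
  | step {a b x} : Gen B S a → Gen B S b → S a b x → Gen B S x

/-- A list each of whose entries satisfies `B` or is obtained from later ones by `S`. -/
def Justified {α : Type} (B : α → Prop) (S : α → α → α → Prop) (L : List α) : Prop :=
  ∀ l (hl : l < L.length), B L[l] ∨ ∃ m n, ∃ (hm : m < l) (hn : n < l), S L[m] L[n] L[l]

theorem Justified.append {α : Type} {B : α → Prop} {S : α → α → α → Prop} {L M : List α}
    (hL : Justified B S L) (hM : Justified B S M) : Justified B S (L ++ M) := by
  intro l hl
  by_cases h : l < L.length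
  · rcases hL l h with h1 | ⟨m, n, hm, hn, h1⟩
    · left; simpa [List.getElem_append, h] using h1
    · right
      refine ⟨m, n, hm, hn, ?_⟩
      simpa [List.getElem_append, h, hm.trans h, hn.trans h] using h1
  · have hl' : l - L.length < M.length := by rw [List.length_append] at hl; omega
    rcases hM _ hl' with h1 | ⟨m, n, hm, hn, h1⟩
    · left; simpa [List.getElem_append, h] using h1
    · right
      -- Positions in the second list are shifted by the length of the first, so justifications
      -- still point to smaller indices.
      refine ⟨m + L.length, n + L.length, by omega, by omega, ?_⟩
      simpa [List.getElem_append, h] using h1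

theorem Justified.concat {α : Type} {B : α → Prop} {S : α → α → α → Prop} {L : List α} {x : α}
    (hL : Justified B S L) (h : B x ∨ ∃ a ∈ L, ∃ b ∈ L, S a b x) : Justified B S (L ++ [x]) := by
  intro l hl
  by_cases hlt : l < L.length
  · rcases hL l hlt with h1 | ⟨m, n, hm, hn, h1⟩
    · left; simpa [List.getElem_append, hlt] using h1
    · right
      refine ⟨m, n, hm, hn, ?_⟩
      simpa [List.getElem_append, hlt, hm.trans hlt, hn.trans hlt] using h1
  · have hl' : l = L.length := by simp at hl; omega
    subst hl'
    rcases h with h | ⟨a, ha, b, hb, h⟩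
    · left; simpa using h
    · right
      obtain ⟨m, hm, rfl⟩ := List.getElem_of_mem ha
      obtain ⟨n, hn, rfl⟩ := List.getElem_of_mem hb
      exact ⟨m, n, hm, hn, by simpa [List.getElem_append, hm, hn] using h⟩

/-- A derivation tree is linearised: the lists for the two premises are concatenated and the
conclusion is placed last. -/
theorem Gen.exists_list {α : Type} {B : α → Prop} {S : α → α → α → Prop} {x : α}
    (h : Gen B S x) : ∃ L, Justified B S (L ++ [x]) := by
  induction h with
  | base h => exact ⟨[], Justified.concat (fun l hl => absurd hl (by simp)) (.inl h)⟩
  | @step a b x _ _ h iha ihb =>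
    obtain ⟨L, hL⟩ := iha
    obtain ⟨M, hM⟩ := ihb
    exact ⟨_, (hL.append hM).concat (.inr ⟨a, by simp, b, by simp, h⟩)⟩

/-- The set of the pairs `⟨n, f n⟩` for `n < k`. -/
def graph (f : ℕ → HFSet) : ℕ → HFSet
  | 0 => empty
  | n + 1 => eats (graph f n) (pair (ord n) (f n))

theorem mem_graph {f : ℕ → HFSet} {k : ℕ} {z : HFSet} :
    Mem z (graph f k) ↔ ∃ n < k, z = pair (ord n) (f n) := by
  induction k with
  | zero => simp [graph, mem_empty]
  | succ k ih =>
    simp only [graph, mem_eats, ih, Nat.lt_succ_iff_lt_or_eq, or_and_right, exists_or,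
      exists_eq_left]

/-- `s` is a sequence of objects coded by `c`, ending at `k` with `y`, in which each entry
satisfies `B` or is obtained from earlier ones by `S`. -/
def Constr {α : Type} (c : α → HFSet) (B : α → Prop) (S : α → α → α → Prop) (s k : HFSet)
    (y : α) : Prop :=
  LstSeq s k (c y) ∧ ∀ l, Mem l (eats k k) → ∃ x, Mem (pair l (c x)) s ∧
    (B x ∨ ∃ m n a b, Mem m l ∧ Mem n l ∧ Mem (pair m (c a)) s ∧ Mem (pair n (c b)) s ∧ S a b x)

/-- The bridge between coded sequences and inductive definitions. A sequence is unwound by strong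
induction on its index. Conversely, a linearised derivation becomes a sequence by taking the graph
of its list. Injectivity of the coding is needed only for unwinding, to identify an entry with the
object that was justified at the same index. -/
theorem exists_constr_iff_gen {α : Type} {c : α → HFSet} (hc : Function.Injective c)
    {B : α → Prop} {S : α → α → α → Prop} {y : α} :
    (∃ s k, Constr c B S s k y) ↔ Gen B S y := by
  constructor
  · rintro ⟨s, k, ⟨⟨k, rfl⟩, -, hfun, hy⟩, h⟩
    -- The claim covers every object filed at index l, since the premises of a step are given merely
    -- as entries at smaller indices.
    have key : ∀ l, l < k + 1 → ∀ x, Mem (pair (ord l) (c x)) s → Gen B S x := by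
      intro l
      induction l using Nat.strong_induction_on with
      | _ l ih =>
        intro hl x hx
        obtain ⟨x', hx', hB⟩ := h (ord l) (ord_succ k ▸ ord_mem_ord_of_lt hl)
        -- Single-valuedness makes the codes agree, and injectivity of `c` then makes the objects
        -- agree.
        have hxx : x = x' := by
          obtain ⟨n, y, m, y', h1, h2, h3⟩ := hfun _ hx _ hx'
          rw [pair_inj] at h1 h2
          have : n = m := ord_inj.1 (h1.1.symm.trans h2.1)
          exact hc (by rw [h1.2, h2.2]; exact h3.resolve_left (not_not.2 this))
        subst hxx
        rcases hB with hB | ⟨m, n, a, b, hm, hn, ha, hb, hS⟩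
        · exact .base hB
        · obtain ⟨m, hml, rfl⟩ := mem_ord.1 hm
          obtain ⟨n, hnl, rfl⟩ := mem_ord.1 hn
          exact .step (ih m hml (hml.trans hl) a ha) (ih n hnl (hnl.trans hl) b hb) hS
    exact key k k.lt_succ_self y hy
  · intro hy
    obtain ⟨L, hL⟩ := hy.exists_list
    -- The default y makes f total; only indices inside the list are ever used.
    let f : ℕ → α := fun n => (L ++ [y]).getD n y
    have hf : ∀ n (hn : n < (L ++ [y]).length), f n = (L ++ [y])[n] := fun n hn => by
      simp only [f, List.getD_eq_getElem _ _ hn]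
    have hlast : f L.length = y := by rw [hf _ (by simp)]; simp
    refine ⟨graph (c ∘ f) (L.length + 1), ord L.length, ⟨⟨_, rfl⟩, ?_, ?_, ?_⟩, ?_⟩
    · intro x hx
      rw [← ord_succ] at hx
      obtain ⟨n, hn, rfl⟩ := mem_ord.1 hx
      exact ⟨_, mem_graph.2 ⟨n, hn, rfl⟩⟩
    · intro z hz z' hz'
      obtain ⟨n, hn, rfl⟩ := mem_graph.1 hz
      obtain ⟨m, hm, rfl⟩ := mem_graph.1 hz'
      refine ⟨n, _, m, _, rfl, rfl, ?_⟩
      by_cases h : n = m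
      · exact .inr (by rw [h])
      · exact .inl h
    · exact mem_graph.2 ⟨_, Nat.lt_succ_self _, by simp [hlast]⟩
    · intro x hx
      rw [← ord_succ] at hx
      obtain ⟨l, hl, rfl⟩ := mem_ord.1 hx
      have hlen : l < (L ++ [y]).length := by simpa using hl
      refine ⟨f l, mem_graph.2 ⟨l, hl, rfl⟩, ?_⟩
      rcases hL l hlen with h | ⟨m, n, hm, hn, h⟩
      · left; rwa [hf l hlen]
      · right
        refine ⟨ord m, ord n, f m, f n, ord_mem_ord_of_lt hm, ord_mem_ord_of_lt hn,
          mem_graph.2 ⟨m, hm.trans hl, rfl⟩, mem_graph.2 ⟨n, hn.trans hl, rfl⟩, ?_⟩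
        rwa [hf l hlen, hf m (hm.trans hlen), hf n (hn.trans hlen)]

end HFSet


/-! ### Substitution and abstraction through de Bruijn syntax -/

/-- Abstraction of the name `i` to the index `k`. -/
def DBTm.abst (i : Name) (k : ℕ) (t : DBTm) : DBTm := t.map (Function.update DBTm.var i (ind k))

def DBFm.abst (i : Name) : ℕ → DBFm → DBFm
  | k, mem t u => mem (t.abst i k) (u.abst i k)
  | k, eq t u => eq (t.abst i k) (u.abst i k)
  | k, disj A B => disj (A.abst i k) (B.abst i k)
  | k, neg A => neg (A.abst i k)
  | k, ex A => ex (A.abst i (k + 1))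

/-- Substitution of `w` for the name `i`. -/
def DBTm.sub (i : Name) (t w : DBTm) : DBTm := t.map (Function.update DBTm.var i w)

def DBFm.sub (i : Name) (A : DBFm) (w : DBTm) : DBFm := A.map (Function.update DBTm.var i w)

/-- Lists of binders have the innermost first, so a name appended at the end is the outermost binder
and gets index `xs.length`. If the name is already bound in xs, that occurrence is an index and
abstraction leaves it alone. -/
theorem lookup_append_abst (i : Name) (xs : List Name) (x : Name) :
    lookup (xs ++ [i]) x = (lookup xs x).abst i xs.length := by
  unfold lookup DBTm.abst
  by_cases hx : x ∈ xs
  · simp [hx, DBTm.map, List.idxOf_append_of_mem hx]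
  · by_cases hi : x = i
    · subst hi; simp [hx, DBTm.map, List.idxOf_append_of_notMem hx]
    · simp [hx, hi, DBTm.map]

theorem Tm.trans_append (i : Name) (xs : List Name) (t : Tm) :
    t.trans (xs ++ [i]) = (t.trans xs).abst i xs.length := by
  induction t with
  | zero => rfl
  | var x => exact lookup_append_abst i xs x
  | eats t u iht ihu => simp [Tm.trans, iht, ihu, DBTm.abst, DBTm.map]

/-- Translation under a binder agrees with translating first and abstracting afterwards. The list xs
is general because descending under a quantifier extends it; the empty list is the case that
describes the code of an existential formula. -/
theorem PreFm.trans_append (i : Name) (A : PreFm) : ∀ xs : List Name,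
    A.trans (xs ++ [i]) = (A.trans xs).abst i xs.length := by
  induction A with
  | ex j A ih =>
    intro xs
    simp only [PreFm.trans, DBFm.abst]
    rw [← List.cons_append, ih, List.length_cons]
  | _ => intro xs; simp_all [PreFm.trans, DBFm.abst, Tm.trans_append]

theorem DBTm.map_map (f g : Name → DBTm) (t : DBTm) :
    (t.map f).map g = t.map fun v => (f v).map g := by
  induction t <;> simp_all [DBTm.map]

theorem DBFm.map_map (f g : Name → DBTm) (A : DBFm) :
    (A.map f).map g = A.map fun v => (f v).map g := by
  induction A <;> simp_all [DBFm.map, DBTm.map_map]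

theorem DBTm.map_var (t : DBTm) : t.map DBTm.var = t := by
  induction t <;> simp_all [DBTm.map]

theorem DBFm.map_var (A : DBFm) : A.map DBTm.var = A := by
  induction A <;> simp_all [DBFm.map, DBTm.map_var]

theorem Tm.trans_nil_subst (σ : Name → Tm) (t : Tm) :
    (t.subst σ).trans [] = (t.trans []).map fun v => (σ v).trans [] :=
  Tm.trans_subst _ σ [] [] t fun v _ => by simp [lookup, DBTm.map]

theorem Tm.subst_congr {σ τ : Name → Tm} {t : Tm} (h : ∀ v ∈ t.fv, σ v = τ v) :
    t.subst σ = t.subst τ := by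
  induction t <;> simp_all [Tm.fv, Tm.subst]

theorem Tm.subst_var (t : Tm) : t.subst Tm.var = t := by
  induction t <;> simp_all [Tm.subst]

theorem Tm.eval_subst (σ : Name → Tm) (e : Name → HFSet) (t : Tm) :
    (t.subst σ).eval e = t.eval fun v => (σ v).eval e := by
  induction t <;> simp_all [Tm.subst, Tm.eval]

theorem Tm.fv_subst {σ : Name → Tm} {t : Tm} {v : Name} (h : v ∈ (t.subst σ).fv) :
    ∃ w ∈ t.fv, v ∈ (σ w).fv := by
  induction t with
  | zero => simp [Tm.subst, Tm.fv] at h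
  | var i => exact ⟨i, by simp [Tm.fv], h⟩
  | eats t u iht ihu =>
    simp only [Tm.subst, Tm.fv, Finset.mem_union] at h ⊢
    rcases h with h | h
    · obtain ⟨w, hw, hv⟩ := iht h; exact ⟨w, .inl hw, hv⟩
    · obtain ⟨w, hw, hv⟩ := ihu h; exact ⟨w, .inr hw, hv⟩

theorem PreFm.fv_subst (A : PreFm) : ∀ {σ : Name → Tm} {v : Name}, v ∈ (A.subst σ).fv →
    ∃ w ∈ A.fv, v ∈ (σ w).fv := by
  induction A with
  | ex i A ih =>
    intro σ v h
    simp only [PreFm.subst, PreFm.fv, Finset.mem_erase] at h ⊢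
    obtain ⟨w, hw, hv⟩ := ih h.2
    by_cases hwi : w = i
    · subst hwi; simp [Tm.fv] at hv; exact absurd hv h.1
    · rw [Function.update_of_ne hwi] at hv; exact ⟨w, ⟨hwi, hw⟩, hv⟩
  | neg A ih => exact ih
  | disj A B ihA ihB =>
    intro σ v h
    simp only [PreFm.subst, PreFm.fv, Finset.mem_union] at h ⊢
    rcases h with h | h
    · obtain ⟨w, hw, hv⟩ := ihA h; exact ⟨w, .inl hw, hv⟩
    · obtain ⟨w, hw, hv⟩ := ihB h; exact ⟨w, .inr hw, hv⟩
  | mem t u =>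
    intro σ v h
    exact Tm.fv_subst (t := .eats t u) h
  | eq t u =>
    intro σ v h
    exact Tm.fv_subst (t := .eats t u) h

theorem PreFm.eval_subst (A : PreFm) : ∀ (σ : Name → Tm) (e : Name → HFSet),
    (A.subst σ).Eval e ↔ A.Eval fun v => (σ v).eval e := by
  induction A with
  | ex i A ih =>
    intro σ e
    simp only [PreFm.subst, PreFm.Eval]
    refine exists_congr fun x => ?_
    rw [ih]
    refine A.eval_congr fun v hv => ?_
    by_cases hvi : v = i
    · subst hvi; simp [Tm.eval]
    · rw [Function.update_of_ne hvi, Function.update_of_ne hvi]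
      refine Tm.eval_congr _ fun w hw => Function.update_of_ne ?_ _ _
      rintro rfl
      -- The fresh bound name occurs in none of the terms substituted for the free variables of the
      -- quantified formula, so changing its value does not affect them.
      exact freshName_notMem ((A.fv.erase i).biUnion fun v => (σ v).fv)
        (Finset.mem_biUnion.2 ⟨v, by simp [hv, hvi], hw⟩)
  | _ => simp_all [PreFm.subst, PreFm.Eval, Tm.eval_subst]

/-! ### Translation, substitution and truth for formulas modulo renaming -/

namespace Fm

theorem trans_injective : Function.Injective Fm.trans := by
  intro A B
  induction A using Quotient.inductionOn
  induction B using Quotient.inductionOn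
  exact fun h => Quotient.sound (PreFm.alpha_iff_trans_eq.2 h)

theorem trans_disj (A B : Fm) : (A OR B).trans = DBFm.disj A.trans B.trans := by
  induction A using Quotient.inductionOn
  induction B using Quotient.inductionOn
  rfl

theorem trans_neg (A : Fm) : A.neg.trans = DBFm.neg A.trans := by
  induction A using Quotient.inductionOn
  rfl

theorem trans_ex (i : Name) (A : Fm) : (Fm.ex i A).trans = DBFm.ex (A.trans.abst i 0) := by
  induction A using Quotient.inductionOn with
  | h A => exact congrArg DBFm.ex (A.trans_append i [])

theorem trans_subst (σ : Name → Tm) (A : Fm) :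
    (A.subst σ).trans = A.trans.map fun v => (σ v).trans [] := by
  induction A using Quotient.inductionOn with
  | h A => exact PreFm.trans_subst σ A

theorem trans_subst1 (A : Fm) (i : Name) (t : Tm) :
    (A.subst1 i t).trans = A.trans.sub i (t.trans []) := by
  rw [subst1, trans_subst, DBFm.sub]
  congr 1
  funext v
  by_cases h : v = i
  · subst h; simp
  · simp [h, Tm.trans, lookup]

/-- Not every de Bruijn formula is a translation, since indices may dangle. The components of a
translated disjunction are nevertheless translations; inverting a coded implication depends on this.
-/
theorem exists_of_trans_eq_disj {A : Fm} {D E : DBFm} (h : A.trans = DBFm.disj D E) :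
    ∃ B C : Fm, A = (B OR C) ∧ B.trans = D ∧ C.trans = E := by
  induction A using Quotient.inductionOn with
  | h A =>
    change A.trans [] = _ at h
    cases A with
    | disj B C =>
      simp only [PreFm.trans, DBFm.disj.injEq] at h
      exact ⟨Quotient.mk _ B, Quotient.mk _ C, rfl, h.1, h.2⟩
    | _ => simp [PreFm.trans] at h

theorem disj_fv (A B : Fm) : (A OR B).fv = A.fv ∪ B.fv := by
  induction A using Quotient.inductionOn
  induction B using Quotient.inductionOn
  rfl

theorem neg_fv (A : Fm) : A.neg.fv = A.fv := by
  induction A using Quotient.inductionOn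
  rfl

theorem ex_fv (i : Name) (A : Fm) : (Fm.ex i A).fv = A.fv.erase i := by
  induction A using Quotient.inductionOn
  rfl

theorem mem_fv (t u : Tm) : (t IN u).fv = t.fv ∪ u.fv := rfl

theorem eq_fv (t u : Tm) : (t EQ u).fv = t.fv ∪ u.fv := rfl

theorem fv_subst {A : Fm} {σ : Name → Tm} {v : Name} (h : v ∈ (A.subst σ).fv) :
    ∃ w ∈ A.fv, v ∈ (σ w).fv := by
  induction A using Quotient.inductionOn with
  | h A => exact A.fv_subst h

theorem subst_mem (σ : Name → Tm) (t u : Tm) : (t IN u).subst σ = t.subst σ IN u.subst σ := rfl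

theorem subst_disj (σ : Name → Tm) (A B : Fm) : (A OR B).subst σ = (A.subst σ OR B.subst σ) := by
  induction A using Quotient.inductionOn
  induction B using Quotient.inductionOn
  rfl

theorem subst_neg (σ : Name → Tm) (A : Fm) : A.neg.subst σ = (A.subst σ).neg := by
  induction A using Quotient.inductionOn
  rfl

theorem subst_imp (σ : Name → Tm) (A B : Fm) :
    (A IMP B).subst σ = (A.subst σ IMP B.subst σ) := by
  simp only [imp, subst_disj, subst_neg]

theorem subst_conj (σ : Name → Tm) (A B : Fm) :
    (A AND B).subst σ = (A.subst σ AND B.subst σ) := by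
  simp only [conj, subst_disj, subst_neg]

theorem subst_iff (σ : Name → Tm) (A B : Fm) :
    (A IFF B).subst σ = (A.subst σ IFF B.subst σ) := by
  simp only [iff, subst_conj, subst_imp]

theorem subst_congr {A : Fm} {σ τ : Name → Tm} (h : ∀ v ∈ A.fv, σ v = τ v) :
    A.subst σ = A.subst τ := by
  induction A using Quotient.inductionOn with
  | h A =>
    apply Quotient.sound
    rw [PreFm.alpha_iff_trans_eq, PreFm.trans_subst τ]
    exact PreFm.trans_subst_aux _ (fun i => (τ i).trans_nil_lift) A σ [] [] fun v hv => by
      simp [lookup, DBTm.map, h v hv]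

theorem subst_subst (σ τ : Name → Tm) (A : Fm) :
    (A.subst σ).subst τ = A.subst fun v => (σ v).subst τ := by
  apply trans_injective
  simp only [trans_subst, DBFm.map_map, Tm.trans_nil_subst]

theorem subst_var (A : Fm) : A.subst Tm.var = A := by
  apply trans_injective
  rw [trans_subst]
  exact DBFm.map_var _

theorem subst1_var_self (A : Fm) (i : Name) : A.subst1 i (Tm.var i) = A := by
  rw [subst1, Function.update_eq_self, subst_var]

theorem subst1_of_notMem {A : Fm} {i : Name} (h : i ∉ A.fv) (t : Tm) : A.subst1 i t = A := by
  conv_rhs => rw [← A.subst_var]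
  refine subst_congr fun v hv => Function.update_of_ne ?_ _ _
  rintro rfl
  exact h hv

/-- Substituting the closed term 0 removes every free occurrence of i, so it has no effect only when
there was none. This is the correctness of the coded non-occurrence predicate. -/
theorem notMem_fv_iff_subst1_zero {A : Fm} {i : Name} : A.subst1 i Tm.zero = A ↔ i ∉ A.fv := by
  refine ⟨fun h hi => ?_, fun h => subst1_of_notMem h _⟩
  rw [← h] at hi
  obtain ⟨w, -, hw⟩ := fv_subst hi
  by_cases hwi : w = i
  · subst hwi; simp [Tm.fv] at hw
  · rw [Function.update_of_ne hwi] at hw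
    simp [Tm.fv] at hw
    exact hwi hw.symm

/-- Substitution below a quantifier, with any sufficiently fresh name for the bound variable. -/
theorem subst_ex {i k : Name} {σ : Name → Tm} {A : Fm}
    (hk : ∀ v ∈ A.fv, v ≠ i → k ∉ (σ v).fv) :
    (Fm.ex i A).subst σ = Fm.ex k (A.subst (Function.update σ i (Tm.var k))) := by
  induction A using Quotient.inductionOn with
  | h A =>
    apply Quotient.sound
    rw [PreFm.alpha_iff_trans_eq, PreFm.trans_subst]
    simp only [PreFm.trans, DBFm.map]
    rw [PreFm.trans_subst_aux (fun v => (σ v).trans []) (fun _ => Tm.trans_nil_lift _) A _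
      [k] [i]]
    intro v hv
    rw [lookup_cons]
    by_cases hvi : v = i
    · subst hvi; simp [Tm.trans, lookup_cons, DBTm.map]
    · have := Tm.trans_cons [] (hk v hv hvi)
      rw [Tm.trans_nil_lift] at this
      simp [hvi, lookup, DBTm.lift, DBTm.map, this]

theorem eval_mem (e : Name → HFSet) (t u : Tm) :
    (t IN u).Eval e ↔ HFSet.Mem (t.eval e) (u.eval e) := Iff.rfl

theorem eval_eq (e : Name → HFSet) (t u : Tm) : (t EQ u).Eval e ↔ t.eval e = u.eval e := Iff.rfl

theorem eval_disj (e : Name → HFSet) (A B : Fm) : (A OR B).Eval e ↔ A.Eval e ∨ B.Eval e := by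
  induction A using Quotient.inductionOn
  induction B using Quotient.inductionOn
  exact Iff.rfl

theorem eval_neg (e : Name → HFSet) (A : Fm) : A.neg.Eval e ↔ ¬ A.Eval e := by
  induction A using Quotient.inductionOn
  exact Iff.rfl

theorem eval_ex (e : Name → HFSet) (i : Name) (A : Fm) :
    (Fm.ex i A).Eval e ↔ ∃ x, A.Eval (Function.update e i x) := by
  induction A using Quotient.inductionOn
  exact Iff.rfl

theorem eval_imp (e : Name → HFSet) (A B : Fm) : (A IMP B).Eval e ↔ (A.Eval e → B.Eval e) := by
  rw [imp, eval_disj, eval_neg, imp_iff_not_or]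

theorem eval_conj (e : Name → HFSet) (A B : Fm) : (A AND B).Eval e ↔ A.Eval e ∧ B.Eval e := by
  rw [conj, eval_neg, eval_disj, eval_neg, eval_neg]; tauto

theorem eval_iff (e : Name → HFSet) (A B : Fm) : (A IFF B).Eval e ↔ (A.Eval e ↔ B.Eval e) := by
  rw [iff, eval_conj, eval_imp, eval_imp]
  exact iff_iff_implies_and_implies.symm

theorem eval_all (e : Name → HFSet) (i : Name) (A : Fm) :
    (Fm.all i A).Eval e ↔ ∀ x, A.Eval (Function.update e i x) := by
  simp [all, eval_neg, eval_ex]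

theorem eval_neq (e : Name → HFSet) (t u : Tm) : (t NEQ u).Eval e ↔ t.eval e ≠ u.eval e := by
  rw [neq, eval_neg, eval_eq]

theorem eval_subst (σ : Name → Tm) (e : Name → HFSet) (A : Fm) :
    (A.subst σ).Eval e ↔ A.Eval fun v => (σ v).eval e := by
  induction A using Quotient.inductionOn with
  | h A => exact A.eval_subst σ e

theorem eval_subst1 (A : Fm) (i : Name) (t : Tm) (e : Name → HFSet) :
    (A.subst1 i t).Eval e ↔ A.Eval (Function.update e i (t.eval e)) := by
  rw [subst1, eval_subst]
  have : (fun v => (Function.update Tm.var i t v).eval e) = Function.update e i (t.eval e) := by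
    funext v
    by_cases h : v = i
    · subst h; simp
    · simp [h, Tm.eval]
  rw [this]

theorem eval_congr {A : Fm} {e e' : Name → HFSet} (h : ∀ v ∈ A.fv, e v = e' v) :
    A.Eval e ↔ A.Eval e' := by
  induction A using Quotient.inductionOn with
  | h A => exact A.eval_congr h

end Fm

/-! ### Soundness -/

theorem Hfthm.sound {extra : Fm} (hextra : ∀ e : Name → HFSet, extra.Eval e) {H : Set Fm} {A : Fm}
    (h : Hfthm extra H A) : ∀ e : Name → HFSet, (∀ C ∈ H, C.Eval e) → A.Eval e := by
  induction h with
  | hyp h => exact fun e he => he _ h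
  | extra => exact fun e _ => hextra e
  | bool h => intro e _; cases h <;> simp only [Fm.eval_imp, Fm.eval_disj, Fm.eval_neg] <;> tauto
  | eq h =>
    intro e _
    cases h <;> simp only [reflAx, eqCongAx, memCongAx, eatsCongAx, Fm.eval_imp, Fm.eval_conj,
      Fm.eval_eq, Fm.eval_mem, Tm.eval]
    · rintro ⟨h1, h2⟩ h3; rw [← h1, ← h2, h3]
    · rintro ⟨h1, h2⟩ h3; rwa [← h1, ← h2]
    · rintro ⟨h1, h2⟩; rw [h1, h2]
  | spec h =>
    intro e _
    cases h with
    | spec A i t =>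
      rw [Fm.eval_imp, Fm.eval_subst1, Fm.eval_ex]
      exact fun h => ⟨_, h⟩
  | hf h =>
    intro e _
    cases h
    · simp only [hf1, Fm.eval_iff, Fm.eval_eq, Fm.eval_all, Fm.eval_neg, Fm.eval_mem, Tm.eval]
      simpa using HFSet.eq_empty_iff
    · simp only [hf2, Fm.eval_iff, Fm.eval_eq, Fm.eval_all, Fm.eval_disj, Fm.eval_mem, Tm.eval]
      simpa using HFSet.eq_eats_iff
  | ind h =>
    intro e _
    cases h with
    | ind A i j hji hj =>
      simp only [Fm.eval_imp, Fm.eval_subst1, Fm.eval_all, Tm.eval]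
      intro h0 h1 x
      induction x using HFSet.eats_induction with
      | h0 => exact h0
      | h1 x y ihx ihy =>
        -- The axiom is evaluated with i and j already assigned. The value of j is invisible to A,
        -- and the inner update at i overwrites the outer one.
        have hupd : ∀ z, A.Eval (Function.update (Function.update (Function.update e i x) j y) i z) ↔
            A.Eval (Function.update e i z) := fun z => by
          refine Fm.eval_congr fun v hv => ?_
          by_cases hvi : v = i
          · simp [hvi]
          · have hvj : v ≠ j := by rintro rfl; exact hj hv
            simp [hvi, hvj]
        have h2 := h1 x y
        rw [hupd, hupd] at h2
        simp only [Function.update_self, Function.update_of_ne hji.symm] at h2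
        refine h2 ?_ ihy
        refine (Fm.eval_congr fun v hv => ?_).1 ihx
        have hvj : v ≠ j := by rintro rfl; exact hj hv
        simp [hvj]
  | mp _ _ ih1 ih2 =>
    intro e he
    exact (Fm.eval_imp ..).1 (ih1 e fun C hC => he C (.inl hC)) (ih2 e fun C hC => he C (.inr hC))
  | _ _h hB hH ih =>
    rename_i H A B i
    intro e he
    rw [Fm.eval_imp, Fm.eval_ex]
    rintro ⟨x, hx⟩
    have hup : ∀ C : Fm, i ∉ C.fv → (C.Eval (Function.update e i x) ↔ C.Eval e) := fun C hC =>
      Fm.eval_congr fun v hv => Function.update_of_ne (by rintro rfl; exact hC hv) _ _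
    exact (hup B hB).1 ((Fm.eval_imp ..).1 (ih _ fun C hC => (hup C (hH C hC)).2 (he C hC)) hx)


/-! ### Propositional completeness -/

/-- A set of formulas that contains the Boolean axioms and is closed under modus ponens. -/
structure IsTheory (S : Set Fm) : Prop where
  bool : ∀ {A}, BooleanAxiom A → A ∈ S
  mp : ∀ {A B : Fm}, (A IMP B) ∈ S → A ∈ S → B ∈ S

namespace IsTheory

variable {S : Set Fm} (hS : IsTheory S) {A B C : Fm}
include hS

theorem contract (h : (A OR A) ∈ S) : A ∈ S := hS.mp (hS.bool (.disjCont A)) h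

theorem cut (h1 : (C OR A) ∈ S) (h2 : (C.neg OR B) ∈ S) : (A OR B) ∈ S :=
  hS.mp (hS.mp (hS.bool (.disjConj A B C)) h1) h2

/-- Commutativity is not an axiom; it is a cut against A → A, read as ¬A ∨ A. -/
theorem comm (h : (A OR B) ∈ S) : (B OR A) ∈ S := hS.cut h (hS.bool (.ident A))

theorem inl (h : A ∈ S) : (A OR B) ∈ S := hS.mp (hS.bool (.disjI1 A B)) h

theorem inr (h : B ∈ S) : (A OR B) ∈ S := hS.comm (hS.inl h)

theorem assoc (h : (A OR (B OR C)) ∈ S) : ((A OR B) OR C) ∈ S :=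
  hS.mp (hS.bool (.disjAssoc A B C)) h

theorem assoc' (h : ((A OR B) OR C) ∈ S) : (A OR (B OR C)) ∈ S :=
  hS.comm (hS.assoc (hS.comm (hS.assoc (hS.comm h))))

/-- Modus ponens under an assumption C, which is the core of the deduction theorem: the formulas
implied by C form a theory again. Cutting A leaves ¬C ∨ (B ∨ ¬C), and contraction merges the two
copies of ¬C. -/
theorem mp_under (h1 : (C IMP (A IMP B)) ∈ S) (h2 : (C IMP A) ∈ S) : (C IMP B) ∈ S := by
  have h3 := hS.cut (hS.comm h2) (hS.assoc' (hS.comm h1))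
  have h4 := hS.assoc' (hS.comm h3)
  exact hS.cut (hS.comm h4) (hS.bool (.disjCont C.neg)) |> hS.comm

theorem explosion (h1 : A ∈ S) (h2 : A.neg ∈ S) : B ∈ S :=
  hS.contract (hS.cut (hS.inl h1) (hS.inl h2))

theorem cases (h1 : (A IMP B) ∈ S) (h2 : (A.neg IMP B) ∈ S) : B ∈ S :=
  hS.contract (hS.cut h1 h2)

theorem orElim (h : (A OR B) ∈ S) (h1 : (A IMP C) ∈ S) (h2 : (B IMP C) ∈ S) : C ∈ S :=
  hS.contract (hS.cut (hS.comm (hS.comm (hS.cut h h1))) h2)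

end IsTheory

/-- A truth value assignment that respects the connectives and satisfies all theorems. -/
structure IsVal (extra : Fm) (v : Fm → Prop) : Prop where
  neg : ∀ A : Fm, v A.neg ↔ ¬ v A
  disj : ∀ A B : Fm, v (A OR B) ↔ v A ∨ v B
  thm : ∀ A, Hfthm extra ∅ A → v A

theorem Hfthm.mp' {extra A B : Fm} (h1 : Hfthm extra ∅ (A IMP B)) (h2 : Hfthm extra ∅ A) :
    Hfthm extra ∅ B := by
  simpa using Hfthm.mp h1 h2

theorem isTheory_thm (extra : Fm) : IsTheory {A | Hfthm extra ∅ A} :=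
  ⟨fun h => .bool h, fun h1 h2 => Hfthm.mp' h1 h2⟩

theorem IsVal.imp {extra : Fm} {v : Fm → Prop} (hv : IsVal extra v) (A B : Fm) :
    v (A IMP B) ↔ (v A → v B) := by
  rw [Fm.imp, hv.disj, hv.neg, imp_iff_not_or]

theorem IsVal.conj {extra : Fm} {v : Fm → Prop} (hv : IsVal extra v) (A B : Fm) :
    v (A AND B) ↔ v A ∧ v B := by
  rw [Fm.conj, hv.neg, hv.disj, hv.neg, hv.neg]; tauto

theorem IsVal.iff {extra : Fm} {v : Fm → Prop} (hv : IsVal extra v) (A B : Fm) :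
    v (A IFF B) ↔ (v A ↔ v B) := by
  rw [Fm.iff, hv.conj, hv.imp, hv.imp]
  exact iff_iff_implies_and_implies.symm

/-- Zorn's lemma applies because modus ponens has only two premises, which lie in a common member of
a chain. -/
theorem exists_maximal_theory {T : Set Fm} (hT : IsTheory T) {B : Fm} (hB : B ∉ T) :
    ∃ S, T ⊆ S ∧ Maximal (fun S => IsTheory S ∧ B ∉ S) S := by
  refine zorn_subset_nonempty {S | IsTheory S ∧ B ∉ S} (fun c hc hchain hne => ?_) T ⟨hT, hB⟩
  refine ⟨⋃₀ c, ⟨⟨fun h => ?_, fun {A D} h1 h2 => ?_⟩, ?_⟩, fun s hs => Set.subset_sUnion_of_mem hs⟩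
  · obtain ⟨s, hs⟩ := hne
    exact ⟨s, hs, (hc hs).1.bool h⟩
  · obtain ⟨s, hs, h1⟩ := h1
    obtain ⟨s', hs', h2⟩ := h2
    rcases hchain.total hs hs' with h | h
    · exact ⟨s', hs', (hc hs').1.mp (h h1) h2⟩
    · exact ⟨s, hs, (hc hs).1.mp h1 (h h2)⟩
  · rintro ⟨s, hs, h⟩
    exact (hc hs).2 h

/-- To prove a formula in the calculus, one may argue with truth values. -/
theorem Hfthm.of_val {extra B : Fm} (h : ∀ v, IsVal extra v → v B) : Hfthm extra ∅ B := by
  by_contra hB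
  obtain ⟨S, hTS, ⟨hS, hBS⟩, hmax⟩ := exists_maximal_theory (isTheory_thm extra) hB
  -- For C outside S, the formulas implied by C form a theory that extends S and contains C. By
  -- maximality it must contain B.
  have himp : ∀ {C : Fm}, C ∉ S → (C IMP B) ∈ S := by
    intro C hC
    by_contra hCB
    have hS' : IsTheory {D | (C IMP D) ∈ S} :=
      ⟨fun h => hS.inr (hS.bool h), fun h1 h2 => hS.mp_under h1 h2⟩
    exact hC (hmax (y := {D | (C IMP D) ∈ S}) ⟨hS', hCB⟩ (fun D hD => hS.inr hD)
      (hS.bool (.ident C)))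
  -- Membership in S is the truth assignment. If it failed to respect negation or disjunction, case
  -- analysis inside S would put B in S.
  refine hBS (h (fun A => A ∈ S) ⟨fun A => ⟨fun h1 h2 => hBS (hS.explosion h2 h1), fun h1 => ?_⟩,
    fun A D => ⟨fun h1 => ?_, fun h1 => h1.elim hS.inl hS.inr⟩, fun A hA => hTS hA⟩)
  · by_contra h2
    exact hBS (hS.cases (himp h1) (himp h2))
  · by_contra h2
    rw [not_or] at h2
    exact hBS (hS.orElim h1 (himp h2.1) (himp h2.2))

/-! ### Quantifiers and substitution in the calculus -/

namespace Hfthm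

variable {extra : Fm}

theorem ex_intro (A : Fm) (i : Name) (t : Tm) : Hfthm extra ∅ (A.subst1 i t IMP Fm.ex i A) :=
  .spec ⟨A, i, t⟩

theorem ex_elim {A B : Fm} {i : Name} (h : Hfthm extra ∅ (A IMP B)) (hi : i ∉ B.fv) :
    Hfthm extra ∅ (Fm.ex i A IMP B) :=
  .exists h hi (by simp)

/-- Contraposition of the special axiom for ¬A. -/
theorem all_elim (A : Fm) (i : Name) (t : Tm) : Hfthm extra ∅ (Fm.all i A IMP A.subst1 i t) := by
  refine of_val fun v hv => ?_
  have h := hv.thm _ (ex_intro A.neg i t)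
  rw [Fm.subst1, Fm.subst_neg] at h
  rw [hv.imp, hv.neg] at h
  rw [hv.imp, Fm.all, hv.neg, Fm.subst1]
  tauto

/-- Generalisation from the existential rule: ¬A implies a refutable closed formula, in which i
cannot be free, and hence so does ∃i ¬A. -/
theorem all_intro {A : Fm} (i : Name) (h : Hfthm extra ∅ A) : Hfthm extra ∅ (Fm.all i A) := by
  have h1 : Hfthm extra ∅ (A.neg IMP (Tm.zero EQ Tm.zero IMP Tm.zero EQ Tm.zero).neg) :=
    of_val fun v hv => by
      have := hv.thm _ h
      rw [hv.imp, hv.neg, hv.neg]; tauto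
  have h2 := ex_elim (i := i) h1 (by simp [Fm.imp, Fm.neg_fv, Fm.disj_fv, Fm.eq_fv, Tm.fv])
  refine of_val fun v hv => ?_
  have h2 := hv.thm _ h2
  rw [hv.imp, hv.neg, hv.imp] at h2
  rw [Fm.all, hv.neg]; tauto

theorem subst1 {A : Fm} (h : Hfthm extra ∅ A) (i : Name) (t : Tm) :
    Hfthm extra ∅ (A.subst1 i t) :=
  mp' (all_elim A i t) (all_intro i h)

/-- When no substituted term contains a replaced variable, a simultaneous substitution can be
carried out one variable at a time, since later replacements leave the inserted terms unchanged. -/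
theorem subst_of_disjoint {A : Fm} (h : Hfthm extra ∅ A) (S : Finset Name) : ∀ σ : Name → Tm,
    (∀ v, v ∉ S → σ v = Tm.var v) → (∀ v ∈ S, ∀ w ∈ S, w ∉ (σ v).fv) →
    Hfthm extra ∅ (A.subst σ) := by
  induction S using Finset.induction_on with
  | empty =>
    intro σ h1 _
    rwa [show σ = Tm.var from funext fun v => h1 v (by simp), Fm.subst_var]
  | insert a S ha ih =>
    intro σ h1 h2
    have h3 := subst1 (ih (Function.update σ a (Tm.var a)) (fun v hv => ?_) (fun v hv w hw => ?_))
      a (σ a)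
    · rw [Fm.subst1, Fm.subst_subst] at h3
      convert h3 using 2
      funext v
      by_cases hva : v = a
      · subst hva; simp [Tm.subst]
      · rw [Function.update_of_ne hva]
        by_cases hvS : v ∈ S
        · conv_lhs => rw [← (σ v).subst_var]
          refine Tm.subst_congr fun w hw => (Function.update_of_ne ?_ _ _).symm
          rintro rfl
          exact h2 v (by simp [hvS]) w (by simp) hw
        · rw [h1 v (by simp [hva, hvS])]
          simp [Tm.subst, hva]
    · by_cases hva : v = a
      · subst hva; simp
      · rw [Function.update_of_ne hva]; exact h1 v (by simp [hva, hv])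
    · have hva : v ≠ a := by rintro rfl; exact ha hv
      rw [Function.update_of_ne hva]
      exact h2 v (by simp [hv]) w (by simp [hw])

/-- Theorems are closed under simultaneous substitution. -/
theorem subst {A : Fm} (h : Hfthm extra ∅ A) (σ : Name → Tm) : Hfthm extra ∅ (A.subst σ) := by
  -- N exceeds every free variable of A and every variable of the terms to be inserted. Free
  -- variables v are first moved to v + N and only then replaced by σ v; each stage satisfies the
  -- disjointness condition.
  obtain ⟨N, hN⟩ : ∃ N, ∀ v ∈ A.fv ∪ A.fv.biUnion fun v => (σ v).fv, v < N :=
    ⟨_, fun v hv => Nat.lt_succ_of_le (Finset.le_sup (f := id) hv)⟩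
  have h1 := subst_of_disjoint h A.fv (fun v => if v ∈ A.fv then Tm.var (v + N) else Tm.var v)
    (fun v hv => by simp [hv]) (fun v hv w hw => by
      have := hN w (by simp [hw])
      rw [if_pos hv]
      simp only [Tm.fv, Finset.mem_singleton]
      rintro rfl
      exact absurd this (Nat.not_lt.2 (Nat.le_add_left N v)))
  have h2 := subst_of_disjoint h1 (A.fv.image (· + N))
    (fun v => if v ∈ A.fv.image (· + N) then σ (v - N) else Tm.var v)
    (fun v hv => if_neg hv) (fun v hv w hw hwv => by
      rw [if_pos hv] at hwv
      obtain ⟨v, hv', rfl⟩ := Finset.mem_image.1 hv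
      obtain ⟨w, -, rfl⟩ := Finset.mem_image.1 hw
      rw [Nat.add_sub_cancel] at hwv
      exact absurd (hN (w + N) (Finset.mem_union_right _ (Finset.mem_biUnion.2 ⟨v, hv', hwv⟩)))
        (Nat.not_lt.2 (Nat.le_add_left N w)))
  rw [Fm.subst_subst] at h2
  rwa [Fm.subst_congr (τ := σ) fun v hv => ?_] at h2
  simp [hv, Tm.subst]

end Hfthm

/-! ### Equality -/

/-- The assignment of the given terms to the first five variables. -/
def assign (a b c d e : Tm) : Name → Tm
  | 0 => a
  | 1 => b
  | 2 => c
  | 3 => d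
  | 4 => e
  | n => .var n

namespace IsVal

variable {extra : Fm} {v : Fm → Prop} (hv : IsVal extra v)
include hv

theorem eq_refl (t : Tm) : v (t EQ t) :=
  hv.thm _ (Hfthm.subst (.eq .refl) (assign .zero t .zero .zero .zero))

theorem eq_cong {a b c d : Tm} (h1 : v (a EQ b)) (h2 : v (c EQ d)) (h3 : v (a EQ c)) :
    v (b EQ d) := by
  have h := hv.thm _ (Hfthm.subst (.eq .eqCong) (assign .zero a b c d))
  rw [eqCongAx, Fm.subst_imp, Fm.subst_imp, Fm.subst_conj, hv.imp, hv.imp, hv.conj] at h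
  exact h ⟨h1, h2⟩ h3

theorem mem_cong {a b c d : Tm} (h1 : v (a EQ b)) (h2 : v (c EQ d)) (h3 : v (a IN c)) :
    v (b IN d) := by
  have h := hv.thm _ (Hfthm.subst (.eq .memCong) (assign .zero a b c d))
  rw [memCongAx, Fm.subst_imp, Fm.subst_imp, Fm.subst_conj, hv.imp, hv.imp, hv.conj] at h
  exact h ⟨h1, h2⟩ h3

theorem eats_cong {a b c d : Tm} (h1 : v (a EQ b)) (h2 : v (c EQ d)) :
    v (a.eats c EQ b.eats d) := by
  have h := hv.thm _ (Hfthm.subst (.eq .eatsCong) (assign .zero a b c d))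
  rw [eatsCongAx, Fm.subst_imp, Fm.subst_conj, hv.imp, hv.conj] at h
  exact h ⟨h1, h2⟩

/-- Congruence of equality applied to a = b, a = a and a = a yields b = a. -/
theorem eq_symm {a b : Tm} (h : v (a EQ b)) : v (b EQ a) :=
  hv.eq_cong h (hv.eq_refl a) (hv.eq_refl a)

theorem notMem_zero (t : Tm) : ¬ v (t IN Tm.zero) := by
  -- The universal quantifier is stripped first, so that the resulting open theorem can be
  -- instantiated by arbitrary terms simultaneously.
  have h1 : Hfthm extra ∅ (Tm.var 0 EQ Tm.zero IMP (Tm.var 1 IN Tm.var 0).neg) := by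
    refine .of_val fun v hv => ?_
    have h1 := hv.thm _ (.hf .hf1)
    have h2 := hv.thm _ (Hfthm.all_elim (Tm.var 1 IN Tm.var 0).neg 1 (.var 1))
    rw [hf1, hv.iff] at h1
    rw [hv.imp, Fm.subst1_var_self] at h2
    rw [hv.imp]
    exact fun h => h2 (h1.1 h)
  have h2 := hv.thm _ (h1.subst (assign .zero t .zero .zero .zero))
  rw [Fm.subst_imp, Fm.subst_neg, hv.imp, hv.neg] at h2
  exact h2 (hv.eq_refl _)

theorem mem_eats {a t u : Tm} : v (a IN t.eats u) ↔ v (a IN t) ∨ v (a EQ u) := by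
  have h1 : Hfthm extra ∅ (Tm.var 0 EQ Tm.eats (.var 1) (.var 2) IMP
      (Tm.var 3 IN Tm.var 0 IFF (Tm.var 3 IN Tm.var 1 OR Tm.var 3 EQ Tm.var 2))) := by
    refine .of_val fun v hv => ?_
    have h1 := hv.thm _ (.hf .hf2)
    have h2 := hv.thm _ (Hfthm.all_elim
      (Tm.var 3 IN Tm.var 0 IFF (Tm.var 3 IN Tm.var 1 OR Tm.var 3 EQ Tm.var 2)) 3 (.var 3))
    rw [hf2, hv.iff] at h1
    rw [hv.imp, Fm.subst1_var_self] at h2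
    rw [hv.imp]
    exact fun h => h2 (h1.1 h)
  have h2 := hv.thm _ (h1.subst (assign (t.eats u) t u a .zero))
  rw [Fm.subst_imp, Fm.subst_iff, Fm.subst_disj, hv.imp, hv.iff, hv.disj] at h2
  exact h2 (hv.eq_refl _)

/-- Replacement of equals in terms. -/
theorem tm_leibniz {t u : Tm} (h : v (t EQ u)) {σ τ : Name → Tm}
    (hστ : ∀ i, σ i = τ i ∨ (σ i = t ∧ τ i = u)) (r : Tm) : v (r.subst σ EQ r.subst τ) := by
  induction r with
  | zero => exact hv.eq_refl _
  | var i =>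
    rcases hστ i with h1 | ⟨h1, h2⟩
    · simp only [Tm.subst, h1]; exact hv.eq_refl _
    · simpa only [Tm.subst, h1, h2]
  | eats r s ihr ihs => exact hv.eats_cong ihr ihs

end IsVal

theorem Fm.induction {P : Fm → Prop} (mem : ∀ t u, P (t IN u)) (eq : ∀ t u, P (t EQ u))
    (disj : ∀ A B, P A → P B → P (A OR B)) (neg : ∀ A, P A → P A.neg)
    (ex : ∀ i A, P A → P (Fm.ex i A)) (A : Fm) : P A := by
  induction A using Quotient.inductionOn with
  | h A =>
    induction A with
    | mem t u => exact mem t u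
    | eq t u => exact eq t u
    | disj A B ihA ihB => exact disj _ _ ihA ihB
    | neg A ih => exact neg _ ih
    | ex i A ih => exact ex i _ ih

/-- Replacement of equals in formulas. -/
theorem Hfthm.leibniz {extra : Fm} (A : Fm) : ∀ {t u : Tm} {σ τ : Name → Tm},
    (∀ i, σ i = τ i ∨ (σ i = t ∧ τ i = u)) →
    Hfthm extra ∅ (t EQ u IMP (A.subst σ IMP A.subst τ)) := by
  induction A using Fm.induction with
  | mem r s =>
    intro t u σ τ h
    refine of_val fun v hv => ?_
    rw [hv.imp, hv.imp]
    exact fun h1 h2 => hv.mem_cong (hv.tm_leibniz h1 h r) (hv.tm_leibniz h1 h s) h2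
  | eq r s =>
    intro t u σ τ h
    refine of_val fun v hv => ?_
    rw [hv.imp, hv.imp]
    exact fun h1 h2 => hv.eq_cong (hv.tm_leibniz h1 h r) (hv.tm_leibniz h1 h s) h2
  | disj A B ihA ihB =>
    intro t u σ τ h
    refine of_val fun v hv => ?_
    have h1 := hv.thm _ (ihA h)
    have h2 := hv.thm _ (ihB h)
    simp only [Fm.subst_disj, hv.imp, hv.disj] at h1 h2 ⊢
    tauto
  | neg A ih =>
    intro t u σ τ h
    refine of_val fun v hv => ?_
    -- Negation reverses the implication, so the induction hypothesis is used with both the terms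
    -- and the substitutions interchanged.
    have h1 := hv.thm _ (ih (t := u) (u := t) (σ := τ) (τ := σ)
      fun i => (h i).imp Eq.symm And.symm)
    simp only [Fm.subst_neg, hv.imp, hv.neg] at h1 ⊢
    intro h2
    have := h1 (hv.eq_symm h2)
    tauto
  | ex i A ih =>
    intro t u σ τ h
    have hk := freshName_notMem (t.fv ∪ u.fv ∪ A.fv.biUnion (fun v => (σ v).fv) ∪
      A.fv.biUnion fun v => (τ v).fv)
    set k := freshName (t.fv ∪ u.fv ∪ A.fv.biUnion (fun v => (σ v).fv) ∪
      A.fv.biUnion fun v => (τ v).fv)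
    simp only [Finset.mem_union, Finset.mem_biUnion, not_or, not_exists, not_and] at hk
    rw [Fm.subst_ex (k := k) fun v hv _ => hk.1.2 v hv,
      Fm.subst_ex (k := k) fun v hv _ => hk.2 v hv]
    have h1 := ih (t := t) (u := u) (σ := Function.update σ i (.var k))
      (τ := Function.update τ i (.var k)) (fun j => by
        by_cases hj : j = i
        · subst hj; simp
        · simpa [hj] using h j)
    have h2 := ex_intro (extra := extra) (A.subst (Function.update τ i (.var k))) k (.var k)
    rw [Fm.subst1_var_self] at h2
    -- The equation is moved into the conclusion so that the existential rule applies to A alone; k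
    -- was chosen fresh for t and u.
    have h3 : Hfthm extra ∅ (A.subst (Function.update σ i (.var k)) IMP
        (t EQ u IMP Fm.ex k (A.subst (Function.update τ i (.var k))))) := by
      refine of_val fun v hv => ?_
      have h1 := hv.thm _ h1
      have h2 := hv.thm _ h2
      simp only [hv.imp] at h1 h2 ⊢
      tauto
    have h4 := ex_elim (i := k) h3 (by
      simp [Fm.imp, Fm.disj_fv, Fm.neg_fv, Fm.ex_fv, Fm.eq_fv, hk.1.1.1, hk.1.1.2])
    refine of_val fun v hv => ?_
    have h4 := hv.thm _ h4
    simp only [hv.imp] at h4 ⊢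
    tauto

/-! ### Closed terms -/

namespace Tm

/-- The terms listed by a closed term. -/
def elts : Tm → List Tm
  | eats t u => u :: t.elts
  | _ => []

def size : Tm → ℕ
  | eats t u => t.size + u.size + 1
  | _ => 1

theorem closed_eats {t u : Tm} : (t.eats u).fv = ∅ ↔ t.fv = ∅ ∧ u.fv = ∅ := by
  simp [fv, Finset.union_eq_empty]

theorem closed_of_mem_elts {t a : Tm} (ht : t.fv = ∅) (ha : a ∈ t.elts) : a.fv = ∅ := by
  induction t with
  | eats t u iht _ =>
    rw [closed_eats] at ht
    rcases List.mem_cons.1 ha with rfl | ha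
    · exact ht.2
    · exact iht ht.1 ha
  | _ => simp [elts] at ha

theorem size_lt_of_mem_elts {t a : Tm} (ha : a ∈ t.elts) : a.size < t.size := by
  induction t with
  | eats t u iht _ =>
    simp only [size]
    rcases List.mem_cons.1 ha with rfl | ha
    · omega
    · have := iht ha; omega
  | _ => simp [elts] at ha

theorem mem_eval_iff {t : Tm} (ht : t.fv = ∅) (e : Name → HFSet) (x : HFSet) :
    HFSet.Mem x (t.eval e) ↔ ∃ a ∈ t.elts, x = a.eval e := by
  induction t with
  | zero => simp [eval, elts, HFSet.mem_empty]
  | var i => simp [fv] at ht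
  | eats t u iht _ =>
    rw [closed_eats] at ht
    simp [eval, elts, HFSet.mem_eats, iht ht.1, or_comm]

theorem subst_of_closed {t : Tm} (ht : t.fv = ∅) (σ : Name → Tm) : t.subst σ = t := by
  conv_rhs => rw [← t.subst_var]
  exact subst_congr fun v hv => by simp [ht] at hv

/-- Every hereditarily finite set has a closed name, so a true existential statement has a witness
expressible in the calculus. -/
theorem exists_closed_eval_eq (x : HFSet) : ∃ t : Tm, t.fv = ∅ ∧ ∀ e, t.eval e = x := by
  induction x using HFSet.eats_induction with
  | h0 => exact ⟨zero, rfl, fun _ => rfl⟩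
  | h1 x y ihx ihy =>
    obtain ⟨t, ht, hx⟩ := ihx
    obtain ⟨u, hu, hy⟩ := ihy
    exact ⟨eats t u, closed_eats.2 ⟨ht, hu⟩, fun e => by rw [eval, hx, hy]⟩

end Tm

/-- Provably, membership in a closed term is a finite disjunction of equations. The term a need not
be closed, so a may be the variable of a bounded quantifier. -/
theorem IsVal.mem_closed {extra : Fm} {v : Fm → Prop} (hv : IsVal extra v) {t : Tm}
    (ht : t.fv = ∅) (a : Tm) : v (a IN t) ↔ ∃ b ∈ t.elts, v (a EQ b) := by
  induction t with
  | zero => simp [Tm.elts, hv.notMem_zero]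
  | var i => simp [Tm.fv] at ht
  | eats t u iht _ =>
    rw [Tm.closed_eats] at ht
    simp [Tm.elts, hv.mem_eats, iht ht.1, or_comm]

/-- Extensionality for closed terms. -/
theorem Hfthm.eq_eats_of_closed {extra : Fm} {s t u : Tm} (hs : s.fv = ∅) (ht : t.fv = ∅)
    (hu : u.fv = ∅)
    (h : Hfthm extra ∅ (Tm.var 3 IN s IFF (Tm.var 3 IN t OR Tm.var 3 EQ u))) :
    Hfthm extra ∅ (s EQ t.eats u) := by
  have h1 := Hfthm.subst (extra := extra) (.hf .hf2) (assign s t u (.var 3) .zero)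
  have h2 := all_intro 3 h
  refine of_val fun v hv => ?_
  have h1 := hv.thm _ h1
  have h2 := hv.thm _ h2
  rw [hf2, Fm.subst_iff, hv.iff] at h1
  refine h1.2 ?_
  rw [Fm.all] at h2
  -- The inserted terms are closed, so the bound variable 3 can be kept without capture.
  rw [Fm.all, Fm.subst_neg, Fm.subst_ex (k := 3), Fm.subst_neg]
  · exact h2
  · intro w hw hw3
    have : w = 0 ∨ w = 1 ∨ w = 2 := by
      simp [Fm.neg_fv, Fm.iff, Fm.conj, Fm.imp, Fm.disj_fv, Fm.mem_fv, Fm.eq_fv, Tm.fv] at hw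
      tauto
    rcases this with rfl | rfl | rfl <;> simp [assign, hs, ht, hu]

/-- One induction on the total size of the two terms handles all four cases. Equality reduces by
extensionality to membership of listed elements, and membership reduces to equality with a listed
element; each reduction shrinks one term. -/
theorem closed_atoms_decided (extra : Fm) (e : Name → HFSet) : ∀ n (t u : Tm),
    t.size + u.size ≤ n → t.fv = ∅ → u.fv = ∅ →
    (t.eval e = u.eval e → Hfthm extra ∅ (t EQ u)) ∧
    (t.eval e ≠ u.eval e → Hfthm extra ∅ (t NEQ u)) ∧
    (HFSet.Mem (t.eval e) (u.eval e) → Hfthm extra ∅ (t IN u)) ∧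
    (¬ HFSet.Mem (t.eval e) (u.eval e) → Hfthm extra ∅ (t IN u).neg) := by
  intro n
  induction n with
  | zero => intro t u h; cases t <;> simp [Tm.size] at h
  | succ n ih =>
    intro t u hn ht hu
    have hmem : ∀ {a s r : Tm}, a ∈ s.elts → s.fv = ∅ → r.fv = ∅ → s.size + r.size ≤ n + 1 →
        HFSet.Mem (a.eval e) (r.eval e) → Hfthm extra ∅ (a IN r) := fun ha hs hr h1 h2 =>
      (ih _ _ (by have := Tm.size_lt_of_mem_elts ha; omega)
        (Tm.closed_of_mem_elts hs ha) hr).2.2.1 h2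
    have hne : ∀ {s r : Tm}, s.fv = ∅ → r.fv = ∅ → s.size + r.size ≤ n + 1 →
        (∃ x, HFSet.Mem x (s.eval e) ∧ ¬ HFSet.Mem x (r.eval e)) →
        Hfthm extra ∅ (s NEQ r) := by
      rintro s r hs hr h1 ⟨x, hxs, hxr⟩
      obtain ⟨a, ha, rfl⟩ := (Tm.mem_eval_iff hs e x).1 hxs
      have h2 := (ih a r (by have := Tm.size_lt_of_mem_elts ha; omega)
        (Tm.closed_of_mem_elts hs ha) hr).2.2.2 hxr
      refine .of_val fun v hv => ?_
      have h2 := hv.thm _ h2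
      rw [Fm.neq, hv.neg]
      rw [hv.neg] at h2
      exact fun h3 => h2 (hv.mem_cong (hv.eq_refl a) h3
        ((hv.mem_closed hs a).2 ⟨a, ha, hv.eq_refl a⟩))
    refine ⟨fun h => ?_, fun h => ?_, fun h => ?_, fun h => ?_⟩
    · have key : ∀ v, IsVal extra v → (v (Tm.var 3 IN t) ↔ v (Tm.var 3 IN u)) := by
        intro v hv
        constructor
        · intro h1
          obtain ⟨a, ha, h1⟩ := (hv.mem_closed ht _).1 h1
          exact hv.mem_cong (hv.eq_symm h1) (hv.eq_refl u) (hv.thm _ (hmem ha ht hu hn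
            (h ▸ (Tm.mem_eval_iff ht e _).2 ⟨a, ha, rfl⟩)))
        · intro h1
          obtain ⟨a, ha, h1⟩ := (hv.mem_closed hu _).1 h1
          exact hv.mem_cong (hv.eq_symm h1) (hv.eq_refl t) (hv.thm _ (hmem ha hu ht
            (by omega) (h ▸ (Tm.mem_eval_iff hu e _).2 ⟨a, ha, rfl⟩)))
      cases u with
      | zero =>
        cases t with
        | zero => exact .of_val fun v hv => hv.eq_refl _
        | var i => simp [Tm.fv] at ht
        | eats t1 t2 =>
          have h1 : HFSet.Mem (t2.eval e) ((Tm.eats t1 t2).eval e) := HFSet.mem_eats.2 (.inr rfl)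
          rw [h] at h1
          exact absurd h1 (HFSet.mem_empty _)
      | var i => simp [Tm.fv] at hu
      | eats u1 u2 =>
        have hu' := Tm.closed_eats.1 hu
        refine .eq_eats_of_closed ht hu'.1 hu'.2 (.of_val fun v hv => ?_)
        rw [hv.iff, hv.disj, key v hv, hv.mem_eats]
    -- Distinct sets differ in some element of one of them. That element is named in the closed
    -- term, and provably not a member of the other.
    · by_cases h1 : ∃ x, HFSet.Mem x (t.eval e) ∧ ¬ HFSet.Mem x (u.eval e)
      · exact hne ht hu hn h1
      · by_cases h2 : ∃ x, HFSet.Mem x (u.eval e) ∧ ¬ HFSet.Mem x (t.eval e)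
        · have h3 := hne hu ht (by omega) h2
          refine .of_val fun v hv => ?_
          have h3 := hv.thm _ h3
          rw [Fm.neq, hv.neg] at h3 ⊢
          exact fun h4 => h3 (hv.eq_symm h4)
        · push Not at h1 h2
          exact absurd (HFSet.ext fun z => ⟨h1 z, h2 z⟩) h
    · obtain ⟨a, ha, h1⟩ := (Tm.mem_eval_iff hu e _).1 h
      have h2 := (ih t a (by have := Tm.size_lt_of_mem_elts ha; omega) ht
        (Tm.closed_of_mem_elts hu ha)).1 h1
      exact .of_val fun v hv => (hv.mem_closed hu t).2 ⟨a, ha, hv.thm _ h2⟩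
    · refine .of_val fun v hv => ?_
      rw [hv.neg, hv.mem_closed hu]
      rintro ⟨a, ha, h1⟩
      have h2 := (ih t a (by have := Tm.size_lt_of_mem_elts ha; omega) ht
        (Tm.closed_of_mem_elts hu ha)).2.1
        fun h3 => h ((Tm.mem_eval_iff hu e _).2 ⟨a, ha, h3⟩)
      have h2 := hv.thm _ h2
      rw [Fm.neq, hv.neg] at h2
      exact h2 h1

/-! ### Completeness for Sigma formulas -/

/-- Every true closed instance of `A` is provable. -/
def SigmaComplete (extra A : Fm) : Prop :=
  ∀ (σ : Name → Tm) (e : Name → HFSet), (∀ v, (σ v).fv = ∅) →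
    (A.subst σ).Eval e → Hfthm extra ∅ (A.subst σ)

namespace SigmaComplete

variable {extra : Fm}

theorem mem (t u : Tm) : SigmaComplete extra (t IN u) := by
  intro σ e hσ h
  refine (closed_atoms_decided extra e _ _ _ le_rfl ?_ ?_).2.2.1 h <;>
  · refine Finset.eq_empty_of_forall_notMem fun v hv => ?_
    obtain ⟨w, -, hw⟩ := Tm.fv_subst hv
    simp [hσ] at hw

theorem eq (t u : Tm) : SigmaComplete extra (t EQ u) := by
  intro σ e hσ h
  refine (closed_atoms_decided extra e _ _ _ le_rfl ?_ ?_).1 h <;>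
  · refine Finset.eq_empty_of_forall_notMem fun v hv => ?_
    obtain ⟨w, -, hw⟩ := Tm.fv_subst hv
    simp [hσ] at hw

theorem neq (t u : Tm) : SigmaComplete extra (t NEQ u) := by
  intro σ e hσ h
  refine (closed_atoms_decided extra e _ _ _ le_rfl ?_ ?_).2.1 h <;>
  · refine Finset.eq_empty_of_forall_notMem fun v hv => ?_
    obtain ⟨w, -, hw⟩ := Tm.fv_subst hv
    simp [hσ] at hw

theorem disj {A B : Fm} (hA : SigmaComplete extra A) (hB : SigmaComplete extra B) :
    SigmaComplete extra (A OR B) := by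
  intro σ e hσ h
  rw [Fm.subst_disj] at h ⊢
  refine .of_val fun v hv => (hv.disj _ _).2 ?_
  exact ((Fm.eval_disj ..).1 h).imp (fun h => hv.thm _ (hA σ e hσ h))
    fun h => hv.thm _ (hB σ e hσ h)

theorem conj {A B : Fm} (hA : SigmaComplete extra A) (hB : SigmaComplete extra B) :
    SigmaComplete extra (A AND B) := by
  intro σ e hσ h
  rw [Fm.subst_conj] at h ⊢
  refine .of_val fun v hv => (hv.conj _ _).2 ?_
  exact ((Fm.eval_conj ..).1 h).imp (fun h => hv.thm _ (hA σ e hσ h))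
    fun h => hv.thm _ (hB σ e hσ h)

/-- Leaving i free and filling it in later equals substituting at once, because the other inserted
terms are closed. -/
theorem subst1_update_var {σ : Name → Tm} (hσ : ∀ v, (σ v).fv = ∅) (A : Fm) (i : Name) (t : Tm) :
    (A.subst (Function.update σ i (.var i))).subst1 i t = A.subst (Function.update σ i t) := by
  rw [Fm.subst1, Fm.subst_subst]
  congr 1
  funext v
  by_cases h : v = i
  · subst h; simp [Tm.subst]
  · simp [h, Tm.subst_of_closed (hσ v)]

theorem closed_update {σ : Name → Tm} (hσ : ∀ v, (σ v).fv = ∅) (i : Name) {t : Tm}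
    (ht : t.fv = ∅) (v : Name) : (Function.update σ i t v).fv = ∅ := by
  by_cases h : v = i
  · subst h; simpa
  · simpa [h] using hσ v

theorem ex {A : Fm} (i : Name) (hA : SigmaComplete extra A) :
    SigmaComplete extra (Fm.ex i A) := by
  intro σ e hσ h
  rw [Fm.subst_ex (k := i) fun v _ _ => by simp [hσ]] at h ⊢
  obtain ⟨x, hx⟩ := (Fm.eval_ex ..).1 h
  obtain ⟨t, ht, hte⟩ := Tm.exists_closed_eval_eq x
  rw [← hte e, ← Fm.eval_subst1, subst1_update_var hσ] at hx
  have h1 := hA _ e (closed_update hσ i ht) hx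
  rw [← subst1_update_var hσ] at h1
  exact (Hfthm.ex_intro _ _ _).mp' h1

/-- After a closed substitution the bound is a closed term. Each listed element gives a true, hence
provable, instance of A. Replacement of equals carries this instance to the bound variable, and
generalisation finishes the proof. -/
theorem all_mem {A : Fm} {i : Name} {t : Tm} (hi : i ∉ t.fv) (hA : SigmaComplete extra A) :
    SigmaComplete extra (Fm.all i (Tm.var i IN t IMP A)) := by
  intro σ e hσ h
  have hall : (Fm.all i (Tm.var i IN t IMP A)).subst σ =
      Fm.all i (Tm.var i IN t.subst σ IMP A.subst (Function.update σ i (.var i))) := by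
    rw [Fm.all, Fm.subst_neg, Fm.subst_ex (k := i) fun v _ _ => by simp [hσ], Fm.subst_neg,
      Fm.subst_imp, Fm.subst_mem, Fm.all]
    have h1 : t.subst (Function.update σ i (.var i)) = t.subst σ :=
      Tm.subst_congr fun v hv => Function.update_of_ne (by rintro rfl; exact hi hv) _ _
    rw [h1]
    simp [Tm.subst]
  have ht : (t.subst σ).fv = ∅ := by
    refine Finset.eq_empty_of_forall_notMem fun v hv => ?_
    obtain ⟨w, -, hw⟩ := Tm.fv_subst hv
    simp [hσ] at hw
  rw [hall] at h ⊢
  refine .all_intro i (.of_val fun v hv => ?_)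
  rw [hv.imp, hv.mem_closed ht]
  rintro ⟨a, ha, h1⟩
  have hac := Tm.closed_of_mem_elts ht ha
  have h2 := (Fm.eval_imp ..).1 ((Fm.eval_all ..).1 h (a.eval e))
  rw [← Fm.eval_subst1, ← Fm.eval_subst1, subst1_update_var hσ] at h2
  have h3 := hA _ e (closed_update hσ i hac) (h2 (by
    rw [Fm.eval_subst1, Fm.eval_mem, Tm.mem_eval_iff ht]
    refine ⟨a, ha, ?_⟩
    simp only [Tm.eval, Function.update_self]
    exact Tm.eval_congr _ fun v hv => by simp [hac] at hv))
  -- The instance at the closed element a is transported to the free variable i, which is known to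
  -- equal a.
  have h4 := hv.thm _ (Hfthm.leibniz (extra := extra) A (t := a) (u := .var i)
    (σ := Function.update σ i a) (τ := Function.update σ i (.var i)) fun j => by
      by_cases hj : j = i
      · subst hj; simp
      · simp [hj])
  rw [hv.imp, hv.imp] at h4
  exact h4 (hv.eq_symm h1) (hv.thm _ h3)

end SigmaComplete


/-! ### Truth values of the coding terms -/

namespace HFSet

def cEats (x y : HFSet) : HFSet := pair (tag 1) (pair x y)
def cInd (x : HFSet) : HFSet := pair (tag 6) x
def cMem (x y : HFSet) : HFSet := pair (tag 0) (pair x y)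
def cEq (x y : HFSet) : HFSet := pair (tag 2) (pair x y)
def cDisj (x y : HFSet) : HFSet := pair (tag 3) (pair x y)
def cNeg (x : HFSet) : HFSet := pair (tag 4) x
def cEx (x : HFSet) : HFSet := pair (tag 5) x
def cImp (x y : HFSet) : HFSet := cDisj (cNeg x) y
def cAll (x : HFSet) : HFSet := cNeg (cEx (cNeg x))

end HFSet

open HFSet (Constr LstSeq Gen cEats cInd cMem cEq cDisj cNeg cEx cImp cAll)

section Eval

variable (e : Name → HFSet)

theorem eval_zero : Tm.zero.eval e = HFSet.empty := rfl

theorem eval_succT (t : Tm) : (succT t).eval e = HFSet.eats (t.eval e) (t.eval e) := rfl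

theorem eval_pair (t u : Tm) : (pair t u).eval e = HFSet.pair (t.eval e) (u.eval e) := by
  unfold HFSet.pair HFSet.upair HFSet.sing
  rfl

theorem eval_ordOf (n : ℕ) : (ordOf n).eval e = HFSet.ord n := by
  induction n with
  | zero => rw [HFSet.ord_zero]; rfl
  | succ n ih => rw [HFSet.ord_succ, ordOf, eval_succT, ih]

theorem eval_tag (n : ℕ) : (tag n).eval e = HFSet.tag n := by
  induction n with
  | zero => exact eval_pair ..
  | succ n ih => rw [tag, eval_pair, ih]; rfl

theorem eval_qEats (t u : Tm) : (qEats t u).eval e = cEats (t.eval e) (u.eval e) := by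
  simp only [qEats, cEats, eval_pair, eval_tag]
theorem eval_qInd (t : Tm) : (qInd t).eval e = cInd (t.eval e) := by
  simp only [qInd, cInd, eval_pair, eval_tag]
theorem eval_qMem (t u : Tm) : (qMem t u).eval e = cMem (t.eval e) (u.eval e) := by
  simp only [qMem, cMem, eval_pair, eval_tag]
theorem eval_qEq (t u : Tm) : (qEq t u).eval e = cEq (t.eval e) (u.eval e) := by
  simp only [qEq, cEq, eval_pair, eval_tag]
theorem eval_qDisj (t u : Tm) : (qDisj t u).eval e = cDisj (t.eval e) (u.eval e) := by
  simp only [qDisj, cDisj, eval_pair, eval_tag]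
theorem eval_qNeg (t : Tm) : (qNeg t).eval e = cNeg (t.eval e) := by
  simp only [qNeg, cNeg, eval_pair, eval_tag]
theorem eval_qEx (t : Tm) : (qEx t).eval e = cEx (t.eval e) := by
  simp only [qEx, cEx, eval_pair, eval_tag]
theorem eval_qImp (t u : Tm) : (qImp t u).eval e = cImp (t.eval e) (u.eval e) := by
  simp only [qImp, cImp, eval_qDisj, eval_qNeg]
theorem eval_qAll (t : Tm) : (qAll t).eval e = cAll (t.eval e) := by
  simp only [qAll, cAll, eval_qEx, eval_qNeg]

end Eval

/-! ### Truth values of quantification over fresh variables -/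

theorem freshFor_notMem {ts : List Tm} {t : Tm} (ht : t ∈ ts) : freshFor ts ∉ t.fv := by
  intro h
  refine freshName_notMem (ts.foldr (fun t S => t.fv ∪ S) ∅) ?_
  change freshFor ts ∈ _
  generalize freshFor ts = k at h
  induction ts with
  | nil => simp at ht
  | cons u ts ih =>
    rcases List.mem_cons.1 ht with rfl | ht
    · exact Finset.mem_union_left _ h
    · exact Finset.mem_union_right _ (ih ht)

theorem eval_update_freshFor {ts : List Tm} {t : Tm} (ht : t ∈ ts) (e : Name → HFSet) (x : HFSet) :
    t.eval (Function.update e (freshFor ts) x) = t.eval e :=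
  Tm.eval_congr _ fun _ hv =>
    Function.update_of_ne (fun h => freshFor_notMem ht (by rwa [← h])) _ _

/-- The environments `e` and `e'` agree on the terms `ts`. -/
def Agree (ts : List Tm) (e' e : Name → HFSet) : Prop := ∀ t ∈ ts, t.eval e' = t.eval e

theorem agree_cons {t : Tm} {ts : List Tm} {e' e : Name → HFSet} :
    Agree (t :: ts) e' e ↔ t.eval e' = t.eval e ∧ Agree ts e' e := by simp [Agree]

theorem Agree.trans {ts : List Tm} {e e' e'' : Name → HFSet} (h1 : Agree ts e'' e')
    (h2 : Agree ts e' e) : Agree ts e'' e := fun t ht => (h1 t ht).trans (h2 t ht)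

/-- The hypothesis ranges over every term and every environment that agrees on the listed terms, so
the particular fresh name drops out and evaluations of nested quantifiers can be composed. -/
theorem exF_iff {ts : List Tm} {P : Tm → Fm} {Q : HFSet → Prop} {e : Name → HFSet}
    (h : ∀ e' a, Agree ts e' e → ((P a).Eval e' ↔ Q (a.eval e'))) :
    (exF ts P).Eval e ↔ ∃ x, Q x := by
  rw [exF, Fm.eval_ex]
  refine exists_congr fun x => ?_
  rw [h _ _ fun t ht => eval_update_freshFor ht e x]
  simp [Tm.eval]

theorem exF₂_iff {ts : List Tm} {P : Tm → Tm → Fm} {Q : HFSet → HFSet → Prop} {e : Name → HFSet}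
    (h : ∀ e' a b, Agree ts e' e → ((P a b).Eval e' ↔ Q (a.eval e') (b.eval e'))) :
    (exF₂ ts P).Eval e ↔ ∃ x y, Q x y :=
  exF_iff (Q := fun x => ∃ y, Q x y) fun e1 a h1 => exF_iff fun e2 b h2 => by
    have h3 := agree_cons.1 h2
    rw [h e2 a b (h3.2.trans h1), h3.1]

theorem exF₃_iff {ts : List Tm} {P : Tm → Tm → Tm → Fm} {Q : HFSet → HFSet → HFSet → Prop}
    {e : Name → HFSet}
    (h : ∀ e' a b c, Agree ts e' e → ((P a b c).Eval e' ↔ Q (a.eval e') (b.eval e') (c.eval e'))) :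
    (exF₃ ts P).Eval e ↔ ∃ x y z, Q x y z :=
  exF_iff (Q := fun x => ∃ y z, Q x y z) fun e1 a h1 => exF₂_iff fun e2 b c h2 => by
    have h3 := agree_cons.1 h2
    rw [h e2 a b c (h3.2.trans h1), h3.1]

theorem exF₄_iff {ts : List Tm} {P : Tm → Tm → Tm → Tm → Fm}
    {Q : HFSet → HFSet → HFSet → HFSet → Prop} {e : Name → HFSet}
    (h : ∀ e' a b c d, Agree ts e' e →
      ((P a b c d).Eval e' ↔ Q (a.eval e') (b.eval e') (c.eval e') (d.eval e'))) :
    (exF₄ ts P).Eval e ↔ ∃ x y z w, Q x y z w :=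
  exF_iff (Q := fun x => ∃ y z w, Q x y z w) fun e1 a h1 => exF₃_iff fun e2 b c d h2 => by
    have h3 := agree_cons.1 h2
    rw [h e2 a b c d (h3.2.trans h1), h3.1]

theorem allIn_iff {ts : List Tm} {t : Tm} {P : Tm → Fm} {Q : HFSet → Prop} {e : Name → HFSet}
    (h : ∀ e' a, Agree (t :: ts) e' e → ((P a).Eval e' ↔ Q (a.eval e'))) :
    (allIn ts t P).Eval e ↔ ∀ x, HFSet.Mem x (t.eval e) → Q x := by
  rw [allIn, Fm.eval_all]
  refine forall_congr' fun x => ?_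
  have h1 : Agree (t :: ts) (Function.update e (freshFor (t :: ts)) x) e :=
    fun t' ht => eval_update_freshFor ht e x
  rw [Fm.eval_imp, h _ _ h1, Fm.eval_mem, h1 t (by simp)]
  simp [Tm.eval]

/-! ### Truth values of the predicates about sequences -/

theorem eval_subsetP (e : Name → HFSet) (t u : Tm) :
    (subsetP t u).Eval e ↔ ∀ x, HFSet.Mem x (t.eval e) → HFSet.Mem x (u.eval e) := by
  refine allIn_iff fun e1 a h1 => ?_
  simp only [agree_cons] at h1
  simp only [Fm.eval_mem, h1]

theorem eval_ordP (e : Name → HFSet) (t : Tm) :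
    (ordP t).Eval e ↔ ∃ n, t.eval e = HFSet.ord n := by
  rw [← HFSet.isOrd_iff]
  refine allIn_iff fun e1 a h1 => ?_
  simp only [agree_cons] at h1
  rw [Fm.eval_conj, eval_subsetP, h1.1]
  refine and_congr Iff.rfl (allIn_iff fun e2 b h2 => ?_)
  simp only [agree_cons] at h2
  rw [eval_subsetP, h2.1]

theorem eval_funP (e : Name → HFSet) (r : Tm) :
    (funP r).Eval e ↔ ∀ z, HFSet.Mem z (r.eval e) → ∀ z', HFSet.Mem z' (r.eval e) →
      ∃ n y m y', z = HFSet.pair (HFSet.ord n) y ∧ z' = HFSet.pair (HFSet.ord m) y' ∧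
        (n ≠ m ∨ y = y') := by
  -- The formula quantifies over sets and then requires them to be ordinals; the semantic statement
  -- quantifies over numbers directly.
  have h0 : ∀ z z' : HFSet, (∃ n y m y', z = HFSet.pair (HFSet.ord n) y ∧
      z' = HFSet.pair (HFSet.ord m) y' ∧ (n ≠ m ∨ y = y')) ↔
      ∃ x y x' y', z = HFSet.pair x y ∧ z' = HFSet.pair x' y' ∧ (∃ n, x = HFSet.ord n) ∧
        (∃ n, x' = HFSet.ord n) ∧ (x ≠ x' ∨ y = y') := by
    intro z z'
    constructor
    · rintro ⟨n, y, m, y', h1, h2, h3⟩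
      exact ⟨_, y, _, y', h1, h2, ⟨n, rfl⟩, ⟨m, rfl⟩, h3.imp_left (mt HFSet.ord_inj.1)⟩
    · rintro ⟨x, y, x', y', h1, h2, ⟨n, rfl⟩, ⟨m, rfl⟩, h3⟩
      exact ⟨n, y, m, y', h1, h2, h3.imp_left (mt HFSet.ord_inj.2)⟩
  simp only [h0]
  refine allIn_iff fun e1 a h1 => ?_
  simp only [agree_cons] at h1
  rw [← h1.1]
  refine allIn_iff fun e2 b h2 => ?_
  simp only [agree_cons] at h2
  rw [← h2.2.2.1]
  refine exF₄_iff fun e3 x y x' y' h3 => ?_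
  simp only [agree_cons] at h3
  simp only [Fm.eval_conj, Fm.eval_disj, Fm.eval_eq, Fm.eval_neq, eval_ordP, eval_pair, h3]

theorem eval_domInclP (e : Name → HFSet) (r d : Tm) :
    (domInclP r d).Eval e ↔
      ∀ x, HFSet.Mem x (d.eval e) → ∃ y, HFSet.Mem (HFSet.pair x y) (r.eval e) := by
  refine allIn_iff fun e1 a h1 => ?_
  simp only [agree_cons] at h1
  refine exF_iff fun e2 b h2 => ?_
  simp only [agree_cons] at h2
  simp only [Fm.eval_mem, eval_pair, h2, h1]

/-- The formula requires the successor of k to be an ordinal, whereas `LstSeq` requires this of k.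
-/
theorem eats_self_eq_ord {k : HFSet} :
    (∃ n, HFSet.eats k k = HFSet.ord n) ↔ ∃ n, k = HFSet.ord n := by
  constructor
  · rintro ⟨n, h⟩
    have h1 : HFSet.Mem k (HFSet.ord n) := h ▸ HFSet.mem_eats.2 (.inr rfl)
    obtain ⟨m, -, h2⟩ := HFSet.mem_ord.1 h1
    exact ⟨m, h2⟩
  · rintro ⟨n, rfl⟩
    exact ⟨n + 1, (HFSet.ord_succ n).symm⟩

theorem eval_lstSeqP (e : Name → HFSet) (s k y : Tm) :
    (lstSeqP s k y).Eval e ↔ LstSeq (s.eval e) (k.eval e) (y.eval e) := by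
  simp only [lstSeqP, seqP, LstSeq, Fm.eval_conj, Fm.eval_mem, eval_ordP, eval_domInclP, eval_funP,
    eval_pair, eval_succT, eats_self_eq_ord, and_assoc]

/-! ### Truth values of the predicates about syntax -/

theorem eval_varP (e : Name → HFSet) (t : Tm) :
    (varP t).Eval e ↔ ∃ i : Name, t.eval e = HFSet.ord (i + 1) := by
  simp only [varP, Fm.eval_conj, Fm.eval_mem, eval_ordP, eval_zero]
  constructor
  · rintro ⟨⟨n, hn⟩, h⟩
    rw [hn] at h ⊢
    cases n with
    | zero => rw [HFSet.ord_zero] at h; exact absurd h (HFSet.mem_empty _)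
    | succ n => exact ⟨n, rfl⟩
  · rintro ⟨i, hi⟩
    exact ⟨⟨_, hi⟩, by rw [hi, ← HFSet.ord_zero]; exact HFSet.ord_mem_ord_of_lt i.succ_pos⟩

theorem eval_indP (e : Name → HFSet) (t : Tm) :
    (indP t).Eval e ↔ ∃ n, t.eval e = cInd (HFSet.ord n) := by
  have : (∃ n, t.eval e = cInd (HFSet.ord n)) ↔
      ∃ x, (∃ n, x = HFSet.ord n) ∧ t.eval e = cInd x :=
    ⟨fun ⟨n, h⟩ => ⟨_, ⟨n, rfl⟩, h⟩, fun ⟨_, ⟨n, h⟩, h'⟩ => ⟨n, h ▸ h'⟩⟩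
  rw [this]
  refine exF_iff fun e1 a h1 => ?_
  simp only [agree_cons] at h1
  simp only [Fm.eval_conj, Fm.eval_eq, eval_ordP, eval_qInd, h1]

def TermBase (x : HFSet) : Prop := x = HFSet.empty ∨ ∃ i : Name, x = HFSet.ord (i + 1)

def TermStep (a b x : HFSet) : Prop := x = cEats a b

theorem eval_termP (e : Name → HFSet) (t : Tm) :
    (termP t).Eval e ↔ Gen TermBase TermStep (t.eval e) := by
  rw [← HFSet.exists_constr_iff_gen Function.injective_id]
  refine exF₂_iff fun e1 s k h1 => ?_
  simp only [agree_cons] at h1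
  rw [seqTermP, Fm.eval_conj, eval_lstSeqP, h1.1]
  refine and_congr Iff.rfl (allIn_iff fun e2 l h2 => ?_)
  simp only [agree_cons] at h2
  refine exF_iff fun e3 sl h3 => ?_
  simp only [agree_cons] at h3
  simp only [Fm.eval_conj, Fm.eval_disj, Fm.eval_mem, Fm.eval_eq, eval_varP, eval_pair, eval_zero,
    h3, h2, TermBase, or_assoc, id]
  refine and_congr Iff.rfl (or_congr Iff.rfl (or_congr Iff.rfl (exF₄_iff
    fun e4 m n sm sn h4 => ?_)))
  simp only [agree_cons] at h4
  simp only [Fm.eval_conj, Fm.eval_mem, Fm.eval_eq, eval_pair, eval_qEats, TermStep, h4, h3, h2]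

def StTermBase (v u : HFSet) (p : HFSet × HFSet) : Prop :=
  (p.1 = v ∧ p.2 = u) ∨
    (((∃ n, p.1 = cInd (HFSet.ord n)) ∨ ((∃ n, p.1 = HFSet.ord n) ∧ p.1 ≠ v)) ∧ p.2 = p.1)

def StTermStep (a b p : HFSet × HFSet) : Prop := p.1 = cEats a.1 b.1 ∧ p.2 = cEats a.2 b.2

def pairCode (p : HFSet × HFSet) : HFSet := HFSet.pair p.1 p.2

theorem pairCode_injective : Function.Injective pairCode := fun _ _ h =>
  Prod.ext (HFSet.pair_inj.1 h).1 (HFSet.pair_inj.1 h).2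

theorem eval_seqStTermP (e : Name → HFSet) (v u x x' s k : Tm) :
    (seqStTermP v u x x' s k).Eval e ↔ (∃ i : Name, v.eval e = HFSet.ord (i + 1)) ∧
      Constr pairCode (StTermBase (v.eval e) (u.eval e)) StTermStep (s.eval e) (k.eval e)
        (x.eval e, x'.eval e) := by
  rw [seqStTermP, Fm.eval_conj, Fm.eval_conj, eval_varP, eval_lstSeqP, eval_pair]
  refine and_congr Iff.rfl (and_congr Iff.rfl (allIn_iff fun e2 l h2 => ?_))
  simp only [agree_cons] at h2
  simp only [Prod.exists]
  refine exF₂_iff fun e3 sl sl' h3 => ?_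
  simp only [agree_cons] at h3
  simp only [Fm.eval_conj, Fm.eval_disj, Fm.eval_mem, Fm.eval_eq, Fm.eval_neq, eval_ordP, eval_indP,
    eval_pair, h3, h2, StTermBase, or_assoc, pairCode]
  refine and_congr Iff.rfl (or_congr Iff.rfl (or_congr Iff.rfl (exF₂_iff fun e4 m n h4 =>
    exF₂_iff fun e5 sm sm' h5 => ?_)))
  simp only [agree_cons] at h4 h5
  -- The values of m and n, fixed in `e4`, are now read in `e5`, where the further entries are bound
  -- too.
  rw [← h5.2.2.2.2.2.2.2.2.2.1, ← h5.2.2.2.2.2.2.2.2.2.2.1]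
  refine exF₂_iff fun e6 sn sn' h6 => ?_
  simp only [agree_cons] at h6
  simp only [Fm.eval_conj, Fm.eval_mem, Fm.eval_eq, eval_pair, eval_qEats, StTermStep,
    h6, h5, h4, h3, h2]


/-! ### Codes as hereditarily finite sets -/

def DBTm.code : DBTm → HFSet
  | zero => HFSet.empty
  | var i => HFSet.ord (i + 1)
  | ind k => cInd (HFSet.ord k)
  | eats t u => cEats t.code u.code

def DBFm.code : DBFm → HFSet
  | mem t u => cMem t.code u.code
  | eq t u => cEq t.code u.code
  | disj A B => cDisj A.code B.code
  | neg A => cNeg A.code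
  | ex A => cEx A.code

def Tm.code (t : Tm) : HFSet := (t.trans []).code

def Fm.code (A : Fm) : HFSet := A.trans.code

theorem DBTm.eval_quot (e : Name → HFSet) (t : DBTm) : t.quot.eval e = t.code := by
  induction t with
  | zero => rfl
  | var i => exact eval_ordOf e (i + 1)
  | ind k => rw [quot, eval_qInd, eval_ordOf, code]
  | eats t u iht ihu => rw [quot, eval_qEats, iht, ihu, code]

theorem DBFm.eval_quot (e : Name → HFSet) (A : DBFm) : A.quot.eval e = A.code := by
  induction A with
  | mem t u => rw [quot, eval_qMem, t.eval_quot, u.eval_quot, code]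
  | eq t u => rw [quot, eval_qEq, t.eval_quot, u.eval_quot, code]
  | disj A B ihA ihB => rw [quot, eval_qDisj, ihA, ihB, code]
  | neg A ih => rw [quot, eval_qNeg, ih, code]
  | ex A ih => rw [quot, eval_qEx, ih, code]

theorem Fm.eval_quot (e : Name → HFSet) (A : Fm) : A.quot.eval e = A.code :=
  A.trans.eval_quot e

/-- The constructors have disjoint ranges: the empty set, non-zero ordinals, and pairs with distinct
tags. This is why variable codes start at 1. -/
theorem DBTm.code_injective : Function.Injective DBTm.code := by
  intro t
  induction t with
  | zero =>
    intro u h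
    cases u with
    | zero => rfl
    | var i =>
      simp only [code, ← HFSet.ord_zero, HFSet.ord_inj] at h
      exact absurd h.symm (Nat.succ_ne_zero i)
    | ind k => exact absurd h.symm (HFSet.pair_ne_empty _ _)
    | eats t u => exact absurd h.symm (HFSet.pair_ne_empty _ _)
  | var i =>
    intro u h
    cases u with
    | zero =>
      simp only [code, ← HFSet.ord_zero, HFSet.ord_inj] at h
      exact absurd h (Nat.succ_ne_zero i)
    | var j => rw [Nat.succ_injective (HFSet.ord_inj.1 h)]
    | ind k => exact absurd h HFSet.ord_ne_pair
    | eats t u => exact absurd h HFSet.ord_ne_pair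
  | ind k =>
    intro u h
    cases u with
    | zero => exact absurd h (HFSet.pair_ne_empty _ _)
    | var j => exact absurd h.symm HFSet.ord_ne_pair
    | ind l => rw [HFSet.ord_inj.1 (HFSet.pair_inj.1 h).2]
    | eats t u => simp [code, cInd, cEats, HFSet.pair_inj, HFSet.tag_inj] at h
  | eats t1 t2 ih1 ih2 =>
    intro u h
    cases u with
    | zero => exact absurd h (HFSet.pair_ne_empty _ _)
    | var j => exact absurd h.symm HFSet.ord_ne_pair
    | ind l => simp [code, cInd, cEats, HFSet.pair_inj, HFSet.tag_inj] at h
    | eats u1 u2 =>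
      have h1 := HFSet.pair_inj.1 (HFSet.pair_inj.1 h).2
      rw [ih1 h1.1, ih2 h1.2]

theorem DBFm.code_injective : Function.Injective DBFm.code := by
  intro A
  induction A with
  | mem t u =>
    intro B h
    cases B <;> simp only [code, cMem, cEq, cDisj, cNeg, cEx, HFSet.pair_inj, HFSet.tag_inj,
      DBTm.code_injective.eq_iff] at h <;> simp_all
  | eq t u =>
    intro B h
    cases B <;> simp only [code, cMem, cEq, cDisj, cNeg, cEx, HFSet.pair_inj, HFSet.tag_inj,
      DBTm.code_injective.eq_iff] at h <;> simp_all
  | disj A1 A2 ih1 ih2 =>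
    intro B h
    cases B <;> simp only [code, cMem, cEq, cDisj, cNeg, cEx, HFSet.pair_inj, HFSet.tag_inj] at h
    case disj B1 B2 => rw [ih1 h.2.1, ih2 h.2.2]
    all_goals simp at h
  | neg A ih =>
    intro B h
    cases B <;> simp only [code, cMem, cEq, cDisj, cNeg, cEx, HFSet.pair_inj, HFSet.tag_inj] at h
    case neg B => rw [ih h.2]
    all_goals simp at h
  | ex A ih =>
    intro B h
    cases B <;> simp only [code, cMem, cEq, cDisj, cNeg, cEx, HFSet.pair_inj, HFSet.tag_inj] at h
    case ex B => rw [ih h.2]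
    all_goals simp at h

namespace Fm

theorem code_injective : Function.Injective Fm.code :=
  DBFm.code_injective.comp trans_injective

theorem code_disj (A B : Fm) : (A OR B).code = cDisj A.code B.code := by
  rw [code, trans_disj]; rfl

theorem code_neg (A : Fm) : A.neg.code = cNeg A.code := by
  rw [code, trans_neg]; rfl

theorem code_imp (A B : Fm) : (A IMP B).code = cImp A.code B.code := by
  rw [imp, code_disj, code_neg, cImp]

theorem code_ex (i : Name) (A : Fm) : (Fm.ex i A).code = cEx (A.trans.abst i 0).code := by
  rw [code, trans_ex]; rfl

theorem code_all (i : Name) (A : Fm) : (Fm.all i A).code = cAll (A.trans.abst i 0).code := by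
  rw [all, code_neg, code_ex, trans_neg]; rfl

theorem code_subst1 (A : Fm) (i : Name) (t : Tm) :
    (A.subst1 i t).code = (A.trans.sub i (t.trans [])).code := by
  rw [code, trans_subst1]

end Fm

/-! ### Meaning of the predicates about syntax -/

theorem gen_term_iff {x : HFSet} : Gen TermBase TermStep x ↔ ∃ t : Tm, x = t.code := by
  constructor
  · intro h
    induction h with
    | base h =>
      rcases h with rfl | ⟨i, rfl⟩
      · exact ⟨.zero, rfl⟩
      · exact ⟨.var i, by simp [Tm.code, Tm.trans, lookup, DBTm.code]⟩
    | step _ _ h ih1 ih2 =>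
      obtain ⟨t, rfl⟩ := ih1
      obtain ⟨u, rfl⟩ := ih2
      exact ⟨.eats t u, h⟩
  · rintro ⟨t, rfl⟩
    induction t with
    | zero => exact .base (.inl rfl)
    | var i => exact .base (.inr ⟨i, by simp [Tm.code, Tm.trans, lookup, DBTm.code]⟩)
    | eats t u iht ihu => exact .step iht ihu rfl

theorem eval_termP_iff (e : Name → HFSet) (t : Tm) :
    (termP t).Eval e ↔ ∃ r : Tm, t.eval e = r.code := by
  rw [eval_termP, gen_term_iff]

/-- Here w may be any de Bruijn term: an index gives abstraction, a translated term gives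
substitution. The input t may itself contain indices, as it does below quantifiers. -/
theorem gen_stTerm_iff {j : Name} {w : DBTm} {p : HFSet × HFSet} :
    Gen (StTermBase (HFSet.ord (j + 1)) w.code) StTermStep p ↔
      ∃ t : DBTm, p.1 = t.code ∧ p.2 = (t.sub j w).code := by
  constructor
  · intro h
    induction h with
    | base h =>
      rcases h with ⟨h1, h2⟩ | ⟨⟨n, h1⟩ | ⟨⟨n, h1⟩, h3⟩, h2⟩
      · exact ⟨.var j, h1, by simpa [DBTm.sub, DBTm.map] using h2⟩
      · exact ⟨.ind n, h1, h2.trans h1⟩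
      · cases n with
        | zero => rw [HFSet.ord_zero] at h1; exact ⟨.zero, h1, h2.trans h1⟩
        | succ i =>
          have hij : i ≠ j := by rintro rfl; exact h3 h1
          exact ⟨.var i, h1, by rw [h2, h1]; simp [DBTm.sub, DBTm.map, hij, DBTm.code]⟩
    | step _ _ h ih1 ih2 =>
      obtain ⟨t, h1, h2⟩ := ih1
      obtain ⟨u, h3, h4⟩ := ih2
      exact ⟨.eats t u, by rw [h.1, h1, h3]; rfl, by rw [h.2, h2, h4]; rfl⟩
  · rintro ⟨t, h⟩
    induction t generalizing p with
    | zero =>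
      exact .base (.inr ⟨.inr ⟨⟨0, h.1.trans HFSet.ord_zero.symm⟩, fun h1 => by
        rw [h.1] at h1
        simp only [DBTm.code, ← HFSet.ord_zero, HFSet.ord_inj] at h1
        exact Nat.succ_ne_zero j h1.symm⟩, h.2.trans h.1.symm⟩)
    | var i =>
      by_cases hij : i = j
      · subst hij
        exact .base (.inl ⟨h.1, by rw [h.2]; simp [DBTm.sub, DBTm.map]⟩)
      · refine .base (.inr ⟨.inr ⟨⟨i + 1, h.1⟩, fun h1 => hij ?_⟩, ?_⟩)
        · exact Nat.succ_injective (HFSet.ord_inj.1 (h.1.symm.trans h1))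
        · rw [h.2, h.1]; simp [DBTm.sub, DBTm.map, hij]
    | ind k => exact .base (.inr ⟨.inl ⟨k, h.1⟩, h.2.trans h.1.symm⟩)
    | eats t u iht ihu =>
      exact .step (iht (p := (_, _)) ⟨rfl, rfl⟩) (ihu (p := (_, _)) ⟨rfl, rfl⟩) h

theorem eval_abstTermP (e : Name → HFSet) (v i x x' : Tm) :
    (abstTermP v i x x').Eval e ↔ ∃ (j : Name) (n : ℕ) (t : DBTm), v.eval e = HFSet.ord (j + 1) ∧
      i.eval e = HFSet.ord n ∧ x.eval e = t.code ∧ x'.eval e = (t.abst j n).code := by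
  have h0 : (exF₂ [v, i, x, x'] fun s k => seqStTermP v (qInd i) x x' s k).Eval e ↔
      ∃ s k, (∃ i : Name, v.eval e = HFSet.ord (i + 1)) ∧
        Constr pairCode (StTermBase (v.eval e) (cInd (i.eval e))) StTermStep s k
          (x.eval e, x'.eval e) := by
    refine exF₂_iff fun e1 s k h1 => ?_
    simp only [agree_cons] at h1
    rw [eval_seqStTermP]
    simp only [eval_qInd, h1]
  simp only [exists_and_left] at h0
  rw [abstTermP, Fm.eval_conj, h0, eval_ordP,
    HFSet.exists_constr_iff_gen pairCode_injective]
  constructor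
  · rintro ⟨⟨n, hn⟩, ⟨j, hj⟩, h⟩
    rw [hj, hn] at h
    obtain ⟨t, h1, h2⟩ := (gen_stTerm_iff (w := .ind n)).1 h
    exact ⟨j, n, t, hj, hn, h1, h2⟩
  · rintro ⟨j, n, t, hj, hn, h1, h2⟩
    refine ⟨⟨n, hn⟩, ⟨j, hj⟩, ?_⟩
    rw [hj, hn]
    exact (gen_stTerm_iff (w := .ind n)).2 ⟨t, h1, h2⟩

theorem eval_substTermP (e : Name → HFSet) (v u x x' : Tm) :
    (substTermP v u x x').Eval e ↔ ∃ (j : Name) (w : Tm) (t : DBTm),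
      v.eval e = HFSet.ord (j + 1) ∧ u.eval e = w.code ∧ x.eval e = t.code ∧
        x'.eval e = (t.sub j (w.trans [])).code := by
  have h0 : (exF₂ [v, u, x, x'] fun s k => seqStTermP v u x x' s k).Eval e ↔
      ∃ s k, (∃ i : Name, v.eval e = HFSet.ord (i + 1)) ∧
        Constr pairCode (StTermBase (v.eval e) (u.eval e)) StTermStep s k
          (x.eval e, x'.eval e) := by
    refine exF₂_iff fun e1 s k h1 => ?_
    simp only [agree_cons] at h1
    rw [eval_seqStTermP]
    simp only [h1]
  simp only [exists_and_left] at h0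
  rw [substTermP, Fm.eval_conj, h0, eval_termP_iff,
    HFSet.exists_constr_iff_gen pairCode_injective]
  constructor
  · rintro ⟨⟨w, hw⟩, ⟨j, hj⟩, h⟩
    rw [hj, hw] at h
    obtain ⟨t, h1, h2⟩ := gen_stTerm_iff.1 h
    exact ⟨j, w, t, hj, hw, h1, h2⟩
  · rintro ⟨j, w, t, hj, hw, h1, h2⟩
    refine ⟨⟨w, hw⟩, ⟨j, hj⟩, ?_⟩
    rw [hj, hw]
    exact gen_stTerm_iff.2 ⟨t, h1, h2⟩

/-! #### Abstraction in formulas -/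

def AbstBase (v : HFSet) (p : HFSet × HFSet × HFSet) : Prop :=
  ∃ (j : Name) (n : ℕ) (t u : DBTm), v = HFSet.ord (j + 1) ∧ p.1 = HFSet.ord n ∧
    ((p.2.1 = cEq t.code u.code ∧ p.2.2 = cEq (t.abst j n).code (u.abst j n).code) ∨
     (p.2.1 = cMem t.code u.code ∧ p.2.2 = cMem (t.abst j n).code (u.abst j n).code))

def AbstStep (a b p : HFSet × HFSet × HFSet) : Prop :=
  ((p.1 = a.1 ∧ p.1 = b.1 ∧ p.2.1 = cDisj a.2.1 b.2.1 ∧ p.2.2 = cDisj a.2.2 b.2.2) ∨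
   (p.1 = a.1 ∧ p.2.1 = cNeg a.2.1 ∧ p.2.2 = cNeg a.2.2) ∨
   (HFSet.eats p.1 p.1 = a.1 ∧ p.2.1 = cEx a.2.1 ∧ p.2.2 = cEx a.2.2)) ∧
  ∃ n, p.1 = HFSet.ord n

def tripleCode (p : HFSet × HFSet × HFSet) : HFSet := HFSet.pair p.1 (HFSet.pair p.2.1 p.2.2)

theorem tripleCode_injective : Function.Injective tripleCode := fun _ _ h =>
  Prod.ext (HFSet.pair_inj.1 h).1 (pairCode_injective (HFSet.pair_inj.1 h).2)

theorem eval_abstAtomicP (e : Name → HFSet) (v i y y' : Tm) :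
    (abstAtomicP v i y y').Eval e ↔ AbstBase (v.eval e) (i.eval e, y.eval e, y'.eval e) := by
  let Q : HFSet → HFSet → HFSet → HFSet → Prop := fun t u t' u' =>
    (∃ (j : Name) (n : ℕ) (r : DBTm), v.eval e = HFSet.ord (j + 1) ∧
      i.eval e = HFSet.ord n ∧ t = r.code ∧ t' = (r.abst j n).code) ∧
    (∃ (j : Name) (n : ℕ) (r : DBTm), v.eval e = HFSet.ord (j + 1) ∧
      i.eval e = HFSet.ord n ∧ u = r.code ∧ u' = (r.abst j n).code) ∧
    ((y.eval e = cEq t u ∧ y'.eval e = cEq t' u') ∨ (y.eval e = cMem t u ∧ y'.eval e = cMem t' u'))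
  have h0 : (abstAtomicP v i y y').Eval e ↔ ∃ t u t' u', Q t u t' u' := by
    refine exF₄_iff fun e1 t u t' u' h1 => ?_
    simp only [agree_cons] at h1
    simp only [Fm.eval_conj, Fm.eval_disj, Fm.eval_eq, eval_abstTermP, eval_qEq, eval_qMem, h1, Q]
  rw [h0]
  constructor
  · rintro ⟨_, _, _, _, ⟨j, n, t, hj, hn, rfl, rfl⟩, ⟨j', n', u, hj', hn', rfl, rfl⟩, h⟩
    obtain rfl : j = j' := Nat.succ_injective (HFSet.ord_inj.1 (hj.symm.trans hj'))
    obtain rfl : n = n' := HFSet.ord_inj.1 (hn.symm.trans hn')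
    exact ⟨j, n, t, u, hj, hn, h⟩
  · rintro ⟨j, n, t, u, hj, hn, h⟩
    exact ⟨_, _, _, _, ⟨j, n, t, hj, hn, rfl, rfl⟩, ⟨j, n, u, hj, hn, rfl, rfl⟩, h⟩

theorem eval_seqAbstFormP (e : Name → HFSet) (v i x x' s k : Tm) :
    (seqAbstFormP v i x x' s k).Eval e ↔
      Constr tripleCode (AbstBase (v.eval e)) AbstStep (s.eval e) (k.eval e)
        (i.eval e, x.eval e, x'.eval e) := by
  rw [seqAbstFormP, Fm.eval_conj, eval_lstSeqP, eval_pair, eval_pair]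
  refine and_congr Iff.rfl (allIn_iff fun e2 l h2 => ?_)
  simp only [agree_cons] at h2
  simp only [Prod.exists]
  refine exF₃_iff fun e3 sli sl sl' h3 => ?_
  simp only [agree_cons] at h3
  simp only [Fm.eval_conj, Fm.eval_disj, Fm.eval_mem, eval_abstAtomicP, eval_ordP, eval_pair,
    h3, h2, tripleCode]
  refine and_congr Iff.rfl (or_congr Iff.rfl ?_)
  -- In the formula the ordinal condition stands outside the quantifiers over premises, while
  -- `AbstStep` carries it inside.
  simp only [AbstStep, ← and_assoc, exists_and_right]
  rw [and_comm]
  refine and_congr (exF₂_iff fun e4 m n h4 => exF₃_iff fun e5 smi sm sm' h5 => ?_) Iff.rfl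
  simp only [agree_cons] at h4 h5
  rw [← h5.2.2.2.2.2.2.2.2.2.2.1, ← h5.2.2.2.2.2.2.2.2.2.2.2.1]
  refine exF₃_iff fun e6 sni sn sn' h6 => ?_
  simp only [agree_cons] at h6
  simp only [Fm.eval_conj, Fm.eval_disj, Fm.eval_mem, Fm.eval_eq, eval_pair, eval_qDisj, eval_qNeg,
    eval_qEx, eval_succT, and_assoc, h6, h5, h4, h3, h2]

/-- The index travels as a component of the triple, because the premise of a quantifier step is an
abstraction at the next index. This makes the induction on de Bruijn formulas go through for all n
together. -/
theorem gen_abst_iff {j : Name} {p : HFSet × HFSet × HFSet} :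
    Gen (AbstBase (HFSet.ord (j + 1))) AbstStep p ↔ ∃ (n : ℕ) (D : DBFm), p.1 = HFSet.ord n ∧
      p.2.1 = D.code ∧ p.2.2 = (D.abst j n).code := by
  constructor
  · intro h
    induction h with
    | base h =>
      obtain ⟨j', n, t, u, hj, hn, h⟩ := h
      obtain rfl : j = j' := Nat.succ_injective (HFSet.ord_inj.1 hj)
      rcases h with h | h
      · exact ⟨n, .eq t u, hn, h⟩
      · exact ⟨n, .mem t u, hn, h⟩
    | step _ _ h ih1 ih2 =>
      obtain ⟨n1, D1, h1, h2, h3⟩ := ih1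
      obtain ⟨n2, D2, h4, h5, h6⟩ := ih2
      obtain ⟨h, n, hn⟩ := h
      rcases h with ⟨ha, hb, hc, hd⟩ | ⟨ha, hc, hd⟩ | ⟨ha, hc, hd⟩
      · obtain rfl : n = n1 := HFSet.ord_inj.1 (by rw [← hn, ha, h1])
        obtain rfl : n = n2 := HFSet.ord_inj.1 (by rw [← hn, hb, h4])
        exact ⟨n, .disj D1 D2, hn, by rw [hc, h2, h5]; rfl, by rw [hd, h3, h6]; rfl⟩
      · obtain rfl : n = n1 := HFSet.ord_inj.1 (by rw [← hn, ha, h1])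
        exact ⟨n, .neg D1, hn, by rw [hc, h2]; rfl, by rw [hd, h3]; rfl⟩
      · obtain rfl : n + 1 = n1 := HFSet.ord_inj.1 (by rw [HFSet.ord_succ, ← hn, ha, h1])
        exact ⟨n, .ex D1, hn, by rw [hc, h2]; rfl, by rw [hd, h3]; rfl⟩
  · rintro ⟨n, D, h1, h2⟩
    induction D generalizing p n with
    | mem t u => exact .base ⟨j, n, t, u, rfl, h1, .inr h2⟩
    | eq t u => exact .base ⟨j, n, t, u, rfl, h1, .inl h2⟩
    | disj A B ihA ihB =>
      exact .step (ihA (p := (_, _, _)) n rfl ⟨rfl, rfl⟩) (ihB (p := (_, _, _)) n rfl ⟨rfl, rfl⟩)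
        ⟨.inl ⟨h1, h1, h2⟩, n, h1⟩
    | neg A ih =>
      have := ih (p := (_, _, _)) n rfl ⟨rfl, rfl⟩
      -- Negation has a single premise; the binary step relation receives it twice.
      exact .step this this ⟨.inr (.inl ⟨h1, h2⟩), n, h1⟩
    | ex A ih =>
      have := ih (p := (_, _, _)) (n + 1) rfl ⟨rfl, rfl⟩
      exact .step this this ⟨.inr (.inr ⟨by rw [h1, HFSet.ord_succ], h2⟩), n, h1⟩

/-- Abstraction of the variable coded by `v` to the index `i`. -/
def AbstS (v i x x' : HFSet) : Prop :=
  ∃ (j : Name) (n : ℕ) (D : DBFm), v = HFSet.ord (j + 1) ∧ i = HFSet.ord n ∧ x = D.code ∧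
    x' = (D.abst j n).code

theorem eval_abstFormP (e : Name → HFSet) (v i x x' : Tm) :
    (abstFormP v i x x').Eval e ↔ AbstS (v.eval e) (i.eval e) (x.eval e) (x'.eval e) := by
  have h0 : (exF₂ [v, i, x, x'] fun s k => seqAbstFormP v i x x' s k).Eval e ↔
      ∃ s k, Constr tripleCode (AbstBase (v.eval e)) AbstStep s k
        (i.eval e, x.eval e, x'.eval e) := by
    refine exF₂_iff fun e1 s k h1 => ?_
    simp only [agree_cons] at h1
    rw [eval_seqAbstFormP]
    simp only [h1]
  rw [abstFormP, Fm.eval_conj, Fm.eval_conj, h0, eval_varP, eval_ordP,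
    HFSet.exists_constr_iff_gen tripleCode_injective]
  constructor
  · rintro ⟨⟨j, hj⟩, -, h⟩
    rw [hj] at h
    obtain ⟨n, D, h⟩ := gen_abst_iff.1 h
    exact ⟨j, n, D, hj, h⟩
  · rintro ⟨j, n, D, hj, h⟩
    refine ⟨⟨j, hj⟩, ⟨n, h.1⟩, ?_⟩
    rw [hj]
    exact gen_abst_iff.2 ⟨n, D, h⟩

/-! #### Substitution in formulas -/

def SubstBase (v u : HFSet) (p : HFSet × HFSet) : Prop :=
  ∃ (j : Name) (w : Tm) (t r : DBTm), v = HFSet.ord (j + 1) ∧ u = w.code ∧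
    ((p.1 = cEq t.code r.code ∧
        p.2 = cEq (t.sub j (w.trans [])).code (r.sub j (w.trans [])).code) ∨
     (p.1 = cMem t.code r.code ∧
        p.2 = cMem (t.sub j (w.trans [])).code (r.sub j (w.trans [])).code))

def SubstStep (a b p : HFSet × HFSet) : Prop :=
  (p.1 = cDisj a.1 b.1 ∧ p.2 = cDisj a.2 b.2) ∨ (p.1 = cNeg a.1 ∧ p.2 = cNeg a.2) ∨
    (p.1 = cEx a.1 ∧ p.2 = cEx a.2)

theorem Tm.code_trans_inj {w w' : Tm} (h : w.code = w'.code) : w.trans [] = w'.trans [] :=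
  DBTm.code_injective h

theorem eval_substAtomicP (e : Name → HFSet) (v u y y' : Tm) :
    (substAtomicP v u y y').Eval e ↔
      SubstBase (v.eval e) (u.eval e) (y.eval e, y'.eval e) := by
  let Q : HFSet → HFSet → HFSet → HFSet → Prop := fun t r t' r' =>
    (∃ (j : Name) (w : Tm) (q : DBTm), v.eval e = HFSet.ord (j + 1) ∧
      u.eval e = w.code ∧ t = q.code ∧ t' = (q.sub j (w.trans [])).code) ∧
    (∃ (j : Name) (w : Tm) (q : DBTm), v.eval e = HFSet.ord (j + 1) ∧
      u.eval e = w.code ∧ r = q.code ∧ r' = (q.sub j (w.trans [])).code) ∧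
    ((y.eval e = cEq t r ∧ y'.eval e = cEq t' r') ∨ (y.eval e = cMem t r ∧ y'.eval e = cMem t' r'))
  have h0 : (substAtomicP v u y y').Eval e ↔ ∃ t r t' r', Q t r t' r' := by
    refine exF₄_iff fun e1 t r t' r' h1 => ?_
    simp only [agree_cons] at h1
    simp only [Fm.eval_conj, Fm.eval_disj, Fm.eval_eq, eval_substTermP, eval_qEq, eval_qMem, h1, Q]
  rw [h0]
  constructor
  · rintro ⟨_, _, _, _, ⟨j, w, t, hj, hw, rfl, rfl⟩, ⟨j', w', r, hj', hw', rfl, rfl⟩, h⟩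
    obtain rfl : j = j' := Nat.succ_injective (HFSet.ord_inj.1 (hj.symm.trans hj'))
    -- The two sides of the atom were substituted with possibly different terms; having the same
    -- code, these have the same translation.
    rw [← Tm.code_trans_inj (hw.symm.trans hw')] at h
    exact ⟨j, w, t, r, hj, hw, h⟩
  · rintro ⟨j, w, t, r, hj, hw, h⟩
    exact ⟨_, _, _, _, ⟨j, w, t, hj, hw, rfl, rfl⟩, ⟨j, w, r, hj, hw, rfl, rfl⟩, h⟩

theorem eval_seqSubstFormP (e : Name → HFSet) (v u x x' s k : Tm) :
    (seqSubstFormP v u x x' s k).Eval e ↔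
      Constr pairCode (SubstBase (v.eval e) (u.eval e)) SubstStep (s.eval e) (k.eval e)
        (x.eval e, x'.eval e) := by
  rw [seqSubstFormP, Fm.eval_conj, eval_lstSeqP, eval_pair]
  refine and_congr Iff.rfl (allIn_iff fun e2 l h2 => ?_)
  simp only [agree_cons] at h2
  simp only [Prod.exists]
  refine exF₂_iff fun e3 sl sl' h3 => ?_
  simp only [agree_cons] at h3
  simp only [Fm.eval_conj, Fm.eval_disj, Fm.eval_mem, eval_substAtomicP, eval_pair, h3, h2,
    pairCode]
  refine and_congr Iff.rfl (or_congr Iff.rfl (exF₂_iff fun e4 m n h4 =>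
    exF₂_iff fun e5 sm sm' h5 => ?_))
  simp only [agree_cons] at h4 h5
  rw [← h5.2.2.2.2.2.2.2.2.2.1, ← h5.2.2.2.2.2.2.2.2.2.2.1]
  refine exF₂_iff fun e6 sn sn' h6 => ?_
  simp only [agree_cons] at h6
  simp only [Fm.eval_conj, Fm.eval_disj, Fm.eval_mem, Fm.eval_eq, eval_pair, eval_qDisj, eval_qNeg,
    eval_qEx, SubstStep, h6, h5, h4, h3, h2]

theorem gen_subst_iff {j : Name} {w : Tm} {p : HFSet × HFSet} :
    Gen (SubstBase (HFSet.ord (j + 1)) w.code) SubstStep p ↔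
      ∃ D : DBFm, p.1 = D.code ∧ p.2 = (D.sub j (w.trans [])).code := by
  constructor
  · intro h
    induction h with
    | base h =>
      obtain ⟨j', w', t, r, hj, hw, h⟩ := h
      obtain rfl : j = j' := Nat.succ_injective (HFSet.ord_inj.1 hj)
      rw [← Tm.code_trans_inj hw] at h
      rcases h with h | h
      · exact ⟨.eq t r, h⟩
      · exact ⟨.mem t r, h⟩
    | step _ _ h ih1 ih2 =>
      obtain ⟨D1, h1, h2⟩ := ih1
      obtain ⟨D2, h3, h4⟩ := ih2
      rcases h with ⟨ha, hb⟩ | ⟨ha, hb⟩ | ⟨ha, hb⟩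
      · exact ⟨.disj D1 D2, by rw [ha, h1, h3]; rfl, by rw [hb, h2, h4]; rfl⟩
      · exact ⟨.neg D1, by rw [ha, h1]; rfl, by rw [hb, h2]; rfl⟩
      · exact ⟨.ex D1, by rw [ha, h1]; rfl, by rw [hb, h2]; rfl⟩
  · rintro ⟨D, h⟩
    induction D generalizing p with
    | mem t u => exact .base ⟨j, w, t, u, rfl, rfl, .inr h⟩
    | eq t u => exact .base ⟨j, w, t, u, rfl, rfl, .inl h⟩
    | disj A B ihA ihB =>
      exact .step (ihA (p := (_, _)) ⟨rfl, rfl⟩) (ihB (p := (_, _)) ⟨rfl, rfl⟩) (.inl h)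
    | neg A ih =>
      have := ih (p := (_, _)) ⟨rfl, rfl⟩
      exact .step this this (.inr (.inl h))
    | ex A ih =>
      have := ih (p := (_, _)) ⟨rfl, rfl⟩
      exact .step this this (.inr (.inr h))

/-- Substitution of the term coded by `u` for the variable coded by `v`. -/
def SubstS (v u x x' : HFSet) : Prop :=
  ∃ (j : Name) (w : Tm) (D : DBFm), v = HFSet.ord (j + 1) ∧ u = w.code ∧ x = D.code ∧
    x' = (D.sub j (w.trans [])).code

theorem eval_substFormP (e : Name → HFSet) (v u x x' : Tm) :
    (substFormP v u x x').Eval e ↔ SubstS (v.eval e) (u.eval e) (x.eval e) (x'.eval e) := by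
  have h0 : (exF₂ [v, u, x, x'] fun s k => seqSubstFormP v u x x' s k).Eval e ↔
      ∃ s k, Constr pairCode (SubstBase (v.eval e) (u.eval e)) SubstStep s k
        (x.eval e, x'.eval e) := by
    refine exF₂_iff fun e1 s k h1 => ?_
    simp only [agree_cons] at h1
    rw [eval_seqSubstFormP]
    simp only [h1]
  rw [substFormP, Fm.eval_conj, Fm.eval_conj, h0, eval_varP, eval_termP_iff,
    HFSet.exists_constr_iff_gen pairCode_injective]
  constructor
  · rintro ⟨⟨j, hj⟩, ⟨w, hw⟩, h⟩
    rw [hj, hw] at h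
    obtain ⟨D, h⟩ := gen_subst_iff.1 h
    exact ⟨j, w, D, hj, hw, h⟩
  · rintro ⟨j, w, D, hj, hw, h⟩
    refine ⟨⟨j, hj⟩, ⟨w, hw⟩, ?_⟩
    rw [hj, hw]
    exact gen_subst_iff.2 ⟨D, h⟩

/-- Injectivity of codes fixes the de Bruijn formula as the translation of A and the index as 0,
leaving only the choice of variable. -/
theorem abstS_code_iff {v x' : HFSet} {A : Fm} : AbstS v HFSet.empty A.code x' ↔
    ∃ j : Name, v = HFSet.ord (j + 1) ∧ x' = (A.trans.abst j 0).code := by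
  constructor
  · rintro ⟨j, n, D, hj, hn, hD, h⟩
    rw [← HFSet.ord_zero, HFSet.ord_inj] at hn
    rw [← DBFm.code_injective hD, ← hn] at h
    exact ⟨j, hj, h⟩
  · rintro ⟨j, hj, h⟩
    exact ⟨j, 0, A.trans, hj, HFSet.ord_zero.symm, rfl, h⟩

theorem substS_code_iff {v u x' : HFSet} {A : Fm} : SubstS v u A.code x' ↔
    ∃ (j : Name) (w : Tm), v = HFSet.ord (j + 1) ∧ u = w.code ∧ x' = (A.subst1 j w).code := by
  constructor
  · rintro ⟨j, w, D, hj, hw, hD, h⟩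
    rw [← DBFm.code_injective hD, ← Fm.code_subst1] at h
    exact ⟨j, w, hj, hw, h⟩
  · rintro ⟨j, w, hj, hw, h⟩
    exact ⟨j, w, A.trans, hj, hw, rfl, by rw [h, Fm.code_subst1]⟩

/-! #### Codes of formulas -/

def FormBase (x : HFSet) : Prop :=
  ∃ t u : Tm, x = cEq t.code u.code ∨ x = cMem t.code u.code

def FormStep (a b x : HFSet) : Prop :=
  x = cDisj a b ∨ x = cNeg a ∨ ∃ v y, AbstS v HFSet.empty a y ∧ x = cEx y

theorem eval_atomicP (e : Name → HFSet) (y : Tm) : (atomicP y).Eval e ↔ FormBase (y.eval e) := by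
  let Q : HFSet → HFSet → Prop := fun t u => (∃ r : Tm, t = r.code) ∧ (∃ r : Tm, u = r.code) ∧
    (y.eval e = cEq t u ∨ y.eval e = cMem t u)
  have h0 : (atomicP y).Eval e ↔ ∃ t u, Q t u := by
    refine exF₂_iff fun e1 t u h1 => ?_
    simp only [agree_cons] at h1
    simp only [Fm.eval_conj, Fm.eval_disj, Fm.eval_eq, eval_termP_iff, eval_qEq, eval_qMem, h1, Q]
  rw [h0]
  constructor
  · rintro ⟨_, _, ⟨t, rfl⟩, ⟨u, rfl⟩, h⟩
    exact ⟨t, u, h⟩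
  · rintro ⟨t, u, h⟩
    exact ⟨_, _, ⟨t, rfl⟩, ⟨u, rfl⟩, h⟩

theorem eval_makeFormP (e : Name → HFSet) (y u w : Tm) :
    (makeFormP y u w).Eval e ↔ FormStep (u.eval e) (w.eval e) (y.eval e) := by
  rw [makeFormP, Fm.eval_disj, Fm.eval_disj, Fm.eval_eq, Fm.eval_eq, eval_qDisj, eval_qNeg]
  refine or_congr Iff.rfl (or_congr Iff.rfl (exF₂_iff fun e1 v au h1 => ?_))
  simp only [agree_cons] at h1
  simp only [Fm.eval_conj, Fm.eval_eq, eval_abstFormP, eval_qEx, eval_zero, h1]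

/-- Quantified codes arise only by abstracting a named variable of a formula code. Hence no index
dangles, and exactly the translations of named formulas are generated. -/
theorem gen_form_iff {x : HFSet} : Gen FormBase FormStep x ↔ ∃ A : Fm, x = A.code := by
  constructor
  · intro h
    induction h with
    | base h =>
      obtain ⟨t, u, h | h⟩ := h
      · exact ⟨t EQ u, h⟩
      · exact ⟨t IN u, h⟩
    | step _ _ h ih1 ih2 =>
      obtain ⟨A, rfl⟩ := ih1
      obtain ⟨B, rfl⟩ := ih2
      rcases h with rfl | rfl | ⟨v, y, h, rfl⟩
      · exact ⟨A OR B, (Fm.code_disj A B).symm⟩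
      · exact ⟨A.neg, A.code_neg.symm⟩
      · obtain ⟨j, -, rfl⟩ := abstS_code_iff.1 h
        exact ⟨Fm.ex j A, (Fm.code_ex j A).symm⟩
  · rintro ⟨A, rfl⟩
    induction A using Fm.induction with
    | mem t u => exact .base ⟨t, u, .inr rfl⟩
    | eq t u => exact .base ⟨t, u, .inl rfl⟩
    | disj A B ihA ihB => exact .step ihA ihB (.inl (A.code_disj B))
    | neg A ih => exact .step ih ih (.inr (.inl A.code_neg))
    | ex i A ih =>
      exact .step ih ih (.inr (.inr ⟨_, _, abstS_code_iff.2 ⟨i, rfl, rfl⟩, Fm.code_ex i A⟩))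

theorem eval_formP (e : Name → HFSet) (y : Tm) :
    (formP y).Eval e ↔ ∃ A : Fm, y.eval e = A.code := by
  rw [← gen_form_iff, ← HFSet.exists_constr_iff_gen Function.injective_id]
  refine exF₂_iff fun e1 s k h1 => ?_
  simp only [agree_cons] at h1
  rw [seqFormP, Fm.eval_conj, eval_lstSeqP, h1.1]
  refine and_congr Iff.rfl (allIn_iff fun e2 l h2 => ?_)
  simp only [agree_cons] at h2
  refine exF_iff fun e3 sl h3 => ?_
  simp only [agree_cons] at h3
  simp only [Fm.eval_conj, Fm.eval_disj, Fm.eval_mem, eval_atomicP, eval_pair, h3, h2, id]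
  refine and_congr Iff.rfl (or_congr Iff.rfl (exF₄_iff fun e4 m n sm sn h4 => ?_))
  simp only [agree_cons] at h4
  simp only [Fm.eval_conj, Fm.eval_mem, eval_pair, eval_makeFormP, h4, h3, h2]

theorem eval_varNonOccFormP (e : Name → HFSet) (v y : Tm) :
    (varNonOccFormP v y).Eval e ↔
      ∃ (j : Name) (A : Fm), v.eval e = HFSet.ord (j + 1) ∧ y.eval e = A.code ∧ j ∉ A.fv := by
  rw [varNonOccFormP, Fm.eval_conj, eval_formP, eval_substFormP, eval_zero]
  constructor
  · rintro ⟨⟨A, hA⟩, h⟩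
    rw [hA] at h
    obtain ⟨j, w, hj, hw, h⟩ := substS_code_iff.1 h
    -- The substituted term is known only through its code, which is that of 0.
    have hw' : w = Tm.zero := Tm.trans_injective [] (Tm.code_trans_inj (w := w) (w' := .zero) hw.symm)
    subst hw'
    exact ⟨j, A, hj, hA, Fm.notMem_fv_iff_subst1_zero.1 (Fm.code_injective h.symm)⟩
  · rintro ⟨j, A, hj, hA, h⟩
    rw [hA]
    exact ⟨⟨A, rfl⟩, substS_code_iff.2 ⟨j, .zero, hj, rfl, by rw [Fm.subst1_of_notMem h]⟩⟩


/-! ### Meaning of the predicates about axioms, rules and proofs -/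

theorem eval_booleanAxP (e : Name → HFSet) (p : Tm) :
    (booleanAxP p).Eval e ↔ ∃ B, BooleanAxiom B ∧ p.eval e = B.code := by
  let Q : HFSet → HFSet → HFSet → Prop := fun x y z =>
    (∃ A : Fm, x = A.code) ∧ (∃ A : Fm, y = A.code) ∧ (∃ A : Fm, z = A.code) ∧
    (p.eval e = cImp x x ∨ p.eval e = cImp x (cDisj x y) ∨ p.eval e = cImp (cDisj x x) x ∨
      p.eval e = cImp (cDisj x (cDisj y z)) (cDisj (cDisj x y) z) ∨
      p.eval e = cImp (cDisj z x) (cImp (cDisj (cNeg z) y) (cDisj x y)))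
  have h0 : (booleanAxP p).Eval e ↔ ∃ x y z, Q x y z := by
    refine exF₃_iff fun e1 x y z h1 => ?_
    simp only [agree_cons] at h1
    simp only [Fm.eval_conj, Fm.eval_disj, Fm.eval_eq, eval_formP, eval_qImp, eval_qDisj,
      eval_qNeg, h1, Q]
  rw [h0]
  constructor
  · rintro ⟨_, _, _, ⟨A, rfl⟩, ⟨B, rfl⟩, ⟨C, rfl⟩, h⟩
    simp only [← Fm.code_disj, ← Fm.code_neg, ← Fm.code_imp] at h
    rcases h with h | h | h | h | h
    · exact ⟨_, .ident A, h⟩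
    · exact ⟨_, .disjI1 A B, h⟩
    · exact ⟨_, .disjCont A, h⟩
    · exact ⟨_, .disjAssoc A B C, h⟩
    · exact ⟨_, .disjConj A B C, h⟩
  · rintro ⟨_, ⟨⟩, h⟩ <;> simp only [Fm.code_disj, Fm.code_neg, Fm.code_imp] at h
    case ident A => exact ⟨_, _, _, ⟨A, rfl⟩, ⟨A, rfl⟩, ⟨A, rfl⟩, .inl h⟩
    case disjI1 A B => exact ⟨_, _, _, ⟨A, rfl⟩, ⟨B, rfl⟩, ⟨A, rfl⟩, .inr (.inl h)⟩
    case disjCont A => exact ⟨_, _, _, ⟨A, rfl⟩, ⟨A, rfl⟩, ⟨A, rfl⟩, .inr (.inr (.inl h))⟩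
    case disjAssoc A B C =>
      exact ⟨_, _, _, ⟨A, rfl⟩, ⟨B, rfl⟩, ⟨C, rfl⟩, .inr (.inr (.inr (.inl h)))⟩
    case disjConj A B C =>
      exact ⟨_, _, _, ⟨A, rfl⟩, ⟨B, rfl⟩, ⟨C, rfl⟩, .inr (.inr (.inr (.inr h)))⟩

theorem eval_specialAxP (e : Name → HFSet) (p : Tm) :
    (specialAxP p).Eval e ↔ ∃ B, SpecialAxiom B ∧ p.eval e = B.code := by
  have h0 : (specialAxP p).Eval e ↔ ∃ v t x xt ax, (∃ A : Fm, x = A.code) ∧ SubstS v t x xt ∧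
      AbstS v HFSet.empty x ax ∧ p.eval e = cImp xt (cEx ax) := by
    refine exF₃_iff fun e1 v t x h1 => exF₂_iff fun e2 xt ax h2 => ?_
    simp only [agree_cons] at h1 h2
    simp only [Fm.eval_conj, Fm.eval_eq, eval_formP, eval_substFormP, eval_abstFormP, eval_zero,
      eval_qImp, eval_qEx, h1, h2]
  rw [h0]
  constructor
  · rintro ⟨v, t, _, xt, ax, ⟨A, rfl⟩, h1, h2, h3⟩
    obtain ⟨j, w, hj, rfl, rfl⟩ := substS_code_iff.1 h1
    obtain ⟨j', hj', rfl⟩ := abstS_code_iff.1 h2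
    obtain rfl : j = j' := Nat.succ_injective (HFSet.ord_inj.1 (hj.symm.trans hj'))
    exact ⟨_, ⟨A, j, w⟩, by rw [h3, Fm.code_imp, Fm.code_ex]⟩
  · rintro ⟨_, ⟨A, j, w⟩, h⟩
    exact ⟨_, _, _, _, _, ⟨A, rfl⟩, substS_code_iff.2 ⟨j, w, rfl, rfl, rfl⟩,
      abstS_code_iff.2 ⟨j, rfl, rfl⟩, by rw [h, Fm.code_imp, Fm.code_ex]⟩

theorem Tm.code_var (i : Name) : (Tm.var i).code = HFSet.ord (i + 1) := by
  simp [Tm.code, Tm.trans, lookup, DBTm.code]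

theorem Tm.code_injective : Function.Injective Tm.code :=
  DBTm.code_injective.comp (Tm.trans_injective [])

theorem eval_inductionAxP (e : Name → HFSet) (p : Tm) :
    (inductionAxP p).Eval e ↔ ∃ B, InductionAxiom B ∧ p.eval e = B.code := by
  have h0 : (inductionAxP p).Eval e ↔ ∃ v w x x0 xw xevw aw avw av, v ≠ w ∧
      (∃ (j : Name) (A : Fm), w = HFSet.ord (j + 1) ∧ x = A.code ∧ j ∉ A.fv) ∧
      SubstS v HFSet.empty x x0 ∧ SubstS v w x xw ∧ SubstS v (cEats v w) x xevw ∧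
      AbstS w HFSet.empty (cImp x (cImp xw xevw)) aw ∧ AbstS v HFSet.empty (cAll aw) avw ∧
      AbstS v HFSet.empty x av ∧ p.eval e = cImp x0 (cImp (cAll avw) (cAll av)) := by
    refine exF₃_iff fun e1 v w x h1 => exF₃_iff fun e2 x0 xw xevw h2 =>
      exF₃_iff fun e3 aw avw av h3 => ?_
    simp only [agree_cons] at h1 h2 h3
    simp only [Fm.eval_conj, Fm.eval_eq, Fm.eval_neq, eval_varNonOccFormP, eval_substFormP,
      eval_abstFormP, eval_zero, eval_qImp, eval_qAll, eval_qEats, h1, h2, h3]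
  rw [h0]
  constructor
  · rintro ⟨v, w, _, x0, xw, xevw, aw, avw, av, hvw, ⟨j, A, rfl, rfl, hj⟩, h1, h2, h3, h4, h5, h6,
      h⟩
    obtain ⟨i, t, rfl, ht, rfl⟩ := substS_code_iff.1 h1
    -- The data of the axiom are read back from their codes one at a time; injectivity forces the
    -- terms 0, x_j and x_i ◁ x_j and makes the repeated variables coincide.
    obtain rfl : t = .zero := Tm.code_injective (a₂ := .zero) ht.symm
    obtain ⟨i', t, hi, ht, rfl⟩ := substS_code_iff.1 h2
    obtain rfl : i = i' := Nat.succ_injective (HFSet.ord_inj.1 hi)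
    obtain rfl : t = .var j := Tm.code_injective (by rw [← ht, Tm.code_var])
    obtain ⟨i', t, hi', ht', rfl⟩ := substS_code_iff.1 h3
    obtain rfl : i = i' := Nat.succ_injective (HFSet.ord_inj.1 hi')
    obtain rfl : t = .eats (.var i) (.var j) := Tm.code_injective (by
      rw [← ht', ← Tm.code_var, ← Tm.code_var]; rfl)
    rw [← Fm.code_imp, ← Fm.code_imp, abstS_code_iff] at h4
    obtain ⟨j', hj', rfl⟩ := h4
    obtain rfl : j = j' := Nat.succ_injective (HFSet.ord_inj.1 hj')
    rw [← Fm.code_all, abstS_code_iff] at h5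
    obtain ⟨i', hi'', rfl⟩ := h5
    obtain rfl : i = i' := Nat.succ_injective (HFSet.ord_inj.1 hi'')
    obtain ⟨i', hi''', rfl⟩ := abstS_code_iff.1 h6
    obtain rfl : i = i' := Nat.succ_injective (HFSet.ord_inj.1 hi''')
    rw [← Fm.code_all, ← Fm.code_all, ← Fm.code_imp, ← Fm.code_imp] at h
    exact ⟨_, .ind A i j (by rintro rfl; exact hvw rfl) hj, h⟩
  · rintro ⟨_, ⟨A, i, j, hij, hj⟩, h⟩
    refine ⟨HFSet.ord (i + 1), HFSet.ord (j + 1), A.code, _, _, _,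
      ((A IMP (A.subst1 i (.var j) IMP
        A.subst1 i (.eats (.var i) (.var j)))).trans.abst j 0).code,
      ((Fm.all j (A IMP (A.subst1 i (.var j) IMP
        A.subst1 i (.eats (.var i) (.var j))))).trans.abst i 0).code, _, ?_, ⟨j, A, rfl, rfl, hj⟩,
      substS_code_iff.2 ⟨i, .zero, rfl, rfl, rfl⟩,
      substS_code_iff.2 ⟨i, .var j, rfl, (Tm.code_var j).symm, rfl⟩,
      substS_code_iff.2 ⟨i, .eats (.var i) (.var j), rfl,
        by rw [← Tm.code_var, ← Tm.code_var]; rfl, rfl⟩,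
      ?_, ?_, abstS_code_iff.2 ⟨i, rfl, rfl⟩, ?_⟩
    · exact fun h1 => hij (Nat.succ_injective (HFSet.ord_inj.1 h1)).symm
    · rw [← Fm.code_imp, ← Fm.code_imp]
      exact abstS_code_iff.2 ⟨j, rfl, rfl⟩
    · rw [← Fm.code_all]
      exact abstS_code_iff.2 ⟨i, rfl, rfl⟩
    · rw [h, ← Fm.code_all, ← Fm.code_all, ← Fm.code_imp, ← Fm.code_imp]

/-- The axioms of the calculus. -/
def IsAxiom (extra B : Fm) : Prop :=
  B = extra ∨ EqualityAxiom B ∨ HFAxiom B ∨ BooleanAxiom B ∨ SpecialAxiom B ∨ InductionAxiom B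

theorem eval_axiomP (extra : Fm) (e : Name → HFSet) (p : Tm) :
    (axiomP extra p).Eval e ↔ ∃ B, IsAxiom extra B ∧ p.eval e = B.code := by
  simp only [axiomP, Fm.eval_disj, Fm.eval_eq, eval_booleanAxP, eval_specialAxP,
    eval_inductionAxP, Fm.eval_quot, IsAxiom, or_and_right, exists_or, exists_eq_left]
  have h1 : (∃ B, EqualityAxiom B ∧ p.eval e = B.code) ↔ p.eval e = reflAx.code ∨
      p.eval e = eqCongAx.code ∨ p.eval e = memCongAx.code ∨ p.eval e = eatsCongAx.code := by
    constructor
    · rintro ⟨_, ⟨⟩, h⟩ <;> simp [h]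
    · rintro (h | h | h | h)
      exacts [⟨_, .refl, h⟩, ⟨_, .eqCong, h⟩, ⟨_, .memCong, h⟩, ⟨_, .eatsCong, h⟩]
  have h2 : (∃ B, HFAxiom B ∧ p.eval e = B.code) ↔ p.eval e = hf1.code ∨ p.eval e = hf2.code := by
    constructor
    · rintro ⟨_, ⟨⟩, h⟩ <;> simp [h]
    · rintro (h | h)
      exacts [⟨_, .hf1, h⟩, ⟨_, .hf2, h⟩]
  simp only [h1, h2, or_assoc]

def PfBase (extra : Fm) (x : HFSet) : Prop := ∃ B, IsAxiom extra B ∧ x = B.code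

/-- For modus ponens, the first argument is the minor premise and the second the implication. The
two unary rules ignore the second. -/
def PfStep (a b x : HFSet) : Prop :=
  b = cImp a x ∨
  (∃ (j : Name) (A B : Fm), j ∉ B.fv ∧ a = (A IMP B).code ∧ x = (Fm.ex j A IMP B).code) ∨
  ∃ v t, SubstS v t a x

theorem eval_existsP (e : Name → HFSet) (p q : Tm) :
    (existsP p q).Eval e ↔ ∃ (j : Name) (A B : Fm), j ∉ B.fv ∧ p.eval e = (A IMP B).code ∧
      q.eval e = (Fm.ex j A IMP B).code := by
  have h0 : (existsP p q).Eval e ↔ ∃ v x ax y, (∃ A : Fm, x = A.code) ∧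
      (∃ (j : Name) (A : Fm), v = HFSet.ord (j + 1) ∧ y = A.code ∧ j ∉ A.fv) ∧
      AbstS v HFSet.empty x ax ∧ p.eval e = cImp x y ∧ q.eval e = cImp (cEx ax) y := by
    refine exF₄_iff fun e1 v x ax y h1 => ?_
    simp only [agree_cons] at h1
    simp only [Fm.eval_conj, Fm.eval_eq, eval_formP, eval_varNonOccFormP, eval_abstFormP,
      eval_zero, eval_qImp, eval_qEx, h1]
  rw [h0]
  constructor
  · rintro ⟨v, _, ax, _, ⟨A, rfl⟩, ⟨j, B, rfl, rfl, hj⟩, h, hp, hq⟩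
    obtain ⟨j', hj', rfl⟩ := abstS_code_iff.1 h
    obtain rfl : j = j' := Nat.succ_injective (HFSet.ord_inj.1 hj')
    exact ⟨j, A, B, hj, by rw [hp, Fm.code_imp], by rw [hq, Fm.code_imp, Fm.code_ex]⟩
  · rintro ⟨j, A, B, hj, hp, hq⟩
    exact ⟨_, _, _, _, ⟨A, rfl⟩, ⟨j, B, rfl, rfl, hj⟩, abstS_code_iff.2 ⟨j, rfl, rfl⟩,
      by rw [hp, Fm.code_imp], by rw [hq, Fm.code_imp, Fm.code_ex]⟩

theorem eval_substP (e : Name → HFSet) (p q : Tm) :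
    (substP p q).Eval e ↔ ∃ v t, SubstS v t (p.eval e) (q.eval e) := by
  refine exF₂_iff fun e1 v t h1 => ?_
  simp only [agree_cons] at h1
  simp only [eval_substFormP, h1]

theorem eval_pfP (extra : Fm) (e : Name → HFSet) (y : Tm) :
    (pfP extra y).Eval e ↔ Gen (PfBase extra) PfStep (y.eval e) := by
  rw [← HFSet.exists_constr_iff_gen Function.injective_id]
  refine exF₂_iff fun e1 s k h1 => ?_
  simp only [agree_cons] at h1
  rw [prfP, Fm.eval_conj, eval_lstSeqP, h1.1]
  refine and_congr Iff.rfl (allIn_iff fun e2 l h2 => ?_)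
  simp only [agree_cons] at h2
  refine exF_iff fun e3 sl h3 => ?_
  simp only [agree_cons] at h3
  simp only [Fm.eval_conj, Fm.eval_disj, Fm.eval_mem, eval_axiomP, eval_pair, h3, h2, id, PfBase]
  refine and_congr Iff.rfl (or_congr Iff.rfl (exF₄_iff fun e4 m n sm sn h4 => ?_))
  simp only [agree_cons] at h4
  simp only [Fm.eval_conj, Fm.eval_disj, Fm.eval_mem, Fm.eval_eq, modPonP, eval_existsP,
    eval_substP, eval_qImp, eval_pair, PfStep, h4, h3, h2]

theorem IsAxiom.thm {extra B : Fm} (h : IsAxiom extra B) : Hfthm extra ∅ B := by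
  rcases h with rfl | h | h | h | h | h
  exacts [.extra, .eq h, .hf h, .bool h, .spec h, .ind h]

/-- In coded modus ponens the conclusion is not required to be a formula code. It is one
nevertheless, because components of a translated disjunction are translations. -/
theorem exists_of_code_eq_imp {A B : Fm} {x : HFSet} (h : B.code = cImp A.code x) :
    ∃ C : Fm, B = (A IMP C) ∧ x = C.code := by
  obtain ⟨D, hD⟩ : ∃ D : DBFm, D = B.trans := ⟨_, rfl⟩
  rw [Fm.code, ← hD] at h
  cases D with
  | disj D1 D2 =>
    obtain ⟨B1, B2, rfl, rfl, rfl⟩ := Fm.exists_of_trans_eq_disj hD.symm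
    have h1 := HFSet.pair_inj.1 (HFSet.pair_inj.1 h).2
    refine ⟨B2, ?_, h1.2.symm⟩
    rw [← Fm.code_neg] at h1
    rw [Fm.imp, Fm.code_injective h1.1]
  | _ => simp [DBFm.code, cImp, cMem, cEq, cNeg, cEx, cDisj, HFSet.pair_inj, HFSet.tag_inj] at h

/-- The objects reached by coded proofs are the codes of the theorems. -/
theorem gen_pf_iff {extra : Fm} {x : HFSet} :
    Gen (PfBase extra) PfStep x ↔ ∃ A : Fm, Hfthm extra ∅ A ∧ x = A.code := by
  constructor
  · intro h
    induction h with
    | base h =>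
      obtain ⟨B, hB, h⟩ := h
      exact ⟨B, hB.thm, h⟩
    | step _ _ h ih1 ih2 =>
      obtain ⟨A, hA, rfl⟩ := ih1
      obtain ⟨B, hB, rfl⟩ := ih2
      rcases h with h | ⟨j, C, D, hj, h1, h2⟩ | ⟨v, t, h⟩
      · obtain ⟨C, rfl, rfl⟩ := exists_of_code_eq_imp h
        exact ⟨C, hB.mp' hA, rfl⟩
      · rw [Fm.code_injective h1] at hA
        exact ⟨_, hA.ex_elim hj, h2⟩
      · obtain ⟨j, w, -, -, rfl⟩ := substS_code_iff.1 h
        -- The additional rule of coded proofs is derivable in the calculus.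
        exact ⟨_, hA.subst1 j w, rfl⟩
  · rintro ⟨A, h, rfl⟩
    -- The hypothesis set is made a variable for the induction. It stays empty throughout, since a
    -- union is empty only if both parts are.
    obtain ⟨H, hH⟩ : ∃ H : Set Fm, H = ∅ := ⟨_, rfl⟩
    rw [← hH] at h
    induction h with
    | hyp h => rw [hH] at h; exact absurd h (Set.notMem_empty _)
    | extra => exact .base ⟨_, .inl rfl, rfl⟩
    | eq h => exact .base ⟨_, .inr (.inl h), rfl⟩
    | hf h => exact .base ⟨_, .inr (.inr (.inl h)), rfl⟩
    | bool h => exact .base ⟨_, .inr (.inr (.inr (.inl h))), rfl⟩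
    | spec h => exact .base ⟨_, .inr (.inr (.inr (.inr (.inl h)))), rfl⟩
    | ind h => exact .base ⟨_, .inr (.inr (.inr (.inr (.inr h)))), rfl⟩
    | mp _ _ ih1 ih2 =>
      rw [Set.union_empty_iff] at hH
      exact .step (ih2 hH.2) (ih1 hH.1) (.inl (Fm.code_imp _ _))
    | _ _h hB _hH ih =>
      exact .step (ih hH) (ih hH) (.inr (.inl ⟨_, _, _, hB, rfl, rfl⟩))

/-- Truth of the provability predicate describes actual derivations, whether or not the extra axiom
is true. -/
theorem eval_pfP_quot (extra : Fm) (e : Name → HFSet) (A : Fm) :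
    (pfP extra A.quot).Eval e ↔ Hfthm extra ∅ A := by
  rw [eval_pfP, gen_pf_iff, Fm.eval_quot]
  constructor
  · rintro ⟨B, hB, h⟩
    rwa [Fm.code_injective h]
  · exact fun h => ⟨A, h, rfl⟩


/-! ### The provability predicate is a Sigma sentence -/

/-- No name in `V` occurs in the term. -/
def Avoids (V : Set Name) (t : Tm) : Prop := ∀ v ∈ V, v ∉ t.fv

/-- Sigma formulas in which no name in `V` is free. -/
inductive IsSigma (V : Set Name) : Fm → Prop
  | mem {t u : Tm} : Avoids V t → Avoids V u → IsSigma V (t IN u)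
  | eq {t u : Tm} : Avoids V t → Avoids V u → IsSigma V (t EQ u)
  | neq {t u : Tm} : Avoids V t → Avoids V u → IsSigma V (t NEQ u)
  | disj {A B : Fm} : IsSigma V A → IsSigma V B → IsSigma V (A OR B)
  | conj {A B : Fm} : IsSigma V A → IsSigma V B → IsSigma V (A AND B)
  | exF {ts : List Tm} {P : Tm → Fm} : (∀ a : Tm, Avoids V a → IsSigma V (P a)) →
      IsSigma V (exF ts P)
  | allIn {ts : List Tm} {t : Tm} {P : Tm → Fm} : Avoids V t →
      (∀ a : Tm, Avoids V a → IsSigma V (P a)) → IsSigma V (allIn ts t P)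

namespace IsSigma

variable {V : Set Name} {A : Fm}

/-- The parameter V lets one structural classification serve two purposes: V = {v} shows that v is
not free, and V = ∅ gives Sigma completeness. -/
theorem notMem_fv {v : Name} (h : IsSigma {v} A) : v ∉ A.fv := by
  induction h with
  | mem h1 h2 => simp [Fm.mem_fv, h1 v rfl, h2 v rfl]
  | eq h1 h2 => simp [Fm.eq_fv, h1 v rfl, h2 v rfl]
  | neq h1 h2 => simp [Fm.neq, Fm.neg_fv, Fm.eq_fv, h1 v rfl, h2 v rfl]
  | disj _ _ h1 h2 => simp [Fm.disj_fv, h1, h2]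
  | conj _ _ h1 h2 => simp [Fm.conj, Fm.neg_fv, Fm.disj_fv, h1, h2]
  | @exF ts P _ ih =>
    rw [HFCalc.exF, Fm.ex_fv, Finset.mem_erase, not_and]
    -- If the bound name is v, it is erased. Otherwise the bound variable avoids v and the induction
    -- hypothesis applies.
    exact fun h => ih _ (by simpa [Avoids, Tm.fv] using h)
  | @allIn ts t P h1 _ ih =>
    rw [HFCalc.allIn, Fm.all, Fm.neg_fv, Fm.ex_fv, Fm.neg_fv, Finset.mem_erase, not_and]
    intro h
    have h2 : v ∉ (Tm.var (freshFor (t :: ts))).fv := by simpa [Tm.fv] using h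
    have h3 := ih _ (by simpa [Avoids] using h2)
    simp [Fm.imp, Fm.disj_fv, Fm.neg_fv, Fm.mem_fv, h1 v rfl, h2, h3]

/-- The classification of a body covers all terms in place of its argument, in particular the fresh
variable that is actually bound. Freshness also keeps that variable out of the bound of a universal
quantifier. -/
theorem sigmaComplete (extra : Fm) (h : IsSigma ∅ A) : SigmaComplete extra A := by
  induction h with
  | mem => exact .mem _ _
  | eq => exact .eq _ _
  | neq => exact .neq _ _
  | disj _ _ h1 h2 => exact .disj h1 h2
  | conj _ _ h1 h2 => exact .conj h1 h2
  | exF _ ih => exact .ex _ (ih _ fun _ h => h.elim)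
  | allIn _ _ ih => exact .all_mem (freshFor_notMem (by simp)) (ih _ fun _ h => h.elim)

theorem exF₂ {ts : List Tm} {P : Tm → Tm → Fm}
    (h : ∀ a b, Avoids V a → Avoids V b → IsSigma V (P a b)) : IsSigma V (exF₂ ts P) :=
  .exF fun a ha => .exF fun b hb => h a b ha hb

theorem exF₃ {ts : List Tm} {P : Tm → Tm → Tm → Fm}
    (h : ∀ a b c, Avoids V a → Avoids V b → Avoids V c → IsSigma V (P a b c)) :
    IsSigma V (exF₃ ts P) :=
  .exF fun a ha => .exF₂ fun b c hb hc => h a b c ha hb hc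

theorem exF₄ {ts : List Tm} {P : Tm → Tm → Tm → Tm → Fm}
    (h : ∀ a b c d, Avoids V a → Avoids V b → Avoids V c → Avoids V d → IsSigma V (P a b c d)) :
    IsSigma V (exF₄ ts P) :=
  .exF fun a ha => .exF₃ fun b c d hb hc hd => h a b c d ha hb hc hd

end IsSigma

/-! ### Terms and codes that avoid given names -/

section Avoids

variable {V : Set Name} {t u : Tm}

theorem avoids_zero : Avoids V Tm.zero := fun _ _ => by simp [Tm.fv]

theorem avoids_eats (ht : Avoids V t) (hu : Avoids V u) : Avoids V (Tm.eats t u) :=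
  fun v hv => by simp [Tm.fv, ht v hv, hu v hv]

theorem avoids_succT (ht : Avoids V t) : Avoids V (succT t) := avoids_eats ht ht

theorem avoids_pair (ht : Avoids V t) (hu : Avoids V u) : Avoids V (pair t u) :=
  avoids_eats (avoids_eats avoids_zero (avoids_eats (avoids_eats avoids_zero hu) ht))
    (avoids_eats (avoids_eats avoids_zero ht) ht)

theorem avoids_tag (n : ℕ) : Avoids V (tag n) := by
  induction n with
  | zero => exact avoids_pair avoids_zero avoids_zero
  | succ n ih => exact avoids_pair avoids_zero ih

theorem avoids_ordOf (n : ℕ) : Avoids V (ordOf n) := by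
  induction n with
  | zero => exact avoids_zero
  | succ n ih => exact avoids_succT ih

theorem avoids_qEats (ht : Avoids V t) (hu : Avoids V u) : Avoids V (qEats t u) :=
  avoids_pair (avoids_tag 1) (avoids_pair ht hu)
theorem avoids_qInd (ht : Avoids V t) : Avoids V (qInd t) := avoids_pair (avoids_tag 6) ht
theorem avoids_qMem (ht : Avoids V t) (hu : Avoids V u) : Avoids V (qMem t u) :=
  avoids_pair (avoids_tag 0) (avoids_pair ht hu)
theorem avoids_qEq (ht : Avoids V t) (hu : Avoids V u) : Avoids V (qEq t u) :=
  avoids_pair (avoids_tag 2) (avoids_pair ht hu)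
theorem avoids_qDisj (ht : Avoids V t) (hu : Avoids V u) : Avoids V (qDisj t u) :=
  avoids_pair (avoids_tag 3) (avoids_pair ht hu)
theorem avoids_qNeg (ht : Avoids V t) : Avoids V (qNeg t) := avoids_pair (avoids_tag 4) ht
theorem avoids_qEx (ht : Avoids V t) : Avoids V (qEx t) := avoids_pair (avoids_tag 5) ht
theorem avoids_qImp (ht : Avoids V t) (hu : Avoids V u) : Avoids V (qImp t u) :=
  avoids_qDisj (avoids_qNeg ht) hu
theorem avoids_qAll (ht : Avoids V t) : Avoids V (qAll t) :=
  avoids_qNeg (avoids_qEx (avoids_qNeg ht))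

theorem DBTm.avoids_quot (t : DBTm) : Avoids V t.quot := by
  induction t with
  | zero => exact avoids_zero
  | var i => exact avoids_ordOf _
  | ind k => exact avoids_qInd (avoids_ordOf k)
  | eats t u iht ihu => exact avoids_qEats iht ihu

theorem DBFm.avoids_quot (A : DBFm) : Avoids V A.quot := by
  induction A with
  | mem t u => exact avoids_qMem t.avoids_quot u.avoids_quot
  | eq t u => exact avoids_qEq t.avoids_quot u.avoids_quot
  | disj A B ihA ihB => exact avoids_qDisj ihA ihB
  | neg A ih => exact avoids_qNeg ih
  | ex A ih => exact avoids_qEx ih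

theorem Fm.avoids_quot (A : Fm) : Avoids V A.quot := A.trans.avoids_quot

end Avoids

/-! ### Sigma classification of the coded predicates -/

section IsSigma

variable {V : Set Name} {t u v x x' i s k y y' z p q w r : Tm}

theorem isSigma_subsetP (ht : Avoids V t) (hu : Avoids V u) : IsSigma V (subsetP t u) :=
  .allIn ht fun _ ha => .mem ha hu

theorem isSigma_ordP (ht : Avoids V t) : IsSigma V (ordP t) :=
  .allIn ht fun _ ha => .conj (isSigma_subsetP ha ht) (.allIn ha fun _ hb => isSigma_subsetP hb ha)

theorem isSigma_funP (hr : Avoids V r) : IsSigma V (funP r) :=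
  .allIn hr fun _ h1 => .allIn hr fun _ h2 => .exF₄ fun _ _ _ _ ha hb hc hd =>
    .conj (.eq h1 (avoids_pair ha hb)) <| .conj (.eq h2 (avoids_pair hc hd)) <|
      .conj (isSigma_ordP ha) <| .conj (isSigma_ordP hc) <| .disj (.neq ha hc) (.eq hb hd)

theorem isSigma_lstSeqP (hs : Avoids V s) (hk : Avoids V k) (hy : Avoids V y) :
    IsSigma V (lstSeqP s k y) :=
  .conj (.conj (isSigma_ordP (avoids_succT hk)) <| .conj
    (.allIn (avoids_succT hk) fun _ ha => .exF fun _ hb => .mem (avoids_pair ha hb) hs)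
    (isSigma_funP hs)) (.mem (avoids_pair hk hy) hs)

theorem isSigma_varP (hx : Avoids V x) : IsSigma V (varP x) :=
  .conj (isSigma_ordP hx) (.mem avoids_zero hx)

theorem isSigma_indP (hx : Avoids V x) : IsSigma V (indP x) :=
  .exF fun _ ha => .conj (isSigma_ordP ha) (.eq hx (avoids_qInd ha))

theorem isSigma_termP (ht : Avoids V t) : IsSigma V (termP t) := by
  refine .exF₂ fun s k hs hk => .conj (isSigma_lstSeqP hs hk ht) <|
    .allIn (avoids_succT hk) fun l hl => .exF fun sl hsl =>
      .conj (.mem (avoids_pair hl hsl) hs) <| .disj (.eq hsl avoids_zero) <|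
        .disj (isSigma_varP hsl) <| .exF₄ fun m n sm sn hm hn hsm hsn => ?_
  exact .conj (.mem hm hl) <| .conj (.mem hn hl) <| .conj (.mem (avoids_pair hm hsm) hs) <|
    .conj (.mem (avoids_pair hn hsn) hs) (.eq hsl (avoids_qEats hsm hsn))

theorem isSigma_seqStTermP (hv : Avoids V v) (hu : Avoids V u) (hx : Avoids V x)
    (hx' : Avoids V x') (hs : Avoids V s) (hk : Avoids V k) :
    IsSigma V (seqStTermP v u x x' s k) := by
  refine .conj (isSigma_varP hv) <| .conj (isSigma_lstSeqP hs hk (avoids_pair hx hx')) <|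
    .allIn (avoids_succT hk) fun l hl => .exF₂ fun sl sl' hsl hsl' =>
      .conj (.mem (avoids_pair hl (avoids_pair hsl hsl')) hs) <|
        .disj (.conj (.eq hsl hv) (.eq hsl' hu)) <|
        .disj (.conj (.disj (isSigma_indP hsl) (.conj (isSigma_ordP hsl) (.neq hsl hv)))
          (.eq hsl' hsl)) <|
        .exF₂ fun m n hm hn => .exF₂ fun sm sm' hsm hsm' => .exF₂ fun sn sn' hsn hsn' => ?_
  exact .conj (.mem hm hl) <| .conj (.mem hn hl) <|
    .conj (.mem (avoids_pair hm (avoids_pair hsm hsm')) hs) <|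
    .conj (.mem (avoids_pair hn (avoids_pair hsn hsn')) hs) <|
    .conj (.eq hsl (avoids_qEats hsm hsn)) (.eq hsl' (avoids_qEats hsm' hsn'))

theorem isSigma_abstTermP (hv : Avoids V v) (hi : Avoids V i) (hx : Avoids V x)
    (hx' : Avoids V x') : IsSigma V (abstTermP v i x x') :=
  .conj (isSigma_ordP hi) <| .exF₂ fun _ _ hs hk =>
    isSigma_seqStTermP hv (avoids_qInd hi) hx hx' hs hk

theorem isSigma_substTermP (hv : Avoids V v) (hu : Avoids V u) (hx : Avoids V x)
    (hx' : Avoids V x') : IsSigma V (substTermP v u x x') :=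
  .conj (isSigma_termP hu) <| .exF₂ fun _ _ hs hk => isSigma_seqStTermP hv hu hx hx' hs hk

theorem isSigma_abstAtomicP (hv : Avoids V v) (hi : Avoids V i) (hy : Avoids V y)
    (hy' : Avoids V y') : IsSigma V (abstAtomicP v i y y') :=
  .exF₄ fun _ _ _ _ h1 h2 h3 h4 => .conj (isSigma_abstTermP hv hi h1 h3) <|
    .conj (isSigma_abstTermP hv hi h2 h4) <|
      .disj (.conj (.eq hy (avoids_qEq h1 h2)) (.eq hy' (avoids_qEq h3 h4)))
        (.conj (.eq hy (avoids_qMem h1 h2)) (.eq hy' (avoids_qMem h3 h4)))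

theorem isSigma_substAtomicP (hv : Avoids V v) (hu : Avoids V u) (hy : Avoids V y)
    (hy' : Avoids V y') : IsSigma V (substAtomicP v u y y') :=
  .exF₄ fun _ _ _ _ h1 h2 h3 h4 => .conj (isSigma_substTermP hv hu h1 h3) <|
    .conj (isSigma_substTermP hv hu h2 h4) <|
      .disj (.conj (.eq hy (avoids_qEq h1 h2)) (.eq hy' (avoids_qEq h3 h4)))
        (.conj (.eq hy (avoids_qMem h1 h2)) (.eq hy' (avoids_qMem h3 h4)))

theorem isSigma_abstFormP (hv : Avoids V v) (hi : Avoids V i) (hx : Avoids V x)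
    (hx' : Avoids V x') : IsSigma V (abstFormP v i x x') := by
  refine .conj (isSigma_varP hv) <| .conj (isSigma_ordP hi) <| .exF₂ fun s k hs hk =>
    .conj (isSigma_lstSeqP hs hk (avoids_pair hi (avoids_pair hx hx'))) <|
    .allIn (avoids_succT hk) fun l hl => .exF₃ fun sli sl sl' hsli hsl hsl' =>
      .conj (.mem (avoids_pair hl (avoids_pair hsli (avoids_pair hsl hsl'))) hs) <|
      .disj (isSigma_abstAtomicP hv hsli hsl hsl') <| .conj (isSigma_ordP hsli) <|
      .exF₂ fun m n hm hn => .exF₃ fun smi sm sm' hsmi hsm hsm' =>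
      .exF₃ fun sni sn sn' hsni hsn hsn' => ?_
  exact .conj (.mem hm hl) <| .conj (.mem hn hl) <|
    .conj (.mem (avoids_pair hm (avoids_pair hsmi (avoids_pair hsm hsm'))) hs) <|
    .conj (.mem (avoids_pair hn (avoids_pair hsni (avoids_pair hsn hsn'))) hs) <|
    .disj (.conj (.eq hsli hsmi) <| .conj (.eq hsli hsni) <|
      .conj (.eq hsl (avoids_qDisj hsm hsn)) (.eq hsl' (avoids_qDisj hsm' hsn'))) <|
    .disj (.conj (.eq hsli hsmi) <|
      .conj (.eq hsl (avoids_qNeg hsm)) (.eq hsl' (avoids_qNeg hsm'))) <|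
    .conj (.eq (avoids_succT hsli) hsmi) <|
      .conj (.eq hsl (avoids_qEx hsm)) (.eq hsl' (avoids_qEx hsm'))

theorem isSigma_substFormP (hv : Avoids V v) (hu : Avoids V u) (hx : Avoids V x)
    (hx' : Avoids V x') : IsSigma V (substFormP v u x x') := by
  refine .conj (isSigma_varP hv) <| .conj (isSigma_termP hu) <| .exF₂ fun s k hs hk =>
    .conj (isSigma_lstSeqP hs hk (avoids_pair hx hx')) <|
    .allIn (avoids_succT hk) fun l hl => .exF₂ fun sl sl' hsl hsl' =>
      .conj (.mem (avoids_pair hl (avoids_pair hsl hsl')) hs) <|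
      .disj (isSigma_substAtomicP hv hu hsl hsl') <|
      .exF₂ fun m n hm hn => .exF₂ fun sm sm' hsm hsm' => .exF₂ fun sn sn' hsn hsn' => ?_
  exact .conj (.mem hm hl) <| .conj (.mem hn hl) <|
    .conj (.mem (avoids_pair hm (avoids_pair hsm hsm')) hs) <|
    .conj (.mem (avoids_pair hn (avoids_pair hsn hsn')) hs) <|
    .disj (.conj (.eq hsl (avoids_qDisj hsm hsn)) (.eq hsl' (avoids_qDisj hsm' hsn'))) <|
    .disj (.conj (.eq hsl (avoids_qNeg hsm)) (.eq hsl' (avoids_qNeg hsm'))) <|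
    .conj (.eq hsl (avoids_qEx hsm)) (.eq hsl' (avoids_qEx hsm'))

theorem isSigma_formP (hy : Avoids V y) : IsSigma V (formP y) := by
  refine .exF₂ fun s k hs hk => .conj (isSigma_lstSeqP hs hk hy) <|
    .allIn (avoids_succT hk) fun n hn => .exF fun sn hsn =>
      .conj (.mem (avoids_pair hn hsn) hs) <| .disj
        (.exF₂ fun t u ht hu => .conj (isSigma_termP ht) <| .conj (isSigma_termP hu) <|
          .disj (.eq hsn (avoids_qEq ht hu)) (.eq hsn (avoids_qMem ht hu))) <|
        .exF₄ fun m l sm sl hm hl hsm hsl => ?_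
  exact .conj (.mem hm hn) <| .conj (.mem hl hn) <| .conj (.mem (avoids_pair hm hsm) hs) <|
    .conj (.mem (avoids_pair hl hsl) hs) <| .disj (.eq hsn (avoids_qDisj hsm hsl)) <|
    .disj (.eq hsn (avoids_qNeg hsm)) <| .exF₂ fun v au hv hau =>
      .conj (isSigma_abstFormP hv avoids_zero hsm hau) (.eq hsn (avoids_qEx hau))

theorem isSigma_varNonOccFormP (hv : Avoids V v) (hy : Avoids V y) :
    IsSigma V (varNonOccFormP v y) :=
  .conj (isSigma_formP hy) (isSigma_substFormP hv avoids_zero hy hy)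

theorem isSigma_booleanAxP (hp : Avoids V p) : IsSigma V (booleanAxP p) :=
  .exF₃ fun _ _ _ hx hy hz => .conj (isSigma_formP hx) <| .conj (isSigma_formP hy) <|
    .conj (isSigma_formP hz) <| .disj (.eq hp (avoids_qImp hx hx)) <|
    .disj (.eq hp (avoids_qImp hx (avoids_qDisj hx hy))) <|
    .disj (.eq hp (avoids_qImp (avoids_qDisj hx hx) hx)) <|
    .disj (.eq hp (avoids_qImp (avoids_qDisj hx (avoids_qDisj hy hz))
      (avoids_qDisj (avoids_qDisj hx hy) hz))) <|
    .eq hp (avoids_qImp (avoids_qDisj hz hx)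
      (avoids_qImp (avoids_qDisj (avoids_qNeg hz) hy) (avoids_qDisj hx hy)))

theorem isSigma_specialAxP (hp : Avoids V p) : IsSigma V (specialAxP p) :=
  .exF₃ fun _ _ _ hv ht hx => .exF₂ fun _ _ hxt hax => .conj (isSigma_formP hx) <|
    .conj (isSigma_substFormP hv ht hx hxt) <| .conj (isSigma_abstFormP hv avoids_zero hx hax) <|
    .eq hp (avoids_qImp hxt (avoids_qEx hax))

theorem isSigma_inductionAxP (hp : Avoids V p) : IsSigma V (inductionAxP p) :=
  .exF₃ fun _ _ _ hv hw hx => .exF₃ fun _ _ _ hx0 hxw hxevw => .exF₃ fun _ _ _ haw havw hav =>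
    .conj (.neq hv hw) <| .conj (isSigma_varNonOccFormP hw hx) <|
    .conj (isSigma_substFormP hv avoids_zero hx hx0) <| .conj (isSigma_substFormP hv hw hx hxw) <|
    .conj (isSigma_substFormP hv (avoids_qEats hv hw) hx hxevw) <|
    .conj (isSigma_abstFormP hw avoids_zero (avoids_qImp hx (avoids_qImp hxw hxevw)) haw) <|
    .conj (isSigma_abstFormP hv avoids_zero (avoids_qAll haw) havw) <|
    .conj (isSigma_abstFormP hv avoids_zero hx hav) <|
    .eq hp (avoids_qImp hx0 (avoids_qImp (avoids_qAll havw) (avoids_qAll hav)))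

theorem isSigma_axiomP (extra : Fm) (hp : Avoids V p) : IsSigma V (axiomP extra p) :=
  .disj (.eq hp extra.avoids_quot) <| .disj (.eq hp reflAx.avoids_quot) <|
    .disj (.eq hp eqCongAx.avoids_quot) <| .disj (.eq hp memCongAx.avoids_quot) <|
    .disj (.eq hp eatsCongAx.avoids_quot) <| .disj (.eq hp hf1.avoids_quot) <|
    .disj (.eq hp hf2.avoids_quot) <| .disj (isSigma_booleanAxP hp) <|
    .disj (isSigma_specialAxP hp) (isSigma_inductionAxP hp)

theorem isSigma_existsP (hp : Avoids V p) (hq : Avoids V q) : IsSigma V (existsP p q) :=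
  .exF₄ fun _ _ _ _ hv hx hax hy => .conj (isSigma_formP hx) <|
    .conj (isSigma_varNonOccFormP hv hy) <| .conj (isSigma_abstFormP hv avoids_zero hx hax) <|
    .conj (.eq hp (avoids_qImp hx hy)) (.eq hq (avoids_qImp (avoids_qEx hax) hy))

theorem isSigma_pfP (extra : Fm) (hy : Avoids V y) : IsSigma V (pfP extra y) := by
  refine .exF₂ fun s k hs hk => .conj (isSigma_lstSeqP hs hk hy) <|
    .allIn (avoids_succT hk) fun n hn => .exF fun sn hsn =>
      .conj (.mem (avoids_pair hn hsn) hs) <| .disj (isSigma_axiomP extra hsn) <|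
        .exF₄ fun m l sm sl hm hl hsm hsl => ?_
  exact .conj (.mem hm hn) <| .conj (.mem hl hn) <| .conj (.mem (avoids_pair hm hsm) hs) <|
    .conj (.mem (avoids_pair hl hsl) hs) <| .disj (.eq hsl (avoids_qImp hsm hsn)) <|
    .disj (isSigma_existsP hsm hsn) <| .exF₂ fun v t hv ht => isSigma_substFormP hv ht hsm hsn

end IsSigma

theorem pfP_quot_fv (extra A : Fm) : (pfP extra A.quot).fv = ∅ :=
  Finset.eq_empty_of_forall_notMem fun _ => (isSigma_pfP extra A.avoids_quot).notMem_fv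

/-- A Sigma sentence is provable if and only if it is true. -/
theorem SigmaComplete.thm_iff_eval {extra F : Fm} (hextra : ∀ e : Name → HFSet, extra.Eval e)
    (hF : SigmaComplete extra F) (hfv : F.fv = ∅) (e : Name → HFSet) :
    Hfthm extra ∅ F ↔ F.Eval e := by
  -- A sentence is its own closed instance, so completeness for closed instances applies to it
  -- directly.
  have hsub : F.subst (fun _ => Tm.zero) = F := by
    conv_rhs => rw [← F.subst_var]
    exact Fm.subst_congr fun v hv => by simp [hfv] at hv
  refine ⟨fun h => h.sound hextra e fun _ hC => hC.elim, fun h => ?_⟩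
  have h1 := hF (fun _ => .zero) e (fun _ => rfl)
  rw [hsub] at h1
  exact h1 h

end HFCalc

theorem mainTheorem5 (extra : HFCalc.Fm)
    (hextra : ∀ e : HFCalc.Name → HFCalc.HFSet, HFCalc.Fm.Eval e extra) (A : HFCalc.Fm) :
    HFCalc.Hfthm extra ∅ A ↔ HFCalc.Hfthm extra ∅ (HFCalc.pfP extra (HFCalc.Fm.quot A)) := by
  have h1 := HFCalc.eval_pfP_quot extra (fun _ => HFCalc.HFSet.empty) A
  have h2 := (HFCalc.isSigma_pfP extra A.avoids_quot).sigmaComplete extra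
  have h3 := HFCalc.pfP_quot_fv extra A
  -- Only three facts about the sentence remain relevant: its truth means provability of A, it is
  -- Sigma complete, and it is closed.
  generalize HFCalc.pfP extra A.quot = F at h1 h2 h3 ⊢
  rw [← h1, h2.thm_iff_eval hextra h3]
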